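/- **Realisers and programs.** Let $D$ be the Scott domain which solves $D=(\mathbf{Nil}+\mathbf{Left}(D)+\mathbf{Right}(D)+\mathbf{Pair}(D\times D)+\mathbf{Fun}(D\to D)+\mathbf{Amb}(D\times D))_\bot$, with $D\to D$ the continuous functions, and application $\mathbf{Fun}(f)\,a=f(a)$, $c\,a=\bot$ for other $c$. *Programs* are the terms built from variables, $\mathbf{Nil}$, $\mathbf{Left}(M)$, $\mathbf{Right}(M)$, $\mathbf{Pair}(M,N)$, $\mathbf{Amb}(M,N)$, case distinction on the head constructor (including the pattern $\mathbf{fun}(a)$ for functions and the pattern $\mathbf{Amb}(a,b)$), $\lambda a.M$, $M\,N$, $\mathbf{rec}\,M$ (least fixed point) and $\bot$; a closed program $M$ denotes an element $[\![M]\!]\in D$. A program is *sequential* if $\mathbf{Amb}(\cdot,\cdot)$ is not used in it as a term former. *Types* are subdomains of $D$: $1=\{\bot,\mathbf{Nil}\}$; besides $\bot$, $T+U$ consists of the $\mathbf{Left}(a)$ and $\mathbf{Right}(b)$, $T\times U$ of the $\mathbf{Pair}(a,b)$ with $a\in T$, $b\in U$, and $\mathbf A(T)$ of the $\mathbf{Amb}(a,b)$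 with $a,b\in T$; $T\Rightarrow U$ consists of $\bot$ and the $\mathbf{Fun}(f)$ with $f(T)\subseteq U$; $\mathbf{fix}\,\alpha.\varphi(\alpha)$ is the subdomain solving $\alpha=\varphi(\alpha)$. Every formula $A$ below has a type $\tau(A)$ and realisers $a\;\mathbf r\;A$, where $\tau$ maps $\vee,\wedge,\to,\downdownarrows$ to $+,\times,\Rightarrow,\mathbf A$, ignores quantifiers, and maps least and greatest fixed points to $\mathbf{fix}$. A formula without computational content (that is, an equation, an inequality, $K\neq\emptyset$, compactness, an inclusion $K\subseteq\mathbf{II}_E$, or $d\in E$ for a set $E$ of digits) is realised by $\mathbf{Nil}$ if and only if it is true, and is dropped from conjunctions and premises: if $A$ is such a formula, then $b\;\mathbf r\;(A\to B)$ iff $b\in\tau(B)$ and ($A$ implies $b\;\mathbf r\;B$), and $b\;\mathbf r\;(A\wedge B)$ iff $A$ holds and $b\;\mathbf r\;B$. Otherwise $A\wedge B$ is realised by pairs, $A\vee B$ by $\mathbf{Left}$ or $\mathbf{Right}$ of a realiser, $c\;\mathbf r\;(A\to B)$ iff $c\in\tau(A)\Rightarrow\tau(B)$ and $a\;\mathbf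 r\;A$ implies $(c\,a)\;\mathbf r\;B$; quantifiers over reals and over sets of reals are uniform (a realiser of $\forall x\,A$ realises all instances, a realiser of $\exists x\,A$ realises some instance), and bounded quantifiers abbreviate $\forall x\,(x\in P\to A)$ and $\exists x\,(x\in P\wedge A)$. Further, $c\;\mathbf r\;\downdownarrows A$ iff $c=\mathbf{Amb}(a,b)$ with $a,b\in\tau(A)$, not both $\bot$, each of which realises $A$ if it is $\neq\bot$; and $\downdownarrows^{*}A$ is the least solution $X$ of $X\leftrightarrow\;\downdownarrows(A\vee X)$. Least ($\overset\mu=$) and greatest ($\overset\nu=$) solutions are realised by the least and greatest solutions of the resulting conditions on realisers. As to truth, $\downdownarrows A$ is equivalent to $A$. **Compact sets.** For reals let $\mathbf{SD}(d):=(d=-1\vee d=1)\vee d=0$, $\mathbf{GC}(d):=d=-1\vee d=1$, $\mathbf t(x)=1-2|x|$, $\mathbf{II}_d=\{x:|2x-d|\le1\}$, $\mathbf{II}_E=\bigcup_{d\in E}\mathbf{II}_d$, and for $K\subseteq\mathbb R$ let $K_d=K\cap\mathbf{II}_d$ and $\mathrm{av}_d^{-1}[K_d]=\{2x-d:x\in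 K_d\}$. Let $\mathbf K(K)$ say that $K$ is a non-empty compact subset of $[-1,1]$. Put - $\mathbf P_{\mathbf{fin}}(P)(u)\overset\mu=(\exists x\in P)\,u=\{x\}\ \vee\ (\exists v\in\mathbf P_{\mathbf{fin}}(P))(\exists y\in P)\,u=v\cup\{y\}$; - $\mathbf G(x)\overset\nu=-1\le x\le1\ \wedge\ (x\neq0\to(x\le0\vee x\ge0))\ \wedge\ \mathbf G(\mathbf t(x))$; - $\mathbf S_{\mathbf K}(K)\overset\nu=\mathbf K(K)\wedge(\exists E\in\mathbf P_{\mathbf{fin}}(\mathbf{SD}))\,\bigl(K\subseteq\mathbf{II}_E\wedge(\forall d\in E)(K_d\neq\emptyset\wedge\mathbf S_{\mathbf K}(\mathrm{av}_d^{-1}[K_d]))\bigr)$; - $\mathbf G_{\mathbf K}(K)\overset\nu=\mathbf K(K)\wedge\mathbf G(\min K)\wedge\mathbf G(\max K)\wedge(\forall d\in\mathbf{GC})(K_d\neq\emptyset\to\mathbf G_{\mathbf K}(\mathbf t[K_d]))$; - $\mathbf S^{*}_{\mathbf K}(K)\overset\nu=\mathbf K(K)\wedge\downdownarrows^{*}\bigl((\exists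 E\in\mathbf P_{\mathbf{fin}}(\mathbf{SD}))\,(K\subseteq\mathbf{II}_E\wedge(\forall d\in E)(K_d\neq\emptyset\wedge\mathbf S^{*}_{\mathbf K}(\mathrm{av}_d^{-1}[K_d])))\bigr)$. Here $(\forall d\in E)\,B(d)$ is read as $(\forall d\in\mathbf{SD})(d\in E\to B(d))$, so that it is realised by a function from digit codes to realisers, i.e. by a family of subtrees indexed by the digits in $E$. The realisers of $\mathbf S_{\mathbf K}(K)$, $\mathbf G_{\mathbf K}(K)$ and $\mathbf S^{*}_{\mathbf K}(K)$ are the signed-digit trees, the Gray-code trees and the concurrent signed-digit trees of $K$. **Theorem.** $\mathbf S_{\mathbf K}\subseteq\mathbf G_{\mathbf K}\subseteq\mathbf S^{*}_{\mathbf K}$, as sets and effectively: 1. there is a sequential closed program $M$ such that, for all $K\subseteq\mathbb R$, $[\![M]\!]$ realises $\mathbf S_{\mathbf K}(K)\to\mathbf G_{\mathbf K}(K)$; that is, $[\![M]\!]$ belongs to $\tau(\mathbf S_{\mathbf K})\Rightarrow\tau(\mathbf G_{\mathbf K})$ and maps each signed-digit tree of $K$ to a Gray-code tree of $K$; 2.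 there is a closed program $N$ such that, for all $K\subseteq\mathbb R$, $[\![N]\!]$ realises $\mathbf G_{\mathbf K}(K)\to\mathbf S^{*}_{\mathbf K}(K)$; that is, $[\![N]\!]$ belongs to $\tau(\mathbf G_{\mathbf K})\Rightarrow\tau(\mathbf S^{*}_{\mathbf K})$ and maps each Gray-code tree of $K$ to a concurrent signed-digit tree of $K$. -/

import Mathlib

namespace CFP

open OmegaCompletePartialOrder

/-! ## The domain of realisers -/

/-- One unfolding `X ↦ (Nil + Left X + Right X + Pair (X × X) + Fun (X → X) + Amb (X × X))_⊥`
of the domain equation. -/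
inductive Node (X : Type) [Preorder X] : Type
  | bot : Node X
  | nil : Node X
  | left (x : X) : Node X
  | right (x : X) : Node X
  | pair (x y : X) : Node X
  | fn (f : X →o X) : Node X
  | amb (x y : X) : Node X

namespace Node

variable {X Y Z : Type}

/-- `⊥` is least, different constructors are incomparable, equal ones are compared by arguments. -/
inductive Le [Preorder X] : Node X → Node X → Prop
  | bot (b : Node X) : Le Node.bot b
  | nil : Le Node.nil Node.nil
  | left {x x' : X} (h : x ≤ x') : Le (Node.left x) (Node.left x')
  | right {x x' : X} (h : x ≤ x') : Le (Node.right x) (Node.right x')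
  | pair {x x' y y' : X} (h : x ≤ x') (k : y ≤ y') : Le (Node.pair x y) (Node.pair x' y')
  | fn {f f' : X →o X} (h : f ≤ f') : Le (Node.fn f) (Node.fn f')
  | amb {x x' y y' : X} (h : x ≤ x') (k : y ≤ y') : Le (Node.amb x y) (Node.amb x' y')

instance instPartialOrder [PartialOrder X] : PartialOrder (Node X) where
  le := Le
  le_refl a := by cases a <;> constructor <;> exact le_rfl
  le_trans a b c h k := by
    cases h <;> cases k <;> constructor <;> exact le_trans ‹_› ‹_›
  le_antisymm a b h k := by
    cases h <;> cases k <;> first | rfl | (congr <;> exact le_antisymm ‹_› ‹_›)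

instance instFinite [PartialOrder X] [Finite X] : Finite (Node X) := by
  have : Finite (X →o X) := DFunLike.finite _
  let e : Node X → Unit ⊕ Unit ⊕ X ⊕ X ⊕ (X × X) ⊕ (X →o X) ⊕ (X × X) := fun a =>
    match a with
    | .bot => .inl ()
    | .nil => .inr (.inl ())
    | .left x => .inr (.inr (.inl x))
    | .right x => .inr (.inr (.inr (.inl x)))
    | .pair x y => .inr (.inr (.inr (.inr (.inl (x, y)))))
    | .fn f => .inr (.inr (.inr (.inr (.inr (.inl f)))))
    | .amb x y => .inr (.inr (.inr (.inr (.inr (.inr (x, y))))))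
  refine Finite.of_injective e ?_
  intro a b h
  cases a <;> cases b <;> simp_all [e]

/-- Functoriality in embedding-projection pairs. -/
def map [PartialOrder X] [PartialOrder Y] (u : X →o Y) (v : Y →o X) : Node X →o Node Y where
  toFun a :=
    match a with
    | .bot => .bot
    | .nil => .nil
    | .left x => .left (u x)
    | .right x => .right (u x)
    | .pair x y => .pair (u x) (u y)
    | .fn f => .fn (u.comp (f.comp v))
    | .amb x y => .amb (u x) (u y)
  monotone' a b h := by
    cases h <;> constructor
    all_goals first
      | exact u.monotone ‹_›
      | (rename_i h; exact fun y => u.monotone (h (v y)))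

end Node

/-- The `n`-th finite approximation of the domain. -/
def Lvl : ℕ → Σ X : Type, PartialOrder X
  | 0 => ⟨Unit, inferInstance⟩
  | n + 1 => letI := (Lvl n).2; ⟨Node (Lvl n).1, inferInstance⟩

/-- The underlying type of the `n`-th approximation. -/
abbrev L (n : ℕ) : Type := (Lvl n).1

instance (n : ℕ) : PartialOrder (L n) := (Lvl n).2

instance instFiniteL : ∀ n, Finite (L n)
  | 0 => inferInstanceAs (Finite Unit)
  | n + 1 => letI := instFiniteL n; inferInstanceAs (Finite (Node (L n)))

/-- The least element of the `n`-th approximation. -/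
def L.bot : ∀ n, L n
  | 0 => ()
  | n + 1 => (Node.bot : Node (L n))

theorem L.bot_le : ∀ n (x : L n), L.bot n ≤ x
  | 0, _ => le_rfl
  | n + 1, x => Node.Le.bot (X := L n) x

/-- The canonical maps `L n → L m` and `L m → L n`. -/
def conn : ∀ n m, (L n →o L m) × (L m →o L n)
  | 0, m => (OrderHom.const _ (L.bot m), OrderHom.const _ (L.bot 0))
  | n + 1, 0 => (OrderHom.const _ (L.bot 0), OrderHom.const _ (L.bot (n + 1)))
  | n + 1, m + 1 =>
    (Node.map (X := L n) (Y := L m) (conn n m).1 (conn n m).2,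
     Node.map (X := L m) (Y := L n) (conn n m).2 (conn n m).1)

/-- The canonical map `L n → L m`: the embedding for `n ≤ m`, the projection for `m ≤ n`. -/
def tr (n m : ℕ) : L n →o L m := (conn n m).1

theorem conn_swap : ∀ n m, (conn n m).swap = conn m n
  | 0, 0 => rfl
  | 0, m + 1 => rfl
  | n + 1, 0 => rfl
  | n + 1, m + 1 => by
    change (Node.map (X := L m) (Y := L n) (conn n m).swap.1 (conn n m).swap.2,
      Node.map (X := L n) (Y := L m) (conn n m).swap.2 (conn n m).swap.1) = _
    rw [conn_swap n m]; rfl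

theorem tr_succ (n m : ℕ) :
    tr (n + 1) (m + 1) = Node.map (X := L n) (Y := L m) (tr n m) (tr m n) := by
  have h : tr m n = (conn n m).2 := by rw [tr, ← conn_swap n m]; rfl
  rw [h]; rfl

theorem tr_zero (n : ℕ) (x : L 0) : tr 0 n x = L.bot n := by cases n <;> rfl

theorem tr_bot : ∀ n m, tr n m (L.bot n) = L.bot m
  | 0, m => tr_zero m _
  | n + 1, 0 => rfl
  | n + 1, m + 1 => by rw [tr_succ]; rfl

theorem tr_tr : ∀ (n m k : ℕ), (n ≤ m ∨ k ≤ m) → ∀ x : L n, tr m k (tr n m x) = tr n k x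
  | 0, m, k, _, x => by rw [tr_zero, tr_zero, tr_bot]
  | n + 1, 0, k, h, _ => by
    obtain rfl : k = 0 := by omega
    rfl
  | n + 1, m + 1, 0, _, _ => rfl
  | n + 1, m + 1, k + 1, h, x => by
    have ih := tr_tr n m k (by omega)
    have ih' := tr_tr k m n (by omega)
    rw [tr_succ, tr_succ, tr_succ]
    have hx : ∀ x : Node (L n), Node.map (tr m k) (tr k m) (Node.map (tr n m) (tr m n) x)
        = Node.map (tr n k) (tr k n) x := by
      intro x
      cases x with
      | bot => rfl
      | nil => rfl
      | left x => exact congrArg Node.left (ih x)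
      | right x => exact congrArg Node.right (ih x)
      | pair x y => exact congrArg₂ Node.pair (ih x) (ih y)
      | amb x y => exact congrArg₂ Node.amb (ih x) (ih y)
      | fn f =>
        refine congrArg Node.fn (OrderHom.ext _ _ (funext fun y => ?_))
        change tr m k (tr n m (f (tr m n (tr k m y)))) = tr n k (f (tr k n y))
        rw [ih', ih]
    exact hx x

theorem tr_self : ∀ n (x : L n), tr n n x = x
  | 0, _ => rfl
  | n + 1, x => by
    have ih := tr_self n
    rw [tr_succ]
    have hx : ∀ x : Node (L n), Node.map (tr n n) (tr n n) x = x := by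
      intro x
      cases x with
      | bot => rfl
      | nil => rfl
      | left x => exact congrArg Node.left (ih x)
      | right x => exact congrArg Node.right (ih x)
      | pair x y => exact congrArg₂ Node.pair (ih x) (ih y)
      | amb x y => exact congrArg₂ Node.amb (ih x) (ih y)
      | fn f =>
        refine congrArg Node.fn (OrderHom.ext _ _ (funext fun y => ?_))
        change tr n n (f (tr n n y)) = f y
        rw [ih, ih]
    exact hx x

/-- The domain `D`, the inverse limit of its finite approximations. -/
def D : Type := {x : ∀ n, L n // ∀ n, tr (n + 1) n (x (n + 1)) = x n}

namespace D

instance : PartialOrder D := inferInstanceAs (PartialOrder {x : ∀ n, L n // _})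

/-- The supremum of an increasing sequence is computed levelwise; every level is finite. -/
noncomputable instance : OmegaCompletePartialOrder D where
  ωSup c := ⟨fun n => monotonicSequenceLimit ⟨fun i => (c i).1 n, fun _ _ h => c.monotone h n⟩, by
    intro n
    set a : ℕ →o L n := ⟨fun i => (c i).1 n, fun _ _ h => c.monotone h n⟩
    set b : ℕ →o L (n + 1) := ⟨fun i => (c i).1 (n + 1), fun _ _ h => c.monotone h (n + 1)⟩
    refine le_antisymm ?_ ?_
    · change tr (n + 1) n ((c _).1 (n + 1)) ≤ _
      rw [(c _).2 n]
      exact le_monotonicSequenceLimit a _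
    · change (c _).1 n ≤ _
      rw [← (c _).2 n]
      exact (tr (n + 1) n).monotone (le_monotonicSequenceLimit b _)⟩
  le_ωSup c i n :=
    le_monotonicSequenceLimit (⟨fun i => (c i).1 n, fun _ _ h => c.monotone h n⟩ : ℕ →o L n) i
  ωSup_le _ _ h n := h _ n

instance : OrderBot D where
  bot := ⟨L.bot, fun n => tr_bot (n + 1) n⟩
  bot_le x n := L.bot_le n (x.1 n)

/-- An element of `D` given by its head constructor on all levels. -/
def mk (x : ∀ n, Node (L n))
    (hx : ∀ n, Node.map (tr (n + 1) n) (tr n (n + 1)) (x (n + 1)) = x n) : D :=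
  ⟨fun n => match n with
    | 0 => ()
    | n + 1 => x n, fun n => match n with
    | 0 => rfl
    | n + 1 => by rw [tr_succ]; exact hx n⟩

def nil : D := mk (fun _ => .nil) fun _ => rfl

def left (a : D) : D := mk (fun n => .left (a.1 n)) fun n => congrArg Node.left (a.2 n)

def right (a : D) : D := mk (fun n => .right (a.1 n)) fun n => congrArg Node.right (a.2 n)

def pair (a b : D) : D :=
  mk (fun n => .pair (a.1 n) (b.1 n)) fun n => congrArg₂ Node.pair (a.2 n) (b.2 n)

def amb (a b : D) : D :=
  mk (fun n => .amb (a.1 n) (b.1 n)) fun n => congrArg₂ Node.amb (a.2 n) (b.2 n)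

/-- The embedding of the `n`-th approximation into `D`. -/
def emb (n : ℕ) : L n →o D where
  toFun x := ⟨fun m => tr n m x, fun m => tr_tr n (m + 1) m (Or.inr (by omega)) x⟩
  monotone' _ _ h m := (tr n m).monotone h

/-- The projection of `D` to the `n`-th approximation. -/
def proj (n : ℕ) : D →o L n := ⟨fun x => x.1 n, fun _ _ h => h n⟩

/-- The element of `D` that represents the continuous function `f`. -/
noncomputable def fn (f : D →𝒄 D) : D :=
  mk (fun n => .fn ((proj n).comp (f.toOrderHom.comp (emb n)))) fun n => by
    refine congrArg Node.fn (OrderHom.ext _ _ (funext fun x => ?_))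
    change tr (n + 1) n ((f (emb (n + 1) (tr n (n + 1) x))).1 (n + 1)) = (f (emb n x)).1 n
    rw [(f _).2 n]
    have h : emb (n + 1) (tr n (n + 1) x) = emb n x :=
      Subtype.ext (funext fun m => tr_tr n (n + 1) m (Or.inl (by omega)) x)
    rw [h]


theorem mk_inj {x y : ∀ n, Node (L n)} {hx hy} (h : mk x hx = mk y hy) (n : ℕ) : x n = y n :=
  congrFun (congrArg Subtype.val h) (n + 1)

theorem left_inj {a a' : D} (h : left a = left a') : a = a' :=
  Subtype.ext (funext fun n => Node.left.inj (mk_inj h n))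

theorem right_inj {a a' : D} (h : right a = right a') : a = a' :=
  Subtype.ext (funext fun n => Node.right.inj (mk_inj h n))

theorem pair_inj {a b a' b' : D} (h : pair a b = pair a' b') : a = a' ∧ b = b' :=
  ⟨Subtype.ext (funext fun n => (Node.pair.inj (mk_inj h n)).1),
    Subtype.ext (funext fun n => (Node.pair.inj (mk_inj h n)).2)⟩

theorem amb_inj {a b a' b' : D} (h : amb a b = amb a' b') : a = a' ∧ b = b' :=
  ⟨Subtype.ext (funext fun n => (Node.amb.inj (mk_inj h n)).1),
    Subtype.ext (funext fun n => (Node.amb.inj (mk_inj h n)).2)⟩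

theorem tr_proj {n m : ℕ} (h : m ≤ n) (x : D) : tr n m (x.1 n) = x.1 m := by
  induction n, h using Nat.le_induction with
  | base => exact tr_self m _
  | succ n h ih => rw [← tr_tr (n + 1) n m (Or.inr h), x.2 n, ih]

theorem tr_mono : ∀ (n m : ℕ) (x : L n), n ≤ m → ∀ k, tr n k x ≤ tr m k (tr n m x)
  | n, m, x, h, k => by rw [tr_tr n m k (Or.inl h)]

theorem tr_tr_le : ∀ (n m : ℕ) (x : L n), tr m n (tr n m x) ≤ x
  | 0, _, _ => le_rfl
  | n + 1, 0, x => L.bot_le (n + 1) x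
  | n + 1, m + 1, x => by
    have ih := tr_tr_le n m
    have hx : ∀ x : Node (L n),
        Node.map (tr m n) (tr n m) (Node.map (tr n m) (tr m n) x) ≤ x := by
      intro x
      cases x with
      | bot => exact .bot _
      | nil => exact .nil
      | left x => exact .left (ih x)
      | right x => exact .right (ih x)
      | pair x y => exact .pair (ih x) (ih y)
      | amb x y => exact .amb (ih x) (ih y)
      | fn f =>
        refine .fn fun y => ?_
        change tr m n (tr n m (f (tr m n (tr n m y)))) ≤ f y
        exact (ih _).trans (f.monotone (ih y))
    rw [tr_succ, tr_succ]
    exact hx x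

theorem emb_proj_mono (x : D) : Monotone fun n => emb n (proj n x) := by
  refine monotone_nat_of_le_succ fun n m => ?_
  change tr n m (x.1 n) ≤ tr (n + 1) m (x.1 (n + 1))
  rcases le_or_gt m n with h | h
  · rw [tr_proj h, tr_proj (by omega)]
  · rw [← x.2 n, ← tr_tr n (n + 1) m (Or.inl (by omega))]
    exact (tr (n + 1) m).monotone ((tr_tr_le (n + 1) n (x.1 (n + 1))))

/-- Every element is the supremum of its finite approximations. -/
theorem ωSup_emb_proj (x : D) : ωSup ⟨⟨fun n => emb n (proj n x), emb_proj_mono x⟩⟩ = x := by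
  refine le_antisymm (ωSup_le _ _ fun n m => ?_) fun n => ?_
  · change tr n m (x.1 n) ≤ x.1 m
    rcases le_or_gt m n with h | h
    · rw [tr_proj h]
    · rw [← tr_proj h.le x]; exact tr_tr_le m n _
  · have := le_ωSup (⟨⟨fun n => emb n (proj n x), emb_proj_mono x⟩⟩ : Chain D) n n
    refine le_trans (le_of_eq ?_) this
    exact (tr_self n _).symm

theorem emb_proj_le (x : D) (n : ℕ) : emb n (proj n x) ≤ x :=
  (le_ωSup (⟨⟨fun n => emb n (proj n x), emb_proj_mono x⟩⟩ : Chain D) n).trans (ωSup_emb_proj x).le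

theorem fn_le {f g : D →𝒄 D} (h : fn f ≤ fn g) (x : D) : f x ≤ g x := by
  intro k
  have key : ∀ n y, (f (emb n y)).1 n ≤ (g (emb n y)).1 n := fun n y => by
    have h1 : Node.Le (.fn ((proj n).comp (f.toOrderHom.comp (emb n))))
      (.fn ((proj n).comp (g.toOrderHom.comp (emb n)))) := h (n + 1)
    cases h1 with
    | fn h1 => exact h1 y
  rw [← ωSup_emb_proj x, f.continuous, g.continuous]
  revert k
  change (ωSup _ : D) ≤ (ωSup _ : D)
  refine ωSup_le _ _ fun n => ?_
  intro k
  have e : emb n (proj n x) ≤ emb (max n k) (proj (max n k) x) :=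
    emb_proj_mono x (le_max_left n k)
  have h1 : (f (emb n (proj n x))).1 k ≤ (f (emb (max n k) (proj (max n k) x))).1 k :=
    f.monotone e k
  have h3 : (f (emb (max n k) (proj (max n k) x))).1 k
      ≤ (g (emb (max n k) (proj (max n k) x))).1 k := by
    rw [← tr_proj (le_max_right n k), ← tr_proj (le_max_right n k) (g _)]
    exact (tr _ k).monotone (key (max n k) _)
  refine h1.trans (h3.trans ?_)
  exact le_ωSup ((⟨⟨fun n => emb n (proj n x), emb_proj_mono x⟩⟩ : Chain D).map g.toOrderHom)
    (max n k) k

theorem fn_inj {f g : D →𝒄 D} (h : fn f = fn g) : f = g :=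
  ContinuousHom.ext _ _ fun x => le_antisymm (fn_le h.le x) (fn_le h.ge x)

/-- A compatible family of functions on the approximations gives a continuous function. -/
theorem exists_fn (f : ∀ n, L n →o L n)
    (hf : ∀ n y, f n y = tr (n + 1) n (f (n + 1) (tr n (n + 1) y))) :
    ∃ F : D →𝒄 D, ∀ n, (proj n).comp (F.toOrderHom.comp (emb n)) = f n := by
  have step : ∀ n x, emb n (f n (tr (n + 1) n x)) ≤ emb (n + 1) (f (n + 1) x) := by
    intro n x m
    change tr n m (f n (tr (n + 1) n x)) ≤ tr (n + 1) m (f (n + 1) x)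
    rw [tr_mono n (n + 1) _ (by omega) m |>.antisymm
      (le_of_eq (tr_tr n (n + 1) m (Or.inl (by omega)) _)), hf]
    exact (tr (n + 1) m).monotone ((tr_tr_le (n + 1) n _).trans
      ((f (n + 1)).monotone (tr_tr_le (n + 1) n _)))
  have mono : ∀ x : D, Monotone fun n => emb n (f n (proj n x)) := fun x =>
    monotone_nat_of_le_succ fun n => by
      have := step n (x.1 (n + 1))
      rw [x.2 n] at this
      exact this
  have hmono : Monotone fun x : D => ωSup ⟨⟨fun n => emb n (f n (proj n x)), mono x⟩⟩ :=
    fun x y h => ωSup_le_ωSup_of_le fun n => ⟨n,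
      (emb n).monotone ((f n).monotone ((proj n).monotone h))⟩
  let F : D →𝒄 D :=
    { toFun := fun x => ωSup ⟨⟨fun n => emb n (f n (proj n x)), mono x⟩⟩
      monotone' := hmono
      map_ωSup' := fun c => by
        refine le_antisymm (ωSup_le _ _ fun n => ?_) (ωSup_le _ _ fun i =>
          hmono (le_ωSup c i))
        let a : ℕ →o L n := ⟨fun i => (c i).1 n, fun _ _ h => c.monotone h n⟩
        refine le_trans ?_ (le_ωSup _ (monotonicSequenceLimitIndex a))
        exact le_ωSup (⟨⟨fun n => emb n (f n (proj n (c (monotonicSequenceLimitIndex a)))),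
          mono _⟩⟩ : Chain D) n }
  refine ⟨F, fun n => OrderHom.ext _ _ (funext fun y => ?_)⟩
  have up : ∀ m, n ≤ m → tr m n (f m (tr n m y)) = f n y := by
    intro m h
    induction m, h using Nat.le_induction with
    | base => rw [tr_self, tr_self]
    | succ m h ih =>
      rw [← ih, hf m, tr_tr n m (m + 1) (Or.inl h), tr_tr (m + 1) m n (Or.inr h)]
  refine le_antisymm ?_ ?_
  · let c : Chain D := ⟨⟨fun m => emb m (f m (proj m (emb n y))), mono _⟩⟩
    change monotonicSequenceLimit (⟨fun i => (c i).1 n, fun _ _ h => c.monotone h n⟩ : ℕ →o L n) ≤ _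
    let i := monotonicSequenceLimitIndex
      (⟨fun i => (c i).1 n, fun _ _ h => c.monotone h n⟩ : ℕ →o L n)
    change (c i).1 n ≤ _
    refine (c.monotone (le_max_left i n) n).trans (le_of_eq ?_)
    exact up _ (le_max_right i n)
  · refine le_trans (le_of_eq ?_)
      (le_ωSup (⟨⟨fun m => emb m (f m (proj m (emb n y))), mono _⟩⟩ : Chain D) n n)
    exact (up n le_rfl).symm

/-- `D` solves its domain equation: every element other than `⊥` is built by a constructor. -/
theorem cases (x : D) : x = ⊥ ∨ x = nil ∨ (∃ a, x = left a) ∨ (∃ a, x = right a) ∨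
    (∃ a b, x = pair a b) ∨ (∃ f, x = fn f) ∨ ∃ a b, x = amb a b := by
  obtain ⟨x, hx⟩ := x
  have hx' : ∀ n, Node.map (tr (n + 1) n) (tr n (n + 1)) (x (n + 2)) = (x (n + 1) : Node (L n)) :=
    fun n => by have := hx (n + 1); rw [tr_succ] at this; exact this
  have ext : ∀ y : D, (∀ n, x (n + 1) = y.1 (n + 1)) → (⟨x, hx⟩ : D) = y := fun y h =>
    Subtype.ext (funext fun n => match n with
      | 0 => rfl
      | n + 1 => h n)
  generalize h1 : (x 1 : Node (L 0)) = c
  have cst : ∀ P : ∀ n, Node (L n) → Prop,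
      (∀ n (z : Node (L (n + 1))), P n (Node.map (tr (n + 1) n) (tr n (n + 1)) z) → P (n + 1) z) →
      P 0 (x 1) → ∀ n, P n (x (n + 1)) := fun P hP h0 n => by
    induction n with
    | zero => exact h0
    | succ n ih => exact hP n _ (by rw [hx' n]; exact ih)
  cases c with
  | bot =>
    refine .inl (ext _ fun n => cst (fun n z => z = .bot) (fun n z h => ?_) h1 n)
    cases z <;> first | rfl | cases h
  | nil =>
    refine .inr (.inl (ext _ fun n => cst (fun n z => z = .nil) (fun n z h => ?_) h1 n))
    cases z <;> first | rfl | cases h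
  | left a =>
    have := cst (fun n z => ∃ a, z = .left a) (fun n z h => by
      obtain ⟨_, h⟩ := h
      cases z <;> first | exact ⟨_, rfl⟩ | cases h) ⟨a, h1⟩
    choose a ha using this
    refine .inr (.inr (.inl ⟨⟨a, fun n => ?_⟩, ext _ ha⟩))
    have := hx' n
    rw [ha, ha] at this
    exact Node.left.inj this
  | right a =>
    have := cst (fun n z => ∃ a, z = .right a) (fun n z h => by
      obtain ⟨_, h⟩ := h
      cases z <;> first | exact ⟨_, rfl⟩ | cases h) ⟨a, h1⟩
    choose a ha using this
    refine .inr (.inr (.inr (.inl ⟨⟨a, fun n => ?_⟩, ext _ ha⟩)))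
    have := hx' n
    rw [ha, ha] at this
    exact Node.right.inj this
  | pair a b =>
    have := cst (fun n z => ∃ a b, z = .pair a b) (fun n z h => by
      obtain ⟨_, _, h⟩ := h
      cases z <;> first | exact ⟨_, _, rfl⟩ | cases h) ⟨a, b, h1⟩
    choose a b ha using this
    have inj := fun n => by
      have := hx' n
      rw [ha, ha] at this
      exact Node.pair.inj this
    exact .inr (.inr (.inr (.inr (.inl
      ⟨⟨a, fun n => (inj n).1⟩, ⟨b, fun n => (inj n).2⟩, ext _ ha⟩))))
  | amb a b =>
    have := cst (fun n z => ∃ a b, z = .amb a b) (fun n z h => by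
      obtain ⟨_, _, h⟩ := h
      cases z <;> first | exact ⟨_, _, rfl⟩ | cases h) ⟨a, b, h1⟩
    choose a b ha using this
    have inj := fun n => by
      have := hx' n
      rw [ha, ha] at this
      exact Node.amb.inj this
    exact .inr (.inr (.inr (.inr (.inr (.inr
      ⟨⟨a, fun n => (inj n).1⟩, ⟨b, fun n => (inj n).2⟩, ext _ ha⟩)))))
  | fn f =>
    have := cst (fun n z => ∃ f, z = .fn f) (fun n z h => by
      obtain ⟨_, h⟩ := h
      cases z <;> first | exact ⟨_, rfl⟩ | cases h) ⟨f, h1⟩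
    choose f hf using this
    obtain ⟨F, hF⟩ := exists_fn f fun n y => by
      have := hx' n
      rw [hf, hf] at this
      exact (congrFun (congrArg DFunLike.coe (Node.fn.inj this)) y).symm
    refine .inr (.inr (.inr (.inr (.inr (.inl ⟨F, ext _ fun n => ?_⟩)))))
    rw [hf]
    exact congrArg Node.fn (hF n).symm

/-- The right-hand side of the domain equation. -/
inductive View : Type
  | bot : View
  | nil : View
  | left (a : D) : View
  | right (a : D) : View
  | pair (a b : D) : View
  | fn (f : D →𝒄 D) : View
  | amb (a b : D) : View

/-- The evaluation of the right-hand side of the domain equation. -/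
noncomputable def ofView : View → D
  | .bot => ⊥
  | .nil => nil
  | .left a => left a
  | .right a => right a
  | .pair a b => pair a b
  | .fn f => fn f
  | .amb a b => amb a b

theorem ofView_inj : Function.Injective ofView := by
  intro v w h
  have h0 : ((ofView v).1 1 : Node (L 0)) = (ofView w).1 1 := congrArg (fun x : D => x.1 1) h
  cases v <;> cases w <;> first
    | rfl
    | exact congrArg View.left (left_inj h)
    | exact congrArg View.right (right_inj h)
    | exact congrArg View.fn (fn_inj h)
    | exact congrArg₂ View.pair (pair_inj h).1 (pair_inj h).2
    | exact congrArg₂ View.amb (amb_inj h).1 (amb_inj h).2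
    | exact absurd h0 (fun h => by cases h)

/-- The domain equation. -/
noncomputable def viewEquiv : View ≃ D :=
  Equiv.ofBijective ofView ⟨ofView_inj, fun x => by
    rcases cases x with h | h | ⟨a, h⟩ | ⟨a, h⟩ | ⟨a, b, h⟩ | ⟨f, h⟩ | ⟨a, b, h⟩
    · exact ⟨.bot, h.symm⟩
    · exact ⟨.nil, h.symm⟩
    · exact ⟨.left a, h.symm⟩
    · exact ⟨.right a, h.symm⟩
    · exact ⟨.pair a b, h.symm⟩
    · exact ⟨.fn f, h.symm⟩
    · exact ⟨.amb a b, h.symm⟩⟩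

/-- The unique way in which an element is built. -/
noncomputable def view (x : D) : View := viewEquiv.symm x

theorem view_ofView (v : View) : view (ofView v) = v := viewEquiv.symm_apply_apply v

/-- Application of `c` to `a`; it is `⊥` if `c` is not a function. -/
noncomputable def app (c a : D) : D :=
  match view c with
  | .fn f => f a
  | _ => ⊥

theorem app_fn (f : D →𝒄 D) (a : D) : app (fn f) a = f a := by
  have : view (fn f) = .fn f := view_ofView (.fn f)
  simp [app, this]

/-- The least fixed point `⨆ n, fⁿ(⊥)` of the function `f` that `c` represents. -/
noncomputable def lfp (c : D) : D :=
  match view c with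
  | .fn f => ωSup (fixedPoints.iterateChain f ⊥ bot_le)
  | _ => ⊥

end D

/-! ## Continuity of the operations -/

/-- The environment `η` with a new value for the variable `0`. -/
def push (η : ℕ → D) (a : D) : ℕ → D
  | 0 => a
  | i + 1 => η i

section Continuity

open Filter

variable {α : Type} [OmegaCompletePartialOrder α]

theorem eventually_level {g : α → D} (hg : ωScottContinuous g) (c : Chain α) (n : ℕ) :
    ∀ᶠ i in atTop, (g (ωSup c)).1 n = (g (c i)).1 n := by
  rw [hg.map_ωSup c]
  let a : ℕ →o L n := ⟨fun i => (g (c i)).1 n, fun _ _ h => hg.monotone (c.monotone h) n⟩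
  refine eventually_atTop.2 ⟨monotonicSequenceLimitIndex a, fun i hi => ?_⟩
  exact le_antisymm (a.monotone hi) (le_monotonicSequenceLimit a i)

theorem continuous_of_level {F : α → D} (hm : Monotone F)
    (h : ∀ c : Chain α, ∀ n, ∃ i, (F (ωSup c)).1 n ≤ (F (c i)).1 n) : ωScottContinuous F := by
  refine ωScottContinuous_iff_monotone_map_ωSup.2 ⟨hm, fun c => le_antisymm (fun n => ?_)
    (ωSup_le _ _ fun i => hm (le_ωSup c i))⟩
  obtain ⟨i, hi⟩ := h c n
  exact hi.trans (le_ωSup (c.map ⟨F, hm⟩) i n)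

theorem continuous_app {g h : α → D} (hg : ωScottContinuous g) (hh : ωScottContinuous h) :
    ωScottContinuous fun x => D.app (g x) (h x) := by
  have hm : ∀ {c c' a a' : D}, c ≤ c' → a ≤ a' → D.app c a ≤ D.app c' a' := by
    intro c c' a a' hc ha
    rcases D.cases c with rfl | rfl | ⟨_, rfl⟩ | ⟨_, rfl⟩ | ⟨_, _, rfl⟩ | ⟨f, rfl⟩ | ⟨_, _, rfl⟩
    · rw [D.app, show D.view ⊥ = .bot from D.view_ofView .bot]; exact bot_le
    · rw [D.app, show D.view D.nil = .nil from D.view_ofView .nil]; exact bot_le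
    · rw [D.app, show D.view (D.left _) = .left _ from D.view_ofView (.left _)]; exact bot_le
    · rw [D.app, show D.view (D.right _) = .right _ from D.view_ofView (.right _)]; exact bot_le
    · rw [D.app, show D.view (D.pair _ _) = .pair _ _ from D.view_ofView (.pair _ _)]
      exact bot_le
    · have h1 := hc 1
      rcases D.cases c' with rfl | rfl | ⟨_, rfl⟩ | ⟨_, rfl⟩ | ⟨_, _, rfl⟩ | ⟨f', rfl⟩ |
        ⟨_, _, rfl⟩
      · cases h1
      · cases h1
      · cases h1
      · cases h1
      · cases h1
      · rw [D.app_fn, D.app_fn]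
        exact (f.monotone ha).trans (D.fn_le hc a')
      · cases h1
    · rw [D.app, show D.view (D.amb _ _) = .amb _ _ from D.view_ofView (.amb _ _)]
      exact bot_le
  refine continuous_of_level (fun x y hxy => hm (hg.monotone hxy) (hh.monotone hxy)) fun c n => ?_
  generalize hc : g (ωSup c) = d
  rcases D.cases d with rfl | rfl | ⟨_, rfl⟩ | ⟨_, rfl⟩ | ⟨_, _, rfl⟩ | ⟨f, rfl⟩ | ⟨_, _, rfl⟩
  · refine ⟨0, ?_⟩
    rw [D.app, show D.view ⊥ = .bot from D.view_ofView .bot]; exact L.bot_le _ _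
  · refine ⟨0, ?_⟩
    rw [D.app, show D.view D.nil = .nil from D.view_ofView .nil]; exact L.bot_le _ _
  · refine ⟨0, ?_⟩
    rw [D.app, show D.view (D.left _) = .left _ from D.view_ofView (.left _)]; exact L.bot_le _ _
  · refine ⟨0, ?_⟩
    rw [D.app, show D.view (D.right _) = .right _ from D.view_ofView (.right _)]
    exact L.bot_le _ _
  · refine ⟨0, ?_⟩
    rw [D.app, show D.view (D.pair _ _) = .pair _ _ from D.view_ofView (.pair _ _)]
    exact L.bot_le _ _
  · rw [D.app_fn]
    set a := h (ωSup c) with ha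
    obtain ⟨m, hm'⟩ : ∃ m, (f a).1 n = (f (D.emb m (D.proj m a))).1 n ∧ n ≤ m := by
      have := eventually_level f.ωScottContinuous
        ⟨⟨fun n => D.emb n (D.proj n a), D.emb_proj_mono a⟩⟩ n
      rw [D.ωSup_emb_proj] at this
      exact (this.and (eventually_ge_atTop n)).exists
    obtain ⟨i, h1, h2⟩ := ((eventually_level hg c (m + 1)).and (eventually_level hh c m)).exists
    refine ⟨i, ?_⟩
    rw [hc] at h1
    rcases D.cases (g (c i)) with e | e | ⟨_, e⟩ | ⟨_, e⟩ | ⟨_, _, e⟩ | ⟨f', e⟩ | ⟨_, _, e⟩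
    · rw [e] at h1; cases h1
    · rw [e] at h1; cases h1
    · rw [e] at h1; cases h1
    · rw [e] at h1; cases h1
    · rw [e] at h1; cases h1
    · rw [e] at h1 ⊢
      rw [D.app_fn]
      have h3 : (f (D.emb m (D.proj m a))).1 m = (f' (D.emb m (D.proj m a))).1 m :=
        congrFun (congrArg DFunLike.coe (Node.fn.inj h1)) _
      have h4 : D.proj m a = D.proj m (h (c i)) := h2
      rw [hm'.1, ← D.tr_proj hm'.2, h3, D.tr_proj hm'.2, h4]
      exact f'.monotone (D.emb_proj_le _ m) n
    · rw [e] at h1; cases h1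
  · refine ⟨0, ?_⟩
    rw [D.app, show D.view (D.amb _ _) = .amb _ _ from D.view_ofView (.amb _ _)]
    exact L.bot_le _ _

/-- The number of the head constructor. -/
def Node.tag {X : Type} [Preorder X] : Node X → ℕ
  | .bot => 0
  | .nil => 1
  | .left _ => 2
  | .right _ => 3
  | .pair _ _ => 4
  | .fn _ => 5
  | .amb _ _ => 6

theorem continuous_guard {g : α → D} (hg : ωScottContinuous g) {G : ℕ → α → D}
    (hG : ∀ t, ωScottContinuous (G t)) (h0 : ∀ x, G 0 x = ⊥) :
    ωScottContinuous fun x => G (Node.tag (X := L 0) ((g x).1 1)) x := by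
  refine continuous_of_level (fun x y hxy => ?_) fun c n => ?_
  · have h : Node.Le (X := L 0) ((g x).1 1) ((g y).1 1) := hg.monotone hxy 1
    have h' : Node.tag (X := L 0) ((g x).1 1) = 0 ∨
        Node.tag (X := L 0) ((g x).1 1) = Node.tag (X := L 0) ((g y).1 1) := by
      revert h
      generalize ((g x).1 1 : Node (L 0)) = u
      generalize ((g y).1 1 : Node (L 0)) = v
      intro h
      cases h
      · exact .inl rfl
      all_goals exact .inr rfl
    rcases h' with h' | h'
    · change G _ x ≤ G _ y
      rw [h', h0]; exact bot_le
    · change G _ x ≤ G _ y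
      rw [h']; exact (hG _).monotone hxy
  · obtain ⟨i, h1, h2⟩ := ((eventually_level hg c 1).and (eventually_level
      (hG (Node.tag (X := L 0) ((g (ωSup c)).1 1))) c n)).exists
    refine ⟨i, ?_⟩
    rw [h2, h1]

/-- The first and the second argument of a data constructor. -/
def Node.arg {X : Type} [Preorder X] (b : X) : Node X → X × X
  | .bot => (b, b)
  | .nil => (b, b)
  | .left x => (x, b)
  | .right x => (x, b)
  | .pair x y => (x, y)
  | .fn _ => (b, b)
  | .amb x y => (x, y)

theorem Node.arg_mono {X : Type} [Preorder X] {b : X} (hb : ∀ x, b ≤ x) {z w : Node X}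
    (h : Node.Le z w) : z.arg b ≤ w.arg b := by
  cases h <;> first | exact ⟨hb _, hb _⟩ | exact ⟨‹_›, le_rfl⟩ | exact ⟨‹_›, ‹_›⟩

/-- The arguments of a data constructor, `⊥` where there are none. -/
def D.arg (x : D) : D × D :=
  (⟨fun n => (Node.arg (L.bot n) (x.1 (n + 1))).1, fun n => by
    have h : Node.map (tr (n + 1) n) (tr n (n + 1)) (x.1 (n + 1 + 1)) = x.1 (n + 1) := by
      have h := x.2 (n + 1)
      rw [tr_succ] at h
      exact h
    change tr (n + 1) n (Node.arg (L.bot (n + 1)) (x.1 (n + 1 + 1))).1 =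
      (Node.arg (L.bot n) (x.1 (n + 1))).1
    rw [← h]
    generalize (x.1 (n + 1 + 1) : Node (L (n + 1))) = z
    cases z <;> first | rfl | exact tr_bot _ _⟩,
   ⟨fun n => (Node.arg (L.bot n) (x.1 (n + 1))).2, fun n => by
    have h : Node.map (tr (n + 1) n) (tr n (n + 1)) (x.1 (n + 1 + 1)) = x.1 (n + 1) := by
      have h := x.2 (n + 1)
      rw [tr_succ] at h
      exact h
    change tr (n + 1) n (Node.arg (L.bot (n + 1)) (x.1 (n + 1 + 1))).2 =
      (Node.arg (L.bot n) (x.1 (n + 1))).2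
    rw [← h]
    generalize (x.1 (n + 1 + 1) : Node (L (n + 1))) = z
    cases z <;> first | rfl | exact tr_bot _ _⟩)

theorem continuous_arg1 {g : α → D} (hg : ωScottContinuous g) :
    ωScottContinuous fun x => (D.arg (g x)).1 := by
  refine continuous_of_level (fun x y hxy n => ?_) fun c n => ?_
  · exact (Node.arg_mono (L.bot_le n) (hg.monotone hxy (n + 1))).1
  · obtain ⟨i, hi⟩ := (eventually_level hg c (n + 1)).exists
    refine ⟨i, ?_⟩
    change (Node.arg (L.bot n) _).1 ≤ (Node.arg (L.bot n) _).1
    rw [hi]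

theorem continuous_arg2 {g : α → D} (hg : ωScottContinuous g) :
    ωScottContinuous fun x => (D.arg (g x)).2 := by
  refine continuous_of_level (fun x y hxy n => ?_) fun c n => ?_
  · exact (Node.arg_mono (L.bot_le n) (hg.monotone hxy (n + 1))).2
  · obtain ⟨i, hi⟩ := (eventually_level hg c (n + 1)).exists
    refine ⟨i, ?_⟩
    change (Node.arg (L.bot n) _).2 ≤ (Node.arg (L.bot n) _).2
    rw [hi]

/-- Continuity of an operation which at each level only needs finitely many levels below. -/
theorem continuous_mk {g h : α → D} (hg : ωScottContinuous g) (hh : ωScottContinuous h)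
    (k : ∀ n, L n → L n → Node (L n)) (hk : ∀ n a b a' b', a ≤ a' → b ≤ b' → k n a b ≤ k n a' b')
    (F : α → D) (hF : ∀ x n, (F x).1 (n + 1) = k n ((g x).1 n) ((h x).1 n)) :
    ωScottContinuous F := by
  refine continuous_of_level (fun x y hxy n => ?_) fun c n => ?_
  · cases n with
    | zero => exact le_rfl
    | succ n => rw [hF, hF]; exact hk _ _ _ _ _ (hg.monotone hxy n) (hh.monotone hxy n)
  · cases n with
    | zero => exact ⟨0, le_rfl⟩
    | succ n =>
      obtain ⟨i, h1, h2⟩ := ((eventually_level hg c n).and (eventually_level hh c n)).exists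
      refine ⟨i, ?_⟩
      rw [hF, hF, h1, h2]
      exact hk _ _ _ _ _ le_rfl le_rfl

theorem continuous_apply {F : α × D → D} (hF : ωScottContinuous F) (x : α) :
    ωScottContinuous fun y => F (x, y) :=
  hF.comp (Prod.ωScottContinuous.prodMk ωScottContinuous.const ωScottContinuous.id)

theorem continuous_fn {F : α × D → D} (hF : ωScottContinuous F) :
    ωScottContinuous fun x =>
      D.fn (ContinuousHom.ofFun (fun y => F (x, y)) (continuous_apply hF x)) := by
  have h2 : ∀ y, ωScottContinuous fun x => F (x, y) := fun y =>
    hF.comp (Prod.ωScottContinuous.prodMk ωScottContinuous.id ωScottContinuous.const)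
  refine continuous_of_level (fun x y hxy n => ?_) fun c n => ?_
  · cases n with
    | zero => exact le_rfl
    | succ n => exact Node.Le.fn fun z => (h2 _).monotone hxy n
  · cases n with
    | zero => exact ⟨0, le_rfl⟩
    | succ n =>
      have := instFiniteL n
      obtain ⟨i, hi⟩ := (eventually_all.2 fun z : L n =>
        eventually_level (h2 (D.emb n z)) c n).exists
      exact ⟨i, Node.Le.fn fun z => (hi z).le⟩

theorem continuous_lfp {g : α → D} (hg : ωScottContinuous g) :
    ωScottContinuous fun x => D.lfp (g x) := by
  let it : ℕ → D → D := fun k c => (D.app c)^[k] ⊥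
  have hit : ∀ k, ωScottContinuous fun x => it k (g x) := by
    intro k
    induction k with
    | zero => exact ωScottContinuous.const
    | succ k ih =>
      have : (fun x => it (k + 1) (g x)) = fun x => D.app (g x) (it k (g x)) := by
        funext x; exact Function.iterate_succ_apply' _ _ _
      rw [this]; exact continuous_app hg ih
  have lub : ∀ c, IsLUB (Set.range fun k => it k c) (D.lfp c) := by
    intro c
    have hbot : (∀ a, D.app c a = ⊥) → D.lfp c = ⊥ →
        IsLUB (Set.range fun k => it k c) (D.lfp c) := by
      intro h h'
      rw [h']
      refine ⟨?_, fun _ _ => bot_le⟩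
      rintro _ ⟨k, rfl⟩
      cases k with
      | zero => exact le_rfl
      | succ k => exact ((Function.iterate_succ_apply' _ _ _).trans (h _)).le
    generalize hv : D.view c = v
    cases v with
    | fn f =>
      have : D.lfp c = ωSup (fixedPoints.iterateChain f.toOrderHom ⊥ bot_le) := by
        rw [D.lfp, hv]; rfl
      rw [this]
      have e : (fun k => it k c) = fixedPoints.iterateChain f.toOrderHom ⊥ bot_le := by
        funext k
        have : D.app c = f := by funext a; rw [D.app, hv]
        change (D.app c)^[k] ⊥ = _
        rw [this]; rfl
      rw [e]; exact isLUB_range_ωSup _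
    | _ => exact hbot (fun a => by rw [D.app, hv]) (by rw [D.lfp, hv])
  refine ωScottContinuous_iff_monotone_map_ωSup.2 ⟨fun x y hxy => ?_, fun c => ?_⟩
  · refine (lub _).2 ?_
    rintro _ ⟨k, rfl⟩
    exact ((hit k).monotone hxy).trans ((lub _).1 ⟨k, rfl⟩)
  · refine le_antisymm ((lub _).2 ?_) (ωSup_le _ _ fun i => ?_)
    · rintro _ ⟨k, rfl⟩
      refine ((hit k).map_ωSup c).le.trans (ωSup_le _ _ fun i => ?_)
      refine le_trans ((lub (g (c i))).1 ⟨k, rfl⟩) ?_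
      exact le_ωSup (c.map ⟨fun x => D.lfp (g x), _⟩) i
    · refine (lub _).2 ?_
      rintro _ ⟨k, rfl⟩
      exact ((hit k).monotone (le_ωSup c i)).trans ((lub _).1 ⟨k, rfl⟩)

theorem continuous_left {g : α → D} (hg : ωScottContinuous g) :
    ωScottContinuous fun x => D.left (g x) :=
  continuous_mk hg hg (fun _ a _ => .left a) (fun _ _ _ _ _ h _ => .left h) _ fun _ _ => rfl

theorem continuous_right {g : α → D} (hg : ωScottContinuous g) :
    ωScottContinuous fun x => D.right (g x) :=
  continuous_mk hg hg (fun _ a _ => .right a) (fun _ _ _ _ _ h _ => .right h) _ fun _ _ => rfl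

theorem continuous_pair {g h : α → D} (hg : ωScottContinuous g) (hh : ωScottContinuous h) :
    ωScottContinuous fun x => D.pair (g x) (h x) :=
  continuous_mk hg hh (fun _ => .pair) (fun _ _ _ _ _ h k => .pair h k) _ fun _ _ => rfl

theorem continuous_amb {g h : α → D} (hg : ωScottContinuous g) (hh : ωScottContinuous h) :
    ωScottContinuous fun x => D.amb (g x) (h x) :=
  continuous_mk hg hh (fun _ => .amb) (fun _ _ _ _ _ h k => .amb h k) _ fun _ _ => rfl

/-- Case distinction on the value of `g`. -/
noncomputable def caseFn (g n l r p f a : (ℕ → D) → D) (η : ℕ → D) : D :=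
  match D.view (g η) with
  | .bot => ⊥
  | .nil => n η
  | .left x => l (push η x)
  | .right x => r (push η x)
  | .pair x y => p (push (push η x) y)
  | .fn h => f (push η (D.fn h))
  | .amb x y => a (push (push η x) y)

theorem continuous_push {e : α → ℕ → D} {g : α → D} (he : ωScottContinuous e)
    (hg : ωScottContinuous g) : ωScottContinuous fun x => push (e x) (g x) := by
  refine ωScottContinuous.of_apply₂ fun i => ?_
  cases i with
  | zero => exact hg
  | succ i => exact he.apply₂ i

theorem continuous_caseFn {m n l r p f a : (ℕ → D) → D} (hm : ωScottContinuous m)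
    (hn : ωScottContinuous n) (hl : ωScottContinuous l) (hr : ωScottContinuous r)
    (hp : ωScottContinuous p) (hf : ωScottContinuous f) (ha : ωScottContinuous a) :
    ωScottContinuous (caseFn m n l r p f a) := by
  have h1 := continuous_arg1 hm
  have h2 := continuous_arg2 hm
  have hid : ωScottContinuous (fun η : ℕ → D => η) := ωScottContinuous.id
  let G : ℕ → (ℕ → D) → D
    | 1, η => n η
    | 2, η => l (push η (D.arg (m η)).1)
    | 3, η => r (push η (D.arg (m η)).1)
    | 4, η => p (push (push η (D.arg (m η)).1) (D.arg (m η)).2)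
    | 5, η => f (push η (m η))
    | 6, η => a (push (push η (D.arg (m η)).1) (D.arg (m η)).2)
    | _, _ => ⊥
  have hG : ∀ t, ωScottContinuous (G t) := fun t => match t with
    | 1 => hn
    | 2 => hl.comp (continuous_push hid h1)
    | 3 => hr.comp (continuous_push hid h1)
    | 4 => hp.comp (continuous_push (continuous_push hid h1) h2)
    | 5 => hf.comp (continuous_push hid hm)
    | 6 => ha.comp (continuous_push (continuous_push hid h1) h2)
    | 0 => ωScottContinuous.const
    | _ + 7 => ωScottContinuous.const
  have := continuous_guard hm hG fun _ => rfl
  refine (congrArg ωScottContinuous (funext fun η => ?_)).mp this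
  obtain ⟨v, hv⟩ := D.viewEquiv.surjective (m η)
  have hv' : D.view (m η) = v := by rw [← hv]; exact D.viewEquiv.symm_apply_apply v
  have hG' : ∀ t, Node.tag (X := L 0) ((D.ofView v).1 1) = t →
      G (Node.tag (X := L 0) ((m η).1 1)) η = G t η := by
    intro t ht
    rw [← hv, ← ht]; rfl
  have ha : D.arg (m η) = D.arg (D.ofView v) := congrArg D.arg hv.symm
  rw [caseFn, hv']
  cases v with
  | bot => exact hG' 0 rfl
  | nil => exact hG' 1 rfl
  | left x => exact (hG' 2 rfl).trans (congrArg (fun q : D × D => l (push η q.1)) ha)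
  | right x => exact (hG' 3 rfl).trans (congrArg (fun q : D × D => r (push η q.1)) ha)
  | pair x y =>
    exact (hG' 4 rfl).trans (congrArg (fun q : D × D => p (push (push η q.1) q.2)) ha)
  | amb x y =>
    exact (hG' 6 rfl).trans (congrArg (fun q : D × D => a (push (push η q.1) q.2)) ha)
  | fn g => exact (hG' 5 rfl).trans (congrArg (fun q : D => f (push η q)) hv.symm)

end Continuity

/-! ## Programs -/

/-- Programs with de Bruijn indices. The clauses of `caseOf m n l r p f a` are
`Nil → n`, `Left(x₀) → l`, `Right(x₀) → r`, `Pair(x₁, x₀) → p`, `fun(x₀) → f` and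
`Amb(x₁, x₀) → a`; a clause that is not wanted is `bot`. -/
inductive Prog : Type
  | var (i : ℕ) : Prog
  | nil : Prog
  | left (m : Prog) : Prog
  | right (m : Prog) : Prog
  | pair (m n : Prog) : Prog
  | amb (m n : Prog) : Prog
  | caseOf (m n l r p f a : Prog) : Prog
  | lam (m : Prog) : Prog
  | app (m n : Prog) : Prog
  | recu (m : Prog) : Prog
  | bot : Prog

namespace Prog

/-- All free variables have an index below `k`. -/
def ClosedAt : ℕ → Prog → Prop
  | k, var i => i < k
  | _, nil => True
  | k, left m => ClosedAt k m
  | k, right m => ClosedAt k m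
  | k, pair m n => ClosedAt k m ∧ ClosedAt k n
  | k, amb m n => ClosedAt k m ∧ ClosedAt k n
  | k, caseOf m n l r p f a => ClosedAt k m ∧ ClosedAt k n ∧ ClosedAt (k + 1) l ∧
      ClosedAt (k + 1) r ∧ ClosedAt (k + 2) p ∧ ClosedAt (k + 1) f ∧ ClosedAt (k + 2) a
  | k, lam m => ClosedAt (k + 1) m
  | k, app m n => ClosedAt k m ∧ ClosedAt k n
  | k, recu m => ClosedAt k m
  | _, bot => True

/-- Closed programs. -/
def Closed (m : Prog) : Prop := ClosedAt 0 m

/-- Sequential programs: `Amb` does not occur. -/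
def Sequential : Prog → Prop
  | var _ => True
  | nil => True
  | left m => Sequential m
  | right m => Sequential m
  | pair m n => Sequential m ∧ Sequential n
  | amb _ _ => False
  | caseOf m n l r p f a => Sequential m ∧ Sequential n ∧ Sequential l ∧
      Sequential r ∧ Sequential p ∧ Sequential f ∧ Sequential a
  | lam m => Sequential m
  | app m n => Sequential m ∧ Sequential n
  | recu m => Sequential m
  | bot => True

/-- The denotation of a program, a continuous function of the environment. -/
noncomputable def den : Prog → (ℕ → D) →𝒄 D
  | var i => .ofFun (fun η => η i) (ωScottContinuous.apply i)
  | nil => .ofFun (fun _ => D.nil) ωScottContinuous.const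
  | left m => .ofFun (fun η => D.left (den m η)) (continuous_left (den m).ωScottContinuous)
  | right m => .ofFun (fun η => D.right (den m η)) (continuous_right (den m).ωScottContinuous)
  | pair m n => .ofFun (fun η => D.pair (den m η) (den n η))
      (continuous_pair (den m).ωScottContinuous (den n).ωScottContinuous)
  | amb m n => .ofFun (fun η => D.amb (den m η) (den n η))
      (continuous_amb (den m).ωScottContinuous (den n).ωScottContinuous)
  | caseOf m n l r p f a => .ofFun (caseFn (den m) (den n) (den l) (den r) (den p) (den f) (den a))
      (continuous_caseFn (den m).ωScottContinuous (den n).ωScottContinuous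
        (den l).ωScottContinuous (den r).ωScottContinuous (den p).ωScottContinuous
        (den f).ωScottContinuous (den a).ωScottContinuous)
  | lam m => .ofFun (fun η => D.fn (.ofFun (fun x => den m (push η x)) (continuous_apply
        (F := fun p : (ℕ → D) × D => den m (push p.1 p.2)) ((den m).ωScottContinuous.comp
          (continuous_push Prod.ωScottContinuous_fst Prod.ωScottContinuous_snd)) η)))
      (continuous_fn ((den m).ωScottContinuous.comp
        (continuous_push (α := (ℕ → D) × D)
          Prod.ωScottContinuous_fst Prod.ωScottContinuous_snd)))
  | app m n => .ofFun (fun η => D.app (den m η) (den n η))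
      (continuous_app (den m).ωScottContinuous (den n).ωScottContinuous)
  | recu m => .ofFun (fun η => D.lfp (den m η)) (continuous_lfp (den m).ωScottContinuous)
  | bot => .ofFun (fun _ => ⊥) ωScottContinuous.const

/-- The element of `D` that a closed program denotes. -/
noncomputable def val (m : Prog) : D := den m fun _ => ⊥

end Prog

/-! ## Types, as subdomains of `D` -/

/-- Greatest fixed point of a monotone operator on a complete lattice. -/
def nu {X : Type} [CompleteLattice X] (Φ : X → X) : X := sSup {x | x ≤ Φ x}

/-- Least fixed point of a monotone operator on a complete lattice. -/
def mu {X : Type} [CompleteLattice X] (Φ : X → X) : X := sInf {x | Φ x ≤ x}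

/-- The type `1`. -/
def tUnit : Set D := {⊥, D.nil}

/-- The type `T + U`. -/
def tSum (T U : Set D) : Set D := {⊥} ∪ D.left '' T ∪ D.right '' U

/-- The type `T × U`. -/
def tProd (T U : Set D) : Set D := {⊥} ∪ Set.image2 D.pair T U

/-- The type `T ⇒ U` of the functions that map `T` to `U`. -/
def tFun (T U : Set D) : Set D := {⊥} ∪ {c | ∃ f : D →𝒄 D, c = D.fn f ∧ ∀ a ∈ T, f a ∈ U}

/-- The type `A(T)` of concurrent elements of `T`. -/
def tAmb (T : Set D) : Set D := {⊥} ∪ Set.image2 D.amb T T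

/-- The recursive type `fix α. φ(α)`: the subdomain which solves `α = φ(α)`. For the operators `φ`
below it is the largest subset of `D` with `α = φ(α)`, since it contains the infinite elements
all of whose finite approximations belong to it. -/
def fix (φ : Set D → Set D) : Set D := nu φ

/-- The type `3 = (1 + 1) + 1` of signed digits. -/
def tSD : Set D := tSum (tSum tUnit tUnit) tUnit

/-- The type `2 = 1 + 1` of Gray digits. -/
def tGC : Set D := tSum tUnit tUnit

/-- The type of non-empty finite lists of elements of `T`. -/
def tPfin (T : Set D) : Set D := fix fun β => tSum T (tProd β T)

/-- The type of partial Gray digit streams. -/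
def tG : Set D := fix fun α => tProd tGC α

/-- The type of one step of a signed digit tree with subtrees in `α`. -/
def tStep (α : Set D) : Set D := tProd (tPfin tSD) (tFun tSD α)

/-- The type of signed digit trees. -/
def tSK : Set D := fix tStep

/-- The type of Gray code trees. -/
def tGK : Set D := fix fun α => tProd tG (tProd tG (tFun tGC α))

/-- The type of elements of `T` behind finitely many layers of `Amb`. -/
def tStar (T : Set D) : Set D := fix fun β => tAmb (tSum T β)

/-- The type of concurrent signed digit trees. -/
def tSKstar : Set D := fix fun α => tStar (tStep α)

/-! ## Realisability

A formula is interpreted by the set of its realisers; quantifiers over reals, sets of reals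
and the like are uniform, that is, unions and intersections. -/

/-- Realisers of a formula `p` without computational content. -/
def rNc (p : Prop) : Set D := {a | a = D.nil ∧ p}

/-- Realisers of `A ∨ B`. -/
def rOr (R S : Set D) : Set D := D.left '' R ∪ D.right '' S

/-- Realisers of `A ∧ B`, both with computational content. -/
def rAnd (R S : Set D) : Set D := Set.image2 D.pair R S

/-- Realisers of `p → B` where `p` has no computational content and `B` has the type `U`. -/
def rImpNc (U : Set D) (p : Prop) (S : Set D) : Set D := {b | b ∈ U ∧ (p → b ∈ S)}

/-- Realisers of `A → B` where `A` has the type `T` and `B` has the type `U`. -/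
def rImp (T U R S : Set D) : Set D := {c | c ∈ tFun T U ∧ ∀ a ∈ R, D.app c a ∈ S}

/-- Realisers of `⇊ A` where `A` has the type `T`: two processes of which at least one
terminates, and each that terminates realises `A`. -/
def rConc (T R : Set D) : Set D :=
  {c | ∃ a b, c = D.amb a b ∧ a ∈ T ∧ b ∈ T ∧ (a ≠ ⊥ ∨ b ≠ ⊥) ∧
    (a ≠ ⊥ → a ∈ R) ∧ (b ≠ ⊥ → b ∈ R)}

/-- Realisers of `⇊* A`, the least solution of `X ↔ ⇊ (A ∨ X)`. -/
def rStar (T R : Set D) : Set D := mu fun X => rConc (tSum T (tStar T)) (rOr R X)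

/-! ## Signed digits, Gray code and compact sets -/

/-- The tent map. -/
def tent (x : ℝ) : ℝ := 1 - 2 * |x|

/-- The inverse of the average map `x ↦ (x + d) / 2`. -/
def avInv (d x : ℝ) : ℝ := 2 * x - d

/-- The interval of half length `1 / 2` about `d / 2`. -/
def II (d : ℝ) : Set ℝ := {x | |2 * x - d| ≤ 1}

/-- `K` is a non-empty compact subset of `[-1, 1]`. -/
def IsK (K : Set ℝ) : Prop := K.Nonempty ∧ IsCompact K ∧ K ⊆ Set.Icc (-1) 1

/-- The part `K_d = K ∩ II d` of `K`. -/
def part (K : Set ℝ) (d : ℝ) : Set ℝ := K ∩ II d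

/-- `K ⊆ ⋃ d ∈ E, II d`. -/
def Covers (E K : Set ℝ) : Prop := K ⊆ ⋃ d ∈ E, II d

/-! ### The sets themselves -/

/-- The signed digits. -/
def SD : Set ℝ := {d | (d = -1 ∨ d = 1) ∨ d = 0}

/-- The Gray digits. -/
def GC : Set ℝ := {d | d = -1 ∨ d = 1}

/-- The non-empty finite subsets of `P`. -/
def Pfin (P : Set ℝ) : Set (Set ℝ) :=
  mu fun Z => {u | (∃ x ∈ P, u = {x}) ∨ ∃ v ∈ Z, ∃ y ∈ P, u = v ∪ {y}}

/-- The reals with a Gray code. -/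
def G : Set ℝ := nu fun Y => {x | (-1 ≤ x ∧ x ≤ 1) ∧ (x ≠ 0 → x ≤ 0 ∨ x ≥ 0) ∧ tent x ∈ Y}

/-- One step of a signed digit tree. -/
def Step (Y : Set (Set ℝ)) : Set (Set ℝ) :=
  {K | ∃ E ∈ Pfin SD, Covers E K ∧ ∀ d ∈ E, (part K d).Nonempty ∧ avInv d '' part K d ∈ Y}

/-- The compact sets with a signed digit tree. -/
def SK : Set (Set ℝ) := nu fun Y => {K | IsK K ∧ K ∈ Step Y}

/-- The compact sets with a Gray code tree. -/
def GK : Set (Set ℝ) :=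
  nu fun Y => {K | IsK K ∧ sInf K ∈ G ∧ sSup K ∈ G ∧
    ∀ d ∈ GC, (part K d).Nonempty → tent '' part K d ∈ Y}

/-- The compact sets with a concurrent signed digit tree. The modality `⇊` does not change
the truth value of a formula, so that `⇊* A` is the least solution of `X ↔ A ∨ X`. -/
def SKstar : Set (Set ℝ) := nu fun Y => {K | IsK K ∧ mu fun X : Prop => K ∈ Step Y ∨ X}

/-! ### The realisers -/

/-- Realisers of `d ∈ SD`. -/
def rSD (d : ℝ) : Set D := rOr (rOr (rNc (d = -1)) (rNc (d = 1))) (rNc (d = 0))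

/-- Realisers of `d ∈ GC`. -/
def rGC (d : ℝ) : Set D := rOr (rNc (d = -1)) (rNc (d = 1))

/-- Realisers of `E ∈ Pfin P`, given those of `x ∈ P`. -/
def rPfin (P : ℝ → Set D) : Set ℝ → Set D :=
  mu fun Z u => rOr {a | ∃ x, a ∈ P x ∧ u = {x}}
    {c | ∃ v y, c ∈ rAnd (Z v) (P y) ∧ u = v ∪ {y}}

/-- Realisers of `x ∈ G`. -/
def rG : ℝ → Set D :=
  nu fun Y x => {a | (-1 ≤ x ∧ x ≤ 1) ∧
    a ∈ rAnd (rImpNc tGC (x ≠ 0) (rOr (rNc (x ≤ 0)) (rNc (x ≥ 0)))) (Y (tent x))}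

/-- Realisers of one step of a signed digit tree for `K`: the digits `E` at the root together with
the subtrees, which are indexed by the codes of the digits in `E`. -/
def rStep (α : Set D) (Y : Set ℝ → Set D) (K : Set ℝ) : Set D :=
  {c | ∃ E, Covers E K ∧ c ∈ rAnd (rPfin rSD E) (⋂ d, rImp tSD α (rSD d)
    (rImpNc α (d ∈ E) {b | (part K d).Nonempty ∧ b ∈ Y (avInv d '' part K d)}))}

/-- Realisers of `K ∈ SK`: the signed digit trees of `K`. -/
def rSK : Set ℝ → Set D := nu fun Y K => {c | IsK K ∧ c ∈ rStep tSK Y K}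

/-- Realisers of `K ∈ GK`: the Gray code trees of `K`. -/
def rGK : Set ℝ → Set D :=
  nu fun Y K => {c | IsK K ∧ c ∈ rAnd (rG (sInf K)) (rAnd (rG (sSup K))
    (⋂ d, rImp tGC tGK (rGC d) (rImpNc tGK (part K d).Nonempty (Y (tent '' part K d)))))}

/-- Realisers of `K ∈ SKstar`: the concurrent signed digit trees of `K`. -/
def rSKstar : Set ℝ → Set D :=
  nu fun Y K => {c | IsK K ∧ c ∈ rStar (tStep tSKstar) (rStep tSKstar Y K)}

end CFP

namespace CFP

open OmegaCompletePartialOrder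

/-! ## Fixed points in complete lattices -/

section FixedPoints

variable {X : Type} [CompleteLattice X] {Φ : X → X} {x : X}

/-! As sets, the three classes all consist of every non-empty compact subset of `[-1, 1]`: signs can
be decided classically (`mem_G`, `mem_GK`), and the digits `-1` and `1` always suffice for one step
of a signed digit tree (`mem_Step`). The content of the theorem lies in the two programs.

Both rest on a few facts. Within `[-1, 1]` the sets `II (-1)`, `II 1`, `II 0` are the two halves and
the middle `[-1/2, 1/2]`. The tent map `t` is even, so negating a number flips only its first Gray
digit. On the left half `t x = 2x + 1` and on the right half `t x = -(2x - 1)`, so up to reflection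
the Gray subtree and the signed digit subtree at `-1` or `1` belong to the same set. For `|x| ≤ 1/2`
one has `t x ≥ 0` and `t (t x) = -t (2x)`, which relates the Gray codes of `x` and of `2x`.

From signed digits to Gray code (`grayTree_spec`): the least digit `d` at the root is a correct
first signed digit of `min K`, because the covering bounds `K` below by `(d - 1) / 2` and `K_d ≠ ∅`
bounds `min K` above by `(d + 1) / 2` (`grayMin_cases`). Hence a tree yields a signed digit stream
of `min K`, which is converted to Gray code (`grayMin_spec`). The head of the Gray code may diverge
only if all digits are `0`, that is, if `min K = 0` (`fst_grayMin_spec`). The maximum comes from the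
tree of `-K` (`negTree_spec`). A tree of `t[K_{-1}]` is built by looking at the least digit again
(`tentTree_spec`), and `t[K_1] = t[(-K)_{-1}]`.

From Gray code to concurrent signed digits (`concTree_spec`): the root digits would be determined by
the signs of `min K` and `max K`, but a Gray digit is undefined when its number is `0`. In that case
the second Gray digit is defined, since `t 0 = 1`, and it certifies an absolute value at most `1/2`,
so that the digit `0` can be used. The two tests run under `Amb`, once for the minimum and once for
the maximum. The digit `0` must only be offered if `K_0 ≠ ∅`. This is certified by one more digit,
the sign of `max t[K_{-1}]` or of `max t[K_1]`: it is non-negative iff the half of `K` has a point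
of absolute value at most `1/2`. The subtree at `0` needs a Gray code tree of the doubled middle
part. It is assembled from the subtrees of `K` by `-t (t y) = t (2y)` (`mid_subtree`, `midMin_spec`,
`midMax_spec`, `mid_mem`).

Realisers of implications must also respect the types. This is obtained from a semantic typing of
programs (`HasType`), whose rule for recursion needs the types to be closed under suprema of chains
(`adm_nu`). -/

theorem le_nu (h : x ≤ Φ x) : x ≤ nu Φ := le_sSup h

theorem nu_unfold (hΦ : Monotone Φ) : nu Φ = Φ (nu Φ) := by
  have h : nu Φ ≤ Φ (nu Φ) := sSup_le fun x hx => le_trans hx (hΦ (le_sSup hx))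
  exact le_antisymm h (le_sSup (hΦ h))

theorem mu_le (h : Φ x ≤ x) : mu Φ ≤ x := sInf_le h

theorem mu_unfold (hΦ : Monotone Φ) : mu Φ = Φ (mu Φ) := by
  have h : Φ (mu Φ) ≤ mu Φ := le_sInf fun x hx => le_trans (hΦ (sInf_le hx)) hx
  exact le_antisymm (sInf_le (hΦ h)) h

end FixedPoints

/-! ## Elements of `D` -/

namespace D

@[simp] theorem view_bot : view ⊥ = .bot := view_ofView .bot
@[simp] theorem view_nil : view nil = .nil := view_ofView .nil
@[simp] theorem view_left (a : D) : view (left a) = .left a := view_ofView (.left a)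
@[simp] theorem view_right (a : D) : view (right a) = .right a := view_ofView (.right a)
@[simp] theorem view_pair (a b : D) : view (pair a b) = .pair a b := view_ofView (.pair a b)
@[simp] theorem view_fn (f : D →𝒄 D) : view (fn f) = .fn f := view_ofView (.fn f)
@[simp] theorem view_amb (a b : D) : view (amb a b) = .amb a b := view_ofView (.amb a b)

@[simp] theorem app_bot (a : D) : app ⊥ a = ⊥ := by simp [app]

theorem ne_bot_of_view {x : D} (h : view x ≠ .bot) : x ≠ ⊥ := by
  rintro rfl
  exact h view_bot

/-- Case distinction on the head constructor. -/
noncomputable def elim (x n : D) (l r : D → D) (p : D → D → D) (f : D → D) (a : D → D → D) : D :=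
  match view x with
  | .bot => ⊥
  | .nil => n
  | .left x => l x
  | .right x => r x
  | .pair x y => p x y
  | .fn h => f (fn h)
  | .amb x y => a x y

section Elim

variable (n : D) (l r : D → D) (p : D → D → D) (f : D → D) (a : D → D → D) (x y : D)

@[simp] theorem elim_bot : elim ⊥ n l r p f a = ⊥ := by simp [elim]
@[simp] theorem elim_left : elim (left x) n l r p f a = l x := by simp [elim]
@[simp] theorem elim_right : elim (right x) n l r p f a = r x := by simp [elim]
@[simp] theorem elim_pair : elim (pair x y) n l r p f a = p x y := by simp [elim]

end Elim

/-- Case distinction between `Left` and `Right`. -/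
noncomputable def caseS (x : D) (l r : D → D) : D :=
  elim x ⊥ l r (fun _ _ => ⊥) (fun _ => ⊥) fun _ _ => ⊥

/-- The first component. -/
noncomputable def fst (x : D) : D :=
  elim x ⊥ (fun _ => ⊥) (fun _ => ⊥) (fun a _ => a) (fun _ => ⊥) fun _ _ => ⊥

/-- The second component. -/
noncomputable def snd (x : D) : D :=
  elim x ⊥ (fun _ => ⊥) (fun _ => ⊥) (fun _ b => b) (fun _ => ⊥) fun _ _ => ⊥

section Projections

variable (x y : D) (l r : D → D)

@[simp] theorem caseS_bot : caseS ⊥ l r = ⊥ := by simp [caseS]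
@[simp] theorem caseS_left : caseS (left x) l r = l x := by simp [caseS]
@[simp] theorem caseS_right : caseS (right x) l r = r x := by simp [caseS]
@[simp] theorem fst_bot : fst ⊥ = ⊥ := by simp [fst]
@[simp] theorem snd_bot : snd ⊥ = ⊥ := by simp [snd]
@[simp] theorem fst_pair : fst (pair x y) = x := by simp [fst]
@[simp] theorem snd_pair : snd (pair x y) = y := by simp [snd]

end Projections

theorem lfp_eq (c : D) : lfp c = app c (lfp c) := by
  generalize hv : view c = v
  cases v with
  | fn f =>
    have h : lfp c = ωSup (fixedPoints.iterateChain f.toOrderHom ⊥ bot_le) := by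
      rw [lfp, hv]; rfl
    have h' := fixedPoints.ωSup_iterate_mem_fixedPoint f ⊥ bot_le
    rw [app, hv]
    change _ = f _
    rw [h]
    exact h'.symm
  | _ => rw [lfp, app, hv]

end D

/-- The suprema of the increasing sequences in `T`. -/
def cl (T : Set D) : Set D := {x | ∃ c : Chain D, (∀ i, c i ∈ T) ∧ ωSup c = x}

/-- Subsets of `D` which contain `⊥` and the suprema of increasing sequences. -/
structure Adm (T : Set D) : Prop where
  bot : ⊥ ∈ T
  sup : cl T ⊆ T

/-- Fixed point induction: the iterates starting from `⊥` stay in `T`, and so does their supremum.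
If `c` is not a function, the value is `⊥`. -/
theorem Adm.lfp {T : Set D} (hT : Adm T) {c : D} (h : ∀ a ∈ T, D.app c a ∈ T) :
    D.lfp c ∈ T := by
  generalize hv : D.view c = v
  cases v with
  | fn f =>
    have e : D.lfp c = ωSup (fixedPoints.iterateChain f.toOrderHom ⊥ bot_le) := by
      rw [D.lfp, hv]; rfl
    rw [e]
    refine hT.sup ⟨_, fun i => ?_, rfl⟩
    change f^[i] ⊥ ∈ T
    induction i with
    | zero => exact hT.bot
    | succ i ih =>
      rw [Function.iterate_succ_apply']
      have := h _ ih
      rwa [D.app, hv] at this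
  | _ => rw [D.lfp, hv]; exact hT.bot

/-! ## Denotations -/

@[simp] theorem push_zero (η : ℕ → D) (a : D) : push η a 0 = a := rfl
@[simp] theorem push_succ (η : ℕ → D) (a : D) (i : ℕ) : push η a (i + 1) = η i := rfl

namespace Prog

section Den

variable (m n l r p f a : Prog) (η : ℕ → D)

@[simp] theorem den_var (i : ℕ) : den (var i) η = η i := rfl
@[simp] theorem den_nil : den nil η = D.nil := rfl
@[simp] theorem den_bot : den bot η = ⊥ := rfl
@[simp] theorem den_left : den (left m) η = D.left (den m η) := rfl
@[simp] theorem den_right : den (right m) η = D.right (den m η) := rfl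
@[simp] theorem den_pair : den (pair m n) η = D.pair (den m η) (den n η) := rfl
@[simp] theorem den_amb : den (amb m n) η = D.amb (den m η) (den n η) := rfl
@[simp] theorem den_app : den (app m n) η = D.app (den m η) (den n η) := rfl
@[simp] theorem den_recu : den (recu m) η = D.lfp (den m η) := rfl

@[simp] theorem den_caseOf : den (caseOf m n l r p f a) η =
    D.elim (den m η) (den n η) (fun x => den l (push η x)) (fun x => den r (push η x))
      (fun x y => den p (push (push η x) y)) (fun x => den f (push η x))
      (fun x y => den a (push (push η x) y)) := by
  change caseFn _ _ _ _ _ _ _ η = _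
  unfold caseFn D.elim
  cases D.view (den m η) <;> rfl

@[simp] theorem app_lam (x : D) : D.app (den (lam m) η) x = den m (push η x) := D.app_fn _ _

end Den

/-- The value of a program depends on its free variables only. -/
theorem den_congr : ∀ (m : Prog) (k : ℕ) (η θ : ℕ → D), ClosedAt k m → (∀ i < k, η i = θ i) →
    den m η = den m θ := by
  have hp : ∀ {k : ℕ} {η θ : ℕ → D} (_ : ∀ i < k, η i = θ i) (x : D),
      ∀ i < k + 1, push η x i = push θ x i := by
    rintro k η θ h x (_ | i) hi
    · rfl
    · exact h i (by omega)
  intro m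
  induction m with
  | var i => intro k η θ hm h; exact h i hm
  | nil => intros; rfl
  | bot => intros; rfl
  | left m ih => intro k η θ hm h; simp only [den_left, ih k η θ hm h]
  | right m ih => intro k η θ hm h; simp only [den_right, ih k η θ hm h]
  | pair m n ihm ihn =>
    intro k η θ hm h; simp only [den_pair, ihm k η θ hm.1 h, ihn k η θ hm.2 h]
  | amb m n ihm ihn =>
    intro k η θ hm h; simp only [den_amb, ihm k η θ hm.1 h, ihn k η θ hm.2 h]
  | app m n ihm ihn =>
    intro k η θ hm h; simp only [den_app, ihm k η θ hm.1 h, ihn k η θ hm.2 h]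
  | recu m ih => intro k η θ hm h; simp only [den_recu, ih k η θ hm h]
  | lam m ih =>
    intro k η θ hm h
    refine congrArg D.fn (ContinuousHom.ext _ _ fun x => ?_)
    exact ih (k + 1) _ _ hm (hp h x)
  | caseOf m n l r p f a ihm ihn ihl ihr ihp ihf iha =>
    intro k η θ ⟨hm, hn, hl, hr, hp', hf, ha⟩ h
    simp only [den_caseOf, ihm k η θ hm h, ihn k η θ hn h]
    congr 1
    · funext x; exact ihl _ _ _ hl (hp h x)
    · funext x; exact ihr _ _ _ hr (hp h x)
    · funext x y; exact ihp _ _ _ hp' (hp (hp h x) y)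
    · funext x; exact ihf _ _ _ hf (hp h x)
    · funext x y; exact iha _ _ _ ha (hp (hp h x) y)

theorem Closed.den_eq {m : Prog} (hm : m.Closed) (η : ℕ → D) : den m η = val m :=
  den_congr m 0 η _ hm fun _ h => absurd h (Nat.not_lt_zero _)

/-- Recursive programs with an argument have this shape. In the body, index `0` is the argument and
index `1` the program itself; each abstraction shifts both by one, and so does each `Left` or
`Right` branch of a case distinction. -/
theorem app_val_rec (m : Prog) (x : D) : D.app (val (recu (lam (lam m)))) x =
    den m (push (push (fun _ => ⊥) (val (recu (lam (lam m))))) x) := by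
  conv_lhs => rw [val, den_recu, D.lfp_eq, app_lam, app_lam]
  rfl

/-! ### Abbreviations for programs -/

/-- Case distinction between `Left` and `Right`. -/
def caseS (m l r : Prog) : Prog := caseOf m bot l r bot bot bot

/-- The first component. -/
def fstP (m : Prog) : Prog := caseOf m bot bot bot (var 1) bot bot

/-- The second component. -/
def sndP (m : Prog) : Prog := caseOf m bot bot bot (var 0) bot bot

/-- Case distinction between the codes of `-1`, `1` and `0`. -/
abbrev case3 (m x y z : Prog) : Prog := caseS m (caseS (var 0) x y) z

section Abbreviations

variable (m l r : Prog) (η : ℕ → D) (k : ℕ)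

@[simp] theorem den_caseS : den (caseS m l r) η =
    D.caseS (den m η) (fun x => den l (push η x)) (fun x => den r (push η x)) := by
  simp [caseS, D.caseS]

@[simp] theorem den_fstP : den (fstP m) η = D.fst (den m η) := by simp [fstP, D.fst]

@[simp] theorem den_sndP : den (sndP m) η = D.snd (den m η) := by simp [sndP, D.snd]

@[simp] theorem closedAt_caseS : ClosedAt k (caseS m l r) ↔
    ClosedAt k m ∧ ClosedAt (k + 1) l ∧ ClosedAt (k + 1) r := by
  simp [caseS, ClosedAt]

@[simp] theorem closedAt_fstP : ClosedAt k (fstP m) ↔ ClosedAt k m := by simp [fstP, ClosedAt]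

@[simp] theorem closedAt_sndP : ClosedAt k (sndP m) ↔ ClosedAt k m := by simp [sndP, ClosedAt]

@[simp] theorem sequential_caseS :
    Sequential (caseS m l r) ↔ Sequential m ∧ Sequential l ∧ Sequential r := by
  simp [caseS, Sequential]

@[simp] theorem sequential_fstP : Sequential (fstP m) ↔ Sequential m := by
  simp [fstP, Sequential]

@[simp] theorem sequential_sndP : Sequential (sndP m) ↔ Sequential m := by
  simp [sndP, Sequential]

end Abbreviations

end Prog

/-! ## Types -/

section Types

variable {T T' U U' X : Set D}

theorem bot_mem_tUnit : ⊥ ∈ tUnit := Or.inl rfl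
theorem bot_mem_tSum : ⊥ ∈ tSum T U := Or.inl (Or.inl rfl)
theorem bot_mem_tProd : ⊥ ∈ tProd T U := Or.inl rfl
theorem bot_mem_tFun : ⊥ ∈ tFun T U := Or.inl rfl
theorem bot_mem_tAmb : ⊥ ∈ tAmb T := Or.inl rfl

theorem left_mem_tSum {a : D} (h : a ∈ T) : D.left a ∈ tSum T U := Or.inl (Or.inr ⟨a, h, rfl⟩)
theorem right_mem_tSum {a : D} (h : a ∈ U) : D.right a ∈ tSum T U := Or.inr ⟨a, h, rfl⟩
theorem pair_mem_tProd {a b : D} (h : a ∈ T) (k : b ∈ U) : D.pair a b ∈ tProd T U :=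
  Or.inr ⟨a, h, b, k, rfl⟩
theorem amb_mem_tAmb {a b : D} (h : a ∈ T) (k : b ∈ T) : D.amb a b ∈ tAmb T :=
  Or.inr ⟨a, h, b, k, rfl⟩

theorem mem_tSum {x : D} : x ∈ tSum T U ↔
    x = ⊥ ∨ (∃ a ∈ T, x = D.left a) ∨ ∃ a ∈ U, x = D.right a := by
  simp only [tSum, Set.mem_union, Set.mem_singleton_iff, Set.mem_image, eq_comm, or_assoc]

theorem mem_tProd {x : D} : x ∈ tProd T U ↔ x = ⊥ ∨ ∃ a ∈ T, ∃ b ∈ U, x = D.pair a b := by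
  simp only [tProd, Set.mem_union, Set.mem_singleton_iff, Set.mem_image2, eq_comm]

theorem mem_tAmb {x : D} : x ∈ tAmb T ↔ x = ⊥ ∨ ∃ a ∈ T, ∃ b ∈ T, x = D.amb a b := by
  simp only [tAmb, Set.mem_union, Set.mem_singleton_iff, Set.mem_image2, eq_comm]

theorem app_mem {c a : D} (hc : c ∈ tFun T U) (ha : a ∈ T) (hU : ⊥ ∈ U) : D.app c a ∈ U := by
  rcases hc with rfl | ⟨f, rfl, hf⟩
  · rwa [D.app_bot]
  · rw [D.app_fn]; exact hf a ha

theorem tSum_mono (h : T ⊆ T') (k : U ⊆ U') : tSum T U ⊆ tSum T' U' :=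
  Set.union_subset_union (Set.union_subset_union le_rfl (Set.image_mono h)) (Set.image_mono k)

theorem tProd_mono (h : T ⊆ T') (k : U ⊆ U') : tProd T U ⊆ tProd T' U' :=
  Set.union_subset_union le_rfl (Set.image2_subset h k)

/-- Only the codomain varies: no recursive type here has its type variable to the left of an arrow.
-/
theorem tFun_mono (h : U ⊆ U') : tFun T U ⊆ tFun T U' := by
  rintro c (hc | ⟨f, rfl, hf⟩)
  · exact Or.inl hc
  · exact Or.inr ⟨f, rfl, fun a ha => h (hf a ha)⟩

theorem tAmb_mono (h : T ⊆ T') : tAmb T ⊆ tAmb T' :=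
  Set.union_subset_union le_rfl (Set.image2_subset h h)

theorem tStep_mono : Monotone tStep := fun _ _ h => tProd_mono le_rfl (tFun_mono h)

theorem tStarOp_mono (T : Set D) : Monotone fun β => tAmb (tSum T β) :=
  fun _ _ h => tAmb_mono (tSum_mono le_rfl h)

theorem tPfin_eq : tPfin T = tSum T (tProd (tPfin T) T) :=
  nu_unfold (Φ := fun β => tSum T (tProd β T)) fun _ _ h => tSum_mono le_rfl (tProd_mono h le_rfl)

theorem tG_eq : tG = tProd tGC tG :=
  nu_unfold (Φ := tProd tGC) fun _ _ h => tProd_mono le_rfl h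

theorem tSK_eq : tSK = tStep tSK := nu_unfold tStep_mono

theorem tGKOp_mono : Monotone fun α => tProd tG (tProd tG (tFun tGC α)) :=
  fun _ _ h => tProd_mono le_rfl (tProd_mono le_rfl (tFun_mono h))

theorem tGK_eq : tGK = tProd tG (tProd tG (tFun tGC tGK)) := nu_unfold tGKOp_mono

theorem tStar_eq : tStar T = tAmb (tSum T (tStar T)) := nu_unfold (tStarOp_mono T)

theorem tStar_mono : Monotone tStar := fun _ _ h =>
  sSup_le_sSup fun _ hx => le_trans hx (tAmb_mono (tSum_mono h le_rfl))

theorem tSKstar_eq : tSKstar = tStar (tStep tSKstar) :=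
  nu_unfold (Φ := fun α => tStar (tStep α)) fun _ _ h => tStar_mono (tStep_mono h)

theorem bot_mem_tStar : ⊥ ∈ tStar T := by rw [tStar_eq]; exact bot_mem_tAmb

/-! ### Admissibility -/

/-- Level `1` of an element records its head constructor. The level is finite, so a chain attains
its limit there. -/
theorem exists_head_eq (c : Chain D) : ∃ i, (c i).1 1 = (ωSup c).1 1 := by
  obtain ⟨i, hi⟩ := (eventually_level (α := D) (g := fun x => x) ωScottContinuous.id c 1).exists
  exact ⟨i, hi.symm⟩

theorem map_mem_cl {g : D → D} (hg : ωScottContinuous g) {c : Chain D} (h : ∀ i, g (c i) ∈ T) :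
    g (ωSup c) ∈ cl T :=
  ⟨c.map ⟨g, hg.monotone⟩, h, (hg.map_ωSup c).symm⟩

/-- The head of the supremum occurs in the chain, which excludes foreign constructors. The arguments
of the members form a chain too, where a member `⊥` has the argument `⊥`; this is where `⊥ ∈ T` and
`⊥ ∈ U` enter. -/
theorem cl_tSum (hT : ⊥ ∈ T) (hU : ⊥ ∈ U) : cl (tSum T U) ⊆ tSum (cl T) (cl U) := by
  rintro _ ⟨c, hc, rfl⟩
  obtain ⟨i, hi⟩ := exists_head_eq c
  have hle := fun j => le_ωSup c j 1
  have arg1 : ∀ {V : Set D}, (∀ i, (D.arg (c i)).1 ∈ V) → (D.arg (ωSup c)).1 ∈ cl V :=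
    fun h => map_mem_cl (continuous_arg1 (α := D) (g := fun x => x) ωScottContinuous.id) h
  rcases D.cases (ωSup c) with h | h | ⟨a, h⟩ | ⟨a, h⟩ | ⟨a, b, h⟩ | ⟨f, h⟩ | ⟨a, b, h⟩
  · rw [h]; exact bot_mem_tSum
  · rw [h] at hi
    rcases mem_tSum.1 (hc i) with e | ⟨_, _, e⟩ | ⟨_, _, e⟩ <;> rw [e] at hi <;> cases hi
  · rw [h] at hle ⊢
    refine left_mem_tSum ?_
    have := arg1 (V := T) fun j => by
      have hj := hle j
      rcases mem_tSum.1 (hc j) with e | ⟨x, hx, e⟩ | ⟨x, hx, e⟩ <;> rw [e] at hj ⊢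
      · exact hT
      · exact hx
      · cases hj
    rwa [h] at this
  · rw [h] at hle ⊢
    refine right_mem_tSum ?_
    have := arg1 (V := U) fun j => by
      have hj := hle j
      rcases mem_tSum.1 (hc j) with e | ⟨x, hx, e⟩ | ⟨x, hx, e⟩ <;> rw [e] at hj ⊢
      · exact hU
      · cases hj
      · exact hx
    rwa [h] at this
  all_goals
    rw [h] at hi
    rcases mem_tSum.1 (hc i) with e | ⟨_, _, e⟩ | ⟨_, _, e⟩ <;> rw [e] at hi <;> cases hi

theorem cl_tProd (hT : ⊥ ∈ T) (hU : ⊥ ∈ U) : cl (tProd T U) ⊆ tProd (cl T) (cl U) := by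
  rintro _ ⟨c, hc, rfl⟩
  obtain ⟨i, hi⟩ := exists_head_eq c
  have arg1 : (D.arg (ωSup c)).1 ∈ cl T :=
    map_mem_cl (continuous_arg1 (α := D) (g := fun x => x) ωScottContinuous.id) fun j => by
      rcases mem_tProd.1 (hc j) with e | ⟨x, hx, y, hy, e⟩ <;> rw [e]
      · exact hT
      · exact hx
  have arg2 : (D.arg (ωSup c)).2 ∈ cl U :=
    map_mem_cl (continuous_arg2 (α := D) (g := fun x => x) ωScottContinuous.id) fun j => by
      rcases mem_tProd.1 (hc j) with e | ⟨x, hx, y, hy, e⟩ <;> rw [e]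
      · exact hU
      · exact hy
  rcases D.cases (ωSup c) with h | h | ⟨a, h⟩ | ⟨a, h⟩ | ⟨a, b, h⟩ | ⟨f, h⟩ | ⟨a, b, h⟩
  · rw [h]; exact bot_mem_tProd
  on_goal 4 => rw [h] at arg1 arg2 ⊢; exact pair_mem_tProd arg1 arg2
  all_goals
    rw [h] at hi
    rcases mem_tProd.1 (hc i) with e | ⟨_, _, _, _, e⟩ <;> rw [e] at hi <;> cases hi

theorem cl_tAmb (hT : ⊥ ∈ T) : cl (tAmb T) ⊆ tAmb (cl T) := by
  rintro _ ⟨c, hc, rfl⟩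
  obtain ⟨i, hi⟩ := exists_head_eq c
  have arg1 : (D.arg (ωSup c)).1 ∈ cl T :=
    map_mem_cl (continuous_arg1 (α := D) (g := fun x => x) ωScottContinuous.id) fun j => by
      rcases mem_tAmb.1 (hc j) with e | ⟨x, hx, y, hy, e⟩ <;> rw [e]
      · exact hT
      · exact hx
  have arg2 : (D.arg (ωSup c)).2 ∈ cl T :=
    map_mem_cl (continuous_arg2 (α := D) (g := fun x => x) ωScottContinuous.id) fun j => by
      rcases mem_tAmb.1 (hc j) with e | ⟨x, hx, y, hy, e⟩ <;> rw [e]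
      · exact hT
      · exact hy
  rcases D.cases (ωSup c) with h | h | ⟨a, h⟩ | ⟨a, h⟩ | ⟨a, b, h⟩ | ⟨f, h⟩ | ⟨a, b, h⟩
  · rw [h]; exact bot_mem_tAmb
  on_goal 6 => rw [h] at arg1 arg2 ⊢; exact amb_mem_tAmb arg1 arg2
  all_goals
    rw [h] at hi
    rcases mem_tAmb.1 (hc i) with e | ⟨_, _, _, _, e⟩ <;> rw [e] at hi <;> cases hi

/-- Application to a fixed argument is continuous, so values of the supremum are suprema of values.
-/
theorem cl_tFun (hU : ⊥ ∈ U) : cl (tFun T U) ⊆ tFun T (cl U) := by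
  rintro _ ⟨c, hc, rfl⟩
  obtain ⟨i, hi⟩ := exists_head_eq c
  rcases D.cases (ωSup c) with h | h | ⟨a, h⟩ | ⟨a, h⟩ | ⟨a, b, h⟩ | ⟨f, h⟩ | ⟨a, b, h⟩
  · rw [h]; exact bot_mem_tFun
  on_goal 5 =>
    refine Or.inr ⟨f, h, fun a ha => ?_⟩
    have := map_mem_cl (T := U) (c := c) (g := fun x => D.app x a)
      (continuous_app ωScottContinuous.id ωScottContinuous.const) fun i => app_mem (hc i) ha hU
    rwa [h, D.app_fn] at this
  all_goals
    rw [h] at hi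
    rcases hc i with e | ⟨_, e, _⟩ <;> rw [e] at hi <;> cases hi

/-- Coinduction: the hypothesis `hc` makes `cl (nu φ)` a post-fixed point of `φ`, hence a subset of
`nu φ`. -/
theorem adm_nu {φ : Set D → Set D} (hm : Monotone φ) (hb : ∀ X, ⊥ ∈ φ X)
    (hc : ∀ X, ⊥ ∈ X → cl (φ X) ⊆ φ (cl X)) : Adm (nu φ) := by
  have hbot : ⊥ ∈ nu φ := by rw [nu_unfold hm]; exact hb _
  refine ⟨hbot, le_nu (le_trans (le_of_eq ?_) (hc _ hbot))⟩
  rw [← nu_unfold hm]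

theorem Adm.tSum (hT : Adm T) (hU : Adm U) : Adm (tSum T U) :=
  ⟨bot_mem_tSum, (cl_tSum hT.bot hU.bot).trans (tSum_mono hT.sup hU.sup)⟩

theorem Adm.tFun (hU : Adm U) : Adm (tFun T U) :=
  ⟨bot_mem_tFun, (cl_tFun hU.bot).trans (tFun_mono hU.sup)⟩

theorem adm_tUnit : Adm tUnit := by
  refine ⟨bot_mem_tUnit, ?_⟩
  rintro _ ⟨c, hc, rfl⟩
  obtain ⟨i, hi⟩ := exists_head_eq c
  rcases D.cases (ωSup c) with h | h | ⟨a, h⟩ | ⟨a, h⟩ | ⟨a, b, h⟩ | ⟨f, h⟩ | ⟨a, b, h⟩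
  · exact Or.inl h
  · exact Or.inr h
  all_goals
    rw [h] at hi
    rcases hc i with e | e <;> rw [e] at hi <;> cases hi

theorem adm_tGC : Adm tGC := adm_tUnit.tSum adm_tUnit

theorem adm_tSD : Adm tSD := adm_tGC.tSum adm_tUnit

theorem Adm.tPfin (hT : Adm T) : Adm (tPfin T) :=
  adm_nu (fun _ _ h => tSum_mono le_rfl (tProd_mono h le_rfl)) (fun _ => bot_mem_tSum) fun _ hX =>
    (cl_tSum hT.bot bot_mem_tProd).trans (tSum_mono hT.sup
      ((cl_tProd hX hT.bot).trans (tProd_mono le_rfl hT.sup)))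

theorem adm_tG : Adm tG :=
  adm_nu (fun _ _ h => tProd_mono le_rfl h) (fun _ => bot_mem_tProd) fun _ hX =>
    (cl_tProd adm_tGC.bot hX).trans (tProd_mono adm_tGC.sup le_rfl)

theorem cl_tStep (hX : ⊥ ∈ X) : cl (tStep X) ⊆ tStep (cl X) :=
  (cl_tProd adm_tSD.tPfin.bot bot_mem_tFun).trans (tProd_mono adm_tSD.tPfin.sup (cl_tFun hX))

theorem adm_tSK : Adm tSK := adm_nu tStep_mono (fun _ => bot_mem_tProd) fun _ => cl_tStep

theorem adm_tGK : Adm tGK :=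
  adm_nu tGKOp_mono (fun _ => bot_mem_tProd) fun _ hX =>
    (cl_tProd adm_tG.bot bot_mem_tProd).trans (tProd_mono adm_tG.sup
      ((cl_tProd adm_tG.bot bot_mem_tFun).trans (tProd_mono adm_tG.sup (cl_tFun hX))))

/-- Stated for an arbitrary `T` rather than an admissible one, since `tSKstar` nests this fixed
point inside another, where `T` depends on the outer variable. -/
theorem cl_tStar (hT : ⊥ ∈ T) : cl (tStar T) ⊆ tStar (cl T) := by
  refine le_nu (Φ := fun β => tAmb (tSum (cl T) β)) ?_
  conv_lhs => rw [tStar_eq]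
  exact (cl_tAmb bot_mem_tSum).trans (tAmb_mono (cl_tSum hT bot_mem_tStar))

theorem adm_tSKstar : Adm tSKstar :=
  adm_nu (fun _ _ h => tStar_mono (tStep_mono h)) (fun _ => bot_mem_tStar) fun _ hX =>
    (cl_tStar bot_mem_tProd).trans (tStar_mono (cl_tStep hX))

end Types

/-! ## Typing of programs -/

namespace Prog

/-- In an environment of type `Γ` the program `m` has a value of type `T`. -/
def HasType (Γ : List (Set D)) (m : Prog) (T : Set D) : Prop :=
  ∀ η : ℕ → D, (∀ i, η i ∈ Γ.getD i Set.univ) → den m η ∈ T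

section Typing

variable {Γ : List (Set D)} {m n l r x y z : Prog} {T U V : Set D}

theorem push_typed {η : ℕ → D} (h : ∀ i, η i ∈ Γ.getD i Set.univ) {a : D} (ha : a ∈ T) :
    ∀ i, push η a i ∈ (T :: Γ).getD i Set.univ
  | 0 => ha
  | i + 1 => h i

theorem HasType.var (i : ℕ) (h : Γ.getD i Set.univ = T) : HasType Γ (var i) T :=
  fun _ hη => h ▸ hη i

theorem HasType.conv (h : HasType Γ m T) (e : T = U) : HasType Γ m U := e ▸ h

/-- Indices beyond the context have the type `Set.univ`, so every environment fits the empty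
context. -/
theorem HasType.val_mem (h : HasType [] m T) : val m ∈ T := h _ fun _ => trivial

theorem HasType.of_closed (hc : Closed m) (h : val m ∈ T) : HasType Γ m T :=
  fun _ _ => by rw [hc.den_eq]; exact h

theorem HasType.nil : HasType Γ nil tUnit := fun _ _ => Or.inr rfl

theorem HasType.bot (h : ⊥ ∈ T) : HasType Γ bot T := fun _ _ => h

theorem HasType.left (h : HasType Γ m T) : HasType Γ (left m) (tSum T U) :=
  fun η hη => left_mem_tSum (h η hη)

theorem HasType.right (h : HasType Γ m U) : HasType Γ (right m) (tSum T U) :=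
  fun η hη => right_mem_tSum (h η hη)

theorem HasType.pair (h : HasType Γ m T) (k : HasType Γ n U) : HasType Γ (pair m n) (tProd T U) :=
  fun η hη => pair_mem_tProd (h η hη) (k η hη)

theorem HasType.amb (h : HasType Γ m T) (k : HasType Γ n T) : HasType Γ (amb m n) (tAmb T) :=
  fun η hη => amb_mem_tAmb (h η hη) (k η hη)

theorem HasType.lam (h : HasType (T :: Γ) m U) : HasType Γ (lam m) (tFun T U) :=
  fun _ hη => Or.inr ⟨_, rfl, fun _ ha => h _ (push_typed hη ha)⟩

theorem HasType.app (hU : ⊥ ∈ U) (h : HasType Γ m (tFun T U)) (k : HasType Γ n T) :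
    HasType Γ (app m n) U :=
  fun η hη => app_mem (h η hη) (k η hη) hU

/-- The only rule that needs closure under suprema; the others need at most `⊥` in the resulting
type. -/
theorem HasType.recu (hT : Adm T) (h : HasType Γ m (tFun T T)) : HasType Γ (recu m) T :=
  fun η hη => hT.lfp fun _ ha => app_mem (h η hη) ha hT.bot

theorem HasType.caseS (hV : ⊥ ∈ V) (h : HasType Γ m (tSum T U)) (hl : HasType (T :: Γ) l V)
    (hr : HasType (U :: Γ) r V) : HasType Γ (caseS m l r) V := fun η hη => by
  rcases mem_tSum.1 (h η hη) with e | ⟨a, ha, e⟩ | ⟨a, ha, e⟩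
  · simp [e, hV]
  · simpa [e] using hl _ (push_typed hη ha)
  · simpa [e] using hr _ (push_typed hη ha)

theorem HasType.fstP (hT : ⊥ ∈ T) (h : HasType Γ m (tProd T U)) : HasType Γ (fstP m) T :=
  fun η hη => by
  rcases mem_tProd.1 (h η hη) with e | ⟨a, ha, b, _, e⟩
  · simp [e, hT]
  · simpa [e] using ha

theorem HasType.sndP (hU : ⊥ ∈ U) (h : HasType Γ m (tProd T U)) : HasType Γ (sndP m) U :=
  fun η hη => by
  rcases mem_tProd.1 (h η hη) with e | ⟨a, _, b, hb, e⟩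
  · simp [e, hU]
  · simpa [e] using hb

theorem HasType.case3 (hV : ⊥ ∈ V) (h : HasType Γ m tSD)
    (hx : HasType (tUnit :: tGC :: Γ) x V) (hy : HasType (tUnit :: tGC :: Γ) y V)
    (hz : HasType (tUnit :: Γ) z V) : HasType Γ (case3 m x y z) V :=
  .caseS hV h (.caseS hV (.var 0 rfl) hx hy) hz

end Typing

end Prog

namespace Prog

/-! ## Programs for digits, Gray codes and Gray code trees -/

/-- The code of the signed digit `-1`. -/
abbrev digM : Prog := left (left nil)

/-- The code of the signed digit `1`. -/
abbrev digP : Prog := left (right nil)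

/-- The code of the signed digit `0`. -/
abbrev digZ : Prog := right nil

/-- The code of the Gray digit `-1`. -/
abbrev grayM : Prog := left nil

/-- The code of the Gray digit `1`. -/
abbrev grayP : Prog := right nil

/-- The negative of a signed digit. -/
def negSD (m : Prog) : Prog :=
  caseS m (caseS (var 0) (left (right (var 0))) (left (left (var 0)))) (right (var 0))

/-- The negative of a Gray digit. -/
def negGC (m : Prog) : Prog := caseS m (right (var 0)) (left (var 0))

/-- The Gray code of `-x`. -/
def negG (m : Prog) : Prog := pair (negGC (fstP m)) (sndP m)

end Prog

namespace D

/-- The negative of a signed digit. -/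
noncomputable def negSD (x : D) : D :=
  caseS x (fun y => caseS y (fun z => left (right z)) fun z => left (left z)) right

/-- The negative of a Gray digit. -/
noncomputable def negGC (x : D) : D := caseS x right left

/-- The Gray code of `-x`. -/
noncomputable def negG (x : D) : D := pair (negGC (fst x)) (snd x)

@[simp] theorem negGC_bot : negGC ⊥ = ⊥ := caseS_bot _ _
@[simp] theorem negGC_left (x : D) : negGC (left x) = right x := caseS_left _ _ _
@[simp] theorem negGC_right (x : D) : negGC (right x) = left x := caseS_right _ _ _
@[simp] theorem negG_pair (x y : D) : negG (pair x y) = pair (negGC x) y := by simp [negG]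

end D

namespace Prog

section Negation

variable (m : Prog) (η : ℕ → D) (k : ℕ)

@[simp] theorem den_negSD : den (negSD m) η = D.negSD (den m η) := by simp [negSD, D.negSD]

@[simp] theorem den_negGC : den (negGC m) η = D.negGC (den m η) := by simp [negGC, D.negGC]

@[simp] theorem den_negG : den (negG m) η = D.negG (den m η) := by simp [negG, D.negG]

@[simp] theorem closedAt_negSD : ClosedAt k (negSD m) ↔ ClosedAt k m := by
  simp [negSD, ClosedAt]

@[simp] theorem closedAt_negGC : ClosedAt k (negGC m) ↔ ClosedAt k m := by
  simp [negGC, ClosedAt]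

@[simp] theorem closedAt_negG : ClosedAt k (negG m) ↔ ClosedAt k m := by simp [negG, ClosedAt]

@[simp] theorem sequential_negSD : Sequential (negSD m) ↔ Sequential m := by
  simp [negSD, Sequential]

@[simp] theorem sequential_negG : Sequential (negG m) ↔ Sequential m := by
  simp [negG, negGC, Sequential]

end Negation

/-! ## From signed digit trees to Gray code trees -/

/-- The least digit in a list. -/
def minList : Prog :=
  recu (lam (lam (caseS (var 0) (var 0)
    (caseS (app (var 2) (fstP (var 0)))
      (caseS (var 0) digM (sndP (var 2)))
      (caseS (sndP (var 1)) (caseS (var 0) digM digZ) digZ)))))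

/-- The negatives of the digits in a list. -/
def negList : Prog :=
  recu (lam (lam (caseS (var 0) (left (negSD (var 0)))
    (right (pair (app (var 2) (fstP (var 0))) (negSD (sndP (var 0))))))))

/-- The signed digit tree of `-K`. -/
def negTree : Prog :=
  recu (lam (lam (pair (app negList (fstP (var 0)))
    (lam (app (var 2) (app (sndP (var 1)) (negSD (var 0))))))))

/-- The signed digit tree of `{1}`. -/
def oneTree : Prog := recu (lam (pair (left digP) (lam (var 1))))

/-- The signed digit tree of the image of the negative part of `K` under the tent map. -/
def tentTree : Prog :=
  recu (lam (lam (case3 (app minList (fstP (var 0)))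
    (app (sndP (var 2)) digM)
    oneTree
    (pair (left digP) (lam (app (var 3) (app (sndP (var 2)) digZ)))))))

/-- The Gray code of the minimum of `K`. -/
def grayMin : Prog :=
  recu (lam (lam (case3 (app minList (fstP (var 0)))
    (pair grayM (app (var 3) (app (sndP (var 2)) digM)))
    (pair grayP (negG (app (var 3) (app (sndP (var 2)) digP))))
    (pair (fstP (app (var 2) (app (sndP (var 1)) digZ)))
      (pair grayP (negG (sndP (app (var 2) (app (sndP (var 1)) digZ)))))))))

/-- The Gray code tree of `K`. -/
def grayTree : Prog :=
  recu (lam (lam (pair (app grayMin (var 0)) (pair (negG (app grayMin (app negTree (var 0))))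
    (lam (caseS (var 0) (app (var 3) (app tentTree (var 2)))
      (app (var 3) (app tentTree (app negTree (var 2))))))))))

theorem minList_closed : minList.Closed := by simp [minList, Closed, ClosedAt]
theorem negList_closed : negList.Closed := by simp [negList, Closed, ClosedAt]
theorem oneTree_closed : oneTree.Closed := by simp [oneTree, Closed, ClosedAt]

theorem ClosedAt.mono : ∀ {m : Prog} {k l : ℕ}, ClosedAt k m → k ≤ l → ClosedAt l m := by
  intro m
  induction m with
  | var i => intro k l hm h; exact lt_of_lt_of_le hm h
  | nil => intros; trivial
  | bot => intros; trivial
  | left m ih => intro k l hm h; exact ih (k := k) hm h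
  | right m ih => intro k l hm h; exact ih (k := k) hm h
  | pair m n ihm ihn => intro k l hm h; exact ⟨ihm hm.1 h, ihn hm.2 h⟩
  | amb m n ihm ihn => intro k l hm h; exact ⟨ihm hm.1 h, ihn hm.2 h⟩
  | app m n ihm ihn => intro k l hm h; exact ⟨ihm hm.1 h, ihn hm.2 h⟩
  | recu m ih => intro k l hm h; exact ih (k := k) hm h
  | lam m ih => intro k l hm h; exact ih (k := k + 1) hm (by omega)
  | caseOf m n l r p f a ihm ihn ihl ihr ihp ihf iha =>
    intro k l ⟨hm, hn, hl, hr, hp, hf, ha⟩ h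
    exact ⟨ihm hm h, ihn hn h, ihl hl (by omega), ihr hr (by omega), ihp hp (by omega),
      ihf hf (by omega), iha ha (by omega)⟩

theorem Closed.closedAt {m : Prog} (h : m.Closed) (k : ℕ) : ClosedAt k m :=
  ClosedAt.mono (k := 0) h (Nat.zero_le k)

theorem negTree_closed : negTree.Closed := by
  simp [negTree, Closed, ClosedAt, negList_closed.closedAt]
theorem tentTree_closed : tentTree.Closed := by
  simp [tentTree, Closed, ClosedAt, minList_closed.closedAt, oneTree_closed.closedAt]
theorem grayMin_closed : grayMin.Closed := by
  simp [grayMin, Closed, ClosedAt, minList_closed.closedAt]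
theorem grayTree_closed : grayTree.Closed := by
  simp [grayTree, Closed, ClosedAt, grayMin_closed.closedAt, negTree_closed.closedAt,
    tentTree_closed.closedAt]

theorem grayTree_sequential : grayTree.Sequential := by
  simp [grayTree, grayMin, tentTree, negTree, oneTree, minList, negList, Sequential]

/-! ### Typing of the sequential programs -/

section Typing

variable {Γ : List (Set D)} {m : Prog}

theorem digM_type : HasType Γ digM tSD := .left (.left .nil)
theorem digP_type : HasType Γ digP tSD := .left (.right .nil)
theorem digZ_type : HasType Γ digZ tSD := .right .nil
theorem grayM_type : HasType Γ grayM tGC := .left .nil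
theorem grayP_type : HasType Γ grayP tGC := .right .nil

theorem HasType.negSD (h : HasType Γ m tSD) : HasType Γ (negSD m) tSD :=
  .caseS bot_mem_tSum h (.caseS bot_mem_tSum (.var 0 rfl) (.left (.right (.var 0 rfl)))
    (.left (.left (.var 0 rfl)))) (.right (.var 0 rfl))

theorem HasType.negGC (h : HasType Γ m tGC) : HasType Γ (negGC m) tGC :=
  .caseS bot_mem_tSum h (.right (.var 0 rfl)) (.left (.var 0 rfl))

theorem HasType.negG (h : HasType Γ m tG) : HasType Γ (negG m) tG := by
  have h' := h.conv tG_eq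
  exact (HasType.pair (.negGC (.fstP bot_mem_tSum h')) (.sndP adm_tG.bot h')).conv tG_eq.symm

theorem HasType.digits (h : HasType Γ m tSK) : HasType Γ (Prog.fstP m) (tPfin tSD) :=
  .fstP adm_tSD.tPfin.bot (h.conv tSK_eq)

theorem HasType.subtree {n : Prog} (h : HasType Γ m tSK) (k : HasType Γ n tSD) :
    HasType Γ (Prog.app (Prog.sndP m) n) tSK :=
  .app adm_tSK.bot (.sndP bot_mem_tFun (h.conv tSK_eq)) k

theorem HasType.tree {n : Prog} (h : HasType Γ m (tPfin tSD)) (k : HasType Γ n (tFun tSD tSK)) :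
    HasType Γ (Prog.pair m n) tSK :=
  (HasType.pair h k).conv tSK_eq.symm

theorem HasType.singleton {T : Set D} (h : HasType Γ m T) : HasType Γ (Prog.left m) (tPfin T) :=
  (HasType.left h).conv tPfin_eq.symm

theorem HasType.cons {T : Set D} {n : Prog} (h : HasType Γ m (tPfin T)) (k : HasType Γ n T) :
    HasType Γ (Prog.right (Prog.pair m n)) (tPfin T) :=
  (HasType.right (.pair h k)).conv tPfin_eq.symm

theorem minList_type : HasType Γ minList (tFun (tPfin tSD) tSD) :=
  .recu adm_tSD.tFun <| .lam <| .lam <|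
    .caseS bot_mem_tSum ((HasType.var 0 rfl).conv tPfin_eq) (.var 0 rfl)
      (.caseS (T := tGC) (U := tUnit) bot_mem_tSum
        (.app bot_mem_tSum (.var 2 rfl) (.fstP adm_tSD.tPfin.bot (.var 0 rfl)))
        (.caseS bot_mem_tSum (.var 0 rfl) digM_type (.sndP bot_mem_tSum (.var 2 rfl)))
        (.caseS (T := tGC) (U := tUnit) bot_mem_tSum (.sndP bot_mem_tSum (.var 1 rfl))
          (.caseS bot_mem_tSum (.var 0 rfl) digM_type digZ_type) digZ_type))

theorem negList_type : HasType Γ negList (tFun (tPfin tSD) (tPfin tSD)) :=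
  .recu adm_tSD.tPfin.tFun <| .lam <| .lam <|
    .caseS adm_tSD.tPfin.bot ((HasType.var 0 rfl).conv tPfin_eq) (.singleton (.negSD (.var 0 rfl)))
      (.cons (.app adm_tSD.tPfin.bot (.var 2 rfl) (.fstP adm_tSD.tPfin.bot (.var 0 rfl)))
        (.negSD (.sndP bot_mem_tSum (.var 0 rfl))))

theorem negTree_type : HasType Γ negTree (tFun tSK tSK) :=
  .recu adm_tSK.tFun <| .lam <| .lam <|
    .tree (.app adm_tSD.tPfin.bot negList_type (.digits (.var 0 rfl)))
      (.lam (.app adm_tSK.bot (.var 2 rfl) (.subtree (.var 1 rfl) (.negSD (.var 0 rfl)))))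

theorem oneTree_type : HasType Γ oneTree tSK :=
  .recu adm_tSK <| .lam <| .tree (.singleton digP_type) (.lam (.var 1 rfl))

theorem tentTree_type : HasType Γ tentTree (tFun tSK tSK) :=
  .recu adm_tSK.tFun <| .lam <| .lam <|
    .case3 adm_tSK.bot (.app bot_mem_tSum minList_type (.digits (.var 0 rfl)))
      (.subtree (.var 2 rfl) digM_type) oneTree_type
      (.tree (.singleton digP_type) (.lam (.app adm_tSK.bot (.var 3 rfl)
        (.subtree (.var 2 rfl) digZ_type))))

theorem grayMin_type : HasType Γ grayMin (tFun tSK tG) :=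
  .recu adm_tG.tFun <| .lam <| .lam <|
    .case3 adm_tG.bot (.app bot_mem_tSum minList_type (.digits (.var 0 rfl)))
      ((HasType.pair grayM_type
        (.app adm_tG.bot (.var 3 rfl) (.subtree (.var 2 rfl) digM_type))).conv tG_eq.symm)
      ((HasType.pair grayP_type (.negG
        (.app adm_tG.bot (.var 3 rfl) (.subtree (.var 2 rfl) digP_type)))).conv tG_eq.symm)
      (by
        have h : HasType (tUnit :: tSK :: tFun tSK tG :: Γ)
            (Prog.app (Prog.var 2) (Prog.app (Prog.sndP (Prog.var 1)) digZ)) (tProd tGC tG) :=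
          (HasType.app adm_tG.bot (.var 2 rfl) (.subtree (.var 1 rfl) digZ_type)).conv tG_eq
        exact (HasType.pair (.fstP bot_mem_tSum h) ((HasType.pair grayP_type
          (.negG (.sndP adm_tG.bot h))).conv tG_eq.symm)).conv tG_eq.symm)

theorem HasType.gray {n l : Prog} (h : HasType Γ m tG) (k : HasType Γ n tG)
    (hl : HasType Γ l (tFun tGC tGK)) : HasType Γ (Prog.pair m (Prog.pair n l)) tGK :=
  (HasType.pair h (.pair k hl)).conv tGK_eq.symm

theorem grayTree_type : HasType Γ grayTree (tFun tSK tGK) :=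
  .recu adm_tGK.tFun <| .lam <| .lam <|
    .gray (.app adm_tG.bot grayMin_type (.var 0 rfl))
      (.negG (.app adm_tG.bot grayMin_type (.app adm_tSK.bot negTree_type (.var 0 rfl))))
      (.lam (.caseS adm_tGK.bot (.var 0 rfl)
        (.app adm_tGK.bot (.var 3 rfl) (.app adm_tSK.bot tentTree_type (.var 2 rfl)))
        (.app adm_tGK.bot (.var 3 rfl) (.app adm_tSK.bot tentTree_type
          (.app adm_tSK.bot negTree_type (.var 2 rfl))))))

end Typing

end Prog

/-! ## Compact sets -/

theorem mem_II {d x : ℝ} : x ∈ II d ↔ (d - 1) / 2 ≤ x ∧ x ≤ (d + 1) / 2 := by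
  rw [II, Set.mem_ofPred_eq, abs_le]
  constructor <;> rintro ⟨h, k⟩ <;> constructor <;> linarith

theorem mem_part {K : Set ℝ} {d x : ℝ} :
    x ∈ part K d ↔ x ∈ K ∧ (d - 1) / 2 ≤ x ∧ x ≤ (d + 1) / 2 := by
  rw [part, Set.mem_inter_iff, mem_II]

theorem isClosed_II (d : ℝ) : IsClosed (II d) :=
  isClosed_le (by fun_prop) continuous_const

theorem tent_of_nonpos {x : ℝ} (h : x ≤ 0) : tent x = 1 + 2 * x := by
  rw [tent, abs_of_nonpos h]; ring

theorem tent_of_nonneg {x : ℝ} (h : 0 ≤ x) : tent x = 1 - 2 * x := by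
  rw [tent, abs_of_nonneg h]

theorem tent_neg (x : ℝ) : tent (-x) = tent x := by rw [tent, tent, abs_neg]

theorem tent_mem {x : ℝ} (h : -1 ≤ x ∧ x ≤ 1) : -1 ≤ tent x ∧ tent x ≤ 1 := by
  have h1 := abs_le.2 h
  have h2 := abs_nonneg x
  rw [tent]
  constructor <;> linarith

namespace IsK

variable {K : Set ℝ} {d : ℝ}

theorem isLeast (hK : IsK K) : IsLeast K (sInf K) := hK.2.1.isLeast_sInf hK.1

theorem isGreatest (hK : IsK K) : IsGreatest K (sSup K) := hK.2.1.isGreatest_sSup hK.1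

theorem bounds (hK : IsK K) {x : ℝ} (hx : x ∈ K) : -1 ≤ x ∧ x ≤ 1 := hK.2.2 hx

theorem neg (hK : IsK K) : IsK (Neg.neg '' K) := by
  refine ⟨hK.1.image _, hK.2.1.image continuous_neg, ?_⟩
  rintro _ ⟨x, hx, rfl⟩
  have := hK.bounds hx
  constructor <;> linarith

theorem isCompact_part (hK : IsK K) : IsCompact (part K d) := hK.2.1.inter_right (isClosed_II d)

theorem avInv (hK : IsK K) (h : (part K d).Nonempty) : IsK (avInv d '' part K d) := by
  refine ⟨h.image _, hK.isCompact_part.image (by unfold CFP.avInv; fun_prop), ?_⟩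
  rintro _ ⟨x, hx, rfl⟩
  obtain ⟨_, h1, h2⟩ := mem_part.1 hx
  rw [CFP.avInv]
  constructor <;> linarith

theorem tent (hK : IsK K) (h : (part K d).Nonempty) : IsK (tent '' part K d) := by
  refine ⟨h.image _, hK.isCompact_part.image (by unfold CFP.tent; fun_prop), ?_⟩
  rintro _ ⟨x, hx, rfl⟩
  exact tent_mem (hK.bounds (mem_part.1 hx).1)

theorem sInf_neg (hK : IsK K) : sInf (Neg.neg '' K) = -sSup K := by
  refine IsLeast.csInf_eq ⟨⟨_, hK.isGreatest.1, rfl⟩, ?_⟩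
  rintro _ ⟨x, hx, rfl⟩
  exact neg_le_neg (hK.isGreatest.2 hx)

theorem sSup_neg (hK : IsK K) : sSup (Neg.neg '' K) = -sInf K := by
  refine IsGreatest.csSup_eq ⟨⟨_, hK.isLeast.1, rfl⟩, ?_⟩
  rintro _ ⟨x, hx, rfl⟩
  exact neg_le_neg (hK.isLeast.2 hx)

theorem sInf_avInv (hK : IsK K) (h : sInf K ∈ II d) :
    sInf (CFP.avInv d '' part K d) = 2 * sInf K - d := by
  refine IsLeast.csInf_eq ⟨⟨_, ⟨hK.isLeast.1, h⟩, rfl⟩, ?_⟩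
  rintro _ ⟨x, hx, rfl⟩
  have := hK.isLeast.2 hx.1
  rw [CFP.avInv]
  linarith

theorem sSup_avInv (hK : IsK K) (h : sSup K ∈ II d) :
    sSup (CFP.avInv d '' part K d) = 2 * sSup K - d := by
  refine IsGreatest.csSup_eq ⟨⟨_, ⟨hK.isGreatest.1, h⟩, rfl⟩, ?_⟩
  rintro _ ⟨x, hx, rfl⟩
  have := hK.isGreatest.2 hx.1
  rw [CFP.avInv]
  linarith

theorem neg_neg_image (K : Set ℝ) : Neg.neg '' (Neg.neg '' K) = K := by
  simp

end IsK

theorem part_neg (K : Set ℝ) (d : ℝ) : part (Neg.neg '' K) d = Neg.neg '' part K (-d) := by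
  ext x
  constructor
  · rintro ⟨⟨y, hy, rfl⟩, h⟩
    have h := mem_II.1 h
    exact ⟨y, ⟨hy, mem_II.2 ⟨by linarith, by linarith⟩⟩, rfl⟩
  · rintro ⟨y, ⟨hy, h⟩, rfl⟩
    have h := mem_II.1 h
    exact ⟨⟨y, hy, rfl⟩, mem_II.2 ⟨by linarith, by linarith⟩⟩

theorem avInv_neg (d : ℝ) (K : Set ℝ) :
    avInv d '' (Neg.neg '' K) = Neg.neg '' (avInv (-d) '' K) := by
  rw [Set.image_image, Set.image_image]
  exact Set.image_congr fun x _ => by rw [avInv, avInv]; ring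

theorem tent_image_neg (K : Set ℝ) : tent '' (Neg.neg '' K) = tent '' K := by
  rw [Set.image_image]
  exact Set.image_congr fun x _ => tent_neg x

/-- On the left half `t x = 2x + 1`, the inverse average map of the digit `-1`: the signed digit
subtree and the Gray subtree at `-1` belong to the same set. -/
theorem tent_part_neg_one (K : Set ℝ) : tent '' part K (-1) = avInv (-1) '' part K (-1) :=
  Set.image_congr fun x hx => by
    have := (mem_part.1 hx).2
    rw [tent_of_nonpos (by linarith), avInv]; ring

/-- On the right half `t x = -(2x - 1)`: the two subtrees at `1` belong to sets that differ by a
reflection. -/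
theorem tent_part_one (K : Set ℝ) :
    tent '' part K 1 = Neg.neg '' (avInv 1 '' part K 1) := by
  rw [Set.image_image]
  exact Set.image_congr fun x hx => by
    have := (mem_part.1 hx).2
    rw [tent_of_nonneg (by linarith), avInv]; ring

/-! ## Realisers -/

section Realisers

theorem mem_rSD {d : ℝ} {a : D} : a ∈ rSD d ↔ (d = -1 ∧ a = D.left (D.left D.nil)) ∨
    (d = 1 ∧ a = D.left (D.right D.nil)) ∨ (d = 0 ∧ a = D.right D.nil) := by
  constructor
  · rintro (⟨_, ⟨_, ⟨rfl, h⟩, rfl⟩ | ⟨_, ⟨rfl, h⟩, rfl⟩, rfl⟩ | ⟨_, ⟨rfl, h⟩, rfl⟩)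
    · exact Or.inl ⟨h, rfl⟩
    · exact Or.inr (Or.inl ⟨h, rfl⟩)
    · exact Or.inr (Or.inr ⟨h, rfl⟩)
  · rintro (⟨h, rfl⟩ | ⟨h, rfl⟩ | ⟨h, rfl⟩)
    · exact Or.inl ⟨_, Or.inl ⟨_, ⟨rfl, h⟩, rfl⟩, rfl⟩
    · exact Or.inl ⟨_, Or.inr ⟨_, ⟨rfl, h⟩, rfl⟩, rfl⟩
    · exact Or.inr ⟨_, ⟨rfl, h⟩, rfl⟩

theorem digM_mem : D.left (D.left D.nil) ∈ rSD (-1) := mem_rSD.2 (Or.inl ⟨rfl, rfl⟩)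
theorem digP_mem : D.left (D.right D.nil) ∈ rSD 1 := mem_rSD.2 (Or.inr (Or.inl ⟨rfl, rfl⟩))
theorem digZ_mem : D.right D.nil ∈ rSD 0 := mem_rSD.2 (Or.inr (Or.inr ⟨rfl, rfl⟩))

theorem rSD_subset (d : ℝ) : rSD d ⊆ tSD := by
  intro a ha
  rcases mem_rSD.1 ha with ⟨_, rfl⟩ | ⟨_, rfl⟩ | ⟨_, rfl⟩
  · exact left_mem_tSum (left_mem_tSum (Or.inr rfl))
  · exact left_mem_tSum (right_mem_tSum (Or.inr rfl))
  · exact right_mem_tSum (Or.inr rfl)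

theorem negSD_mem {d : ℝ} {a : D} (h : a ∈ rSD d) : D.negSD a ∈ rSD (-d) := by
  rw [mem_rSD] at h ⊢
  rcases h with ⟨rfl, rfl⟩ | ⟨rfl, rfl⟩ | ⟨rfl, rfl⟩ <;> simp [D.negSD]

theorem mem_rGC {d : ℝ} {a : D} :
    a ∈ rGC d ↔ (d = -1 ∧ a = D.left D.nil) ∨ (d = 1 ∧ a = D.right D.nil) := by
  constructor
  · rintro (⟨_, ⟨rfl, h⟩, rfl⟩ | ⟨_, ⟨rfl, h⟩, rfl⟩)
    · exact Or.inl ⟨h, rfl⟩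
    · exact Or.inr ⟨h, rfl⟩
  · rintro (⟨h, rfl⟩ | ⟨h, rfl⟩)
    · exact Or.inl ⟨_, ⟨rfl, h⟩, rfl⟩
    · exact Or.inr ⟨_, ⟨rfl, h⟩, rfl⟩

theorem rGC_subset (d : ℝ) : rGC d ⊆ tGC := by
  intro a ha
  rcases mem_rGC.1 ha with ⟨_, rfl⟩ | ⟨_, rfl⟩
  · exact left_mem_tSum (Or.inr rfl)
  · exact right_mem_tSum (Or.inr rfl)

/-! ### Finite sets -/

section Pfin

variable {P : ℝ → Set D}

theorem rPfin_singleton {x : ℝ} {a : D} (h : a ∈ P x) : D.left a ∈ rPfin P {x} := by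
  simp only [rPfin, mu, sInf_apply, Set.iInf_eq_iInter, Set.mem_iInter]
  rintro ⟨Z, hZ⟩
  exact hZ {x} (Or.inl ⟨a, ⟨x, h, rfl⟩, rfl⟩)

theorem rPfin_union {x : ℝ} {u : Set ℝ} {a l : D} (hl : l ∈ rPfin P u) (h : a ∈ P x) :
    D.right (D.pair l a) ∈ rPfin P (u ∪ {x}) := by
  simp only [rPfin, mu, sInf_apply, Set.iInf_eq_iInter, Set.mem_iInter] at hl ⊢
  rintro ⟨Z, hZ⟩
  exact hZ _ (Or.inr ⟨_, ⟨u, x, ⟨l, hl ⟨Z, hZ⟩, a, h, rfl⟩, rfl⟩, rfl⟩)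

theorem rPfin_induction {C : Set ℝ → D → Prop} (h1 : ∀ x, ∀ a ∈ P x, C {x} (D.left a))
    (h2 : ∀ u l x a, C u l → a ∈ P x → C (u ∪ {x}) (D.right (D.pair l a)))
    {u : Set ℝ} {l : D} (h : l ∈ rPfin P u) : C u l := by
  refine mu_le (x := fun u => {l | C u l}) (fun u l hl => ?_) u h
  rcases hl with ⟨a, ⟨x, ha, rfl⟩, rfl⟩ | ⟨_, ⟨v, x, ⟨l, hl, a, ha, rfl⟩, rfl⟩, rfl⟩
  · exact h1 x a ha
  · exact h2 v l x a hl ha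

theorem rPfin_subset {T : Set D} (hP : ∀ x, P x ⊆ T) (u : Set ℝ) : rPfin P u ⊆ tPfin T := by
  intro l hl
  refine rPfin_induction (C := fun _ l => l ∈ tPfin T) (fun x a ha => ?_)
    (fun u l x a hl ha => ?_) hl
  · rw [tPfin_eq]; exact left_mem_tSum (hP x ha)
  · rw [tPfin_eq]; exact right_mem_tSum (pair_mem_tProd hl (hP x ha))

end Pfin

/-! ### Gray codes -/

/-- Realisers of `x ≠ 0 → x ≤ 0 ∨ x ≥ 0`. -/
abbrev rSign (x : ℝ) : Set D := rImpNc tGC (x ≠ 0) (rOr (rNc (x ≤ 0)) (rNc (x ≥ 0)))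

theorem grayM_mem {x : ℝ} (h : x ≤ 0) : D.left D.nil ∈ rSign x :=
  ⟨left_mem_tSum (Or.inr rfl), fun _ => Or.inl ⟨_, ⟨rfl, h⟩, rfl⟩⟩

theorem grayP_mem {x : ℝ} (h : 0 ≤ x) : D.right D.nil ∈ rSign x :=
  ⟨right_mem_tSum (Or.inr rfl), fun _ => Or.inr ⟨_, ⟨rfl, h⟩, rfl⟩⟩

/-- At `0` the digit is constrained only by its type, but both of its possible values are then true
statements about the sign. So a defined digit can always be trusted, and an undefined one means `x =
0`. -/
theorem rSign_cases {x : ℝ} {g : D} (h : g ∈ rSign x) : (g = ⊥ ∧ x = 0) ∨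
    (∃ u, g = D.left u ∧ x ≤ 0) ∨ ∃ u, g = D.right u ∧ 0 ≤ x := by
  by_cases hx : x = 0
  · rcases mem_tSum.1 h.1 with e | ⟨u, _, e⟩ | ⟨u, _, e⟩
    · exact Or.inl ⟨e, hx⟩
    · exact Or.inr (Or.inl ⟨u, e, hx.le⟩)
    · exact Or.inr (Or.inr ⟨u, e, hx.ge⟩)
  · rcases h.2 hx with ⟨u, hu, rfl⟩ | ⟨u, hu, rfl⟩
    · exact Or.inr (Or.inl ⟨u, rfl, hu.2⟩)
    · exact Or.inr (Or.inr ⟨u, rfl, hu.2⟩)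

theorem negGC_mem_tGC {g : D} (h : g ∈ tGC) : D.negGC g ∈ tGC := by
  rcases mem_tSum.1 h with rfl | ⟨u, hu, rfl⟩ | ⟨u, hu, rfl⟩
  · rwa [D.negGC_bot]
  · rw [D.negGC_left]; exact right_mem_tSum hu
  · rw [D.negGC_right]; exact left_mem_tSum hu

theorem negGC_mem {x : ℝ} {g : D} (h : g ∈ rSign x) : D.negGC g ∈ rSign (-x) := by
  refine ⟨negGC_mem_tGC h.1, fun hx => ?_⟩
  rcases h.2 (by simpa using hx) with ⟨u, hu, rfl⟩ | ⟨u, hu, rfl⟩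
  · rw [D.negGC_left]; exact Or.inr ⟨u, ⟨hu.1, by simpa using hu.2⟩, rfl⟩
  · rw [D.negGC_right]; exact Or.inl ⟨u, ⟨hu.1, by simpa using hu.2⟩, rfl⟩

theorem negGC_rGC {d : ℝ} {g : D} (h : g ∈ rGC d) : D.negGC g ∈ rGC (-d) := by
  rw [mem_rGC] at h ⊢
  rcases h with ⟨rfl, rfl⟩ | ⟨rfl, rfl⟩ <;> simp

theorem rGOp_mono : Monotone fun (Y : ℝ → Set D) x => {a | (-1 ≤ x ∧ x ≤ 1) ∧
    a ∈ rAnd (rSign x) (Y (tent x))} :=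
  fun _ _ h _ _ ha => ⟨ha.1, Set.image2_subset le_rfl (h _) ha.2⟩

theorem mem_rG {x : ℝ} {a : D} : a ∈ rG x ↔ (-1 ≤ x ∧ x ≤ 1) ∧
    ∃ g ∈ rSign x, ∃ b ∈ rG (tent x), D.pair g b = a :=
  Set.ext_iff.1 (congrFun (nu_unfold rGOp_mono) x) a

theorem pair_mem_rG {x : ℝ} {g b : D} (hx : -1 ≤ x ∧ x ≤ 1) (hg : g ∈ rSign x)
    (hb : b ∈ rG (tent x)) : D.pair g b ∈ rG x :=
  mem_rG.2 ⟨hx, g, hg, b, hb, rfl⟩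

/-- The tent map is even, so only the first digit changes. -/
theorem negG_mem {x : ℝ} {a : D} (h : a ∈ rG x) : D.negG a ∈ rG (-x) := by
  obtain ⟨hx, g, hg, b, hb, rfl⟩ := mem_rG.1 h
  rw [D.negG_pair]
  exact pair_mem_rG ⟨by linarith, by linarith⟩ (negGC_mem hg) (by rwa [tent_neg])

/-- Partial Gray codes, of which the first `n` digits are correct. -/
def rGn : ℕ → ℝ → Set D
  | 0, _ => Set.univ
  | n + 1, x => {a | (-1 ≤ x ∧ x ≤ 1) ∧ a ∈ rAnd (rSign x) (rGn n (tent x))}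

/-- Replaces coinduction by induction on the number of correct digits. `grayMin` negates and
rearranges the result of its recursive call, which plain coinduction does not allow directly. The
tails obtained for different `n` agree since `D.pair` is injective. -/
theorem mem_rG_of_rGn {x : ℝ} {a : D} (h : ∀ n, a ∈ rGn n x) : a ∈ rG x := by
  refine le_nu (x := fun x => {a | ∀ n, a ∈ rGn n x}) (fun x a h => ?_) x h
  obtain ⟨hx, g, hg, b, _, rfl⟩ := h 1
  refine ⟨hx, g, hg, b, fun n => ?_, rfl⟩
  obtain ⟨_, g', _, b', hb', e⟩ := h (n + 1)
  rwa [← (D.pair_inj e).2]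

theorem negG_mem_rGn {n : ℕ} {x : ℝ} {a : D} (h : a ∈ rGn n x) : D.negG a ∈ rGn n (-x) := by
  cases n with
  | zero => trivial
  | succ n =>
    obtain ⟨hx, g, hg, b, hb, rfl⟩ := h
    rw [D.negG_pair]
    exact ⟨⟨by linarith, by linarith⟩, _, negGC_mem hg, b, by rwa [tent_neg], rfl⟩

/-! ### Signed digit trees and Gray code trees -/

variable {α : Set D} {Y : Set ℝ → Set D} {K : Set ℝ} {c : D}

/-- The type conditions inside the nested implications all follow from `f ∈ tFun tSD α`; as `f` may
be `⊥`, this uses `⊥ ∈ α`. -/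
theorem mem_rStep (hα : ⊥ ∈ α) : c ∈ rStep α Y K ↔ ∃ E l f, c = D.pair l f ∧ Covers E K ∧
    l ∈ rPfin rSD E ∧ f ∈ tFun tSD α ∧
    ∀ d ∈ E, ∀ a ∈ rSD d, (part K d).Nonempty ∧ D.app f a ∈ Y (avInv d '' part K d) := by
  constructor
  · rintro ⟨E, hE, l, hl, f, hf, rfl⟩
    have hf := Set.mem_iInter.1 hf
    -- The type condition is the same for every index of the intersection; `0` is an arbitrary
    -- choice.
    exact ⟨E, l, f, rfl, hE, hl, (hf 0).1, fun d hd a ha => ((hf d).2 a ha).2 hd⟩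
  · rintro ⟨E, l, f, rfl, hE, hl, hf, h⟩
    refine ⟨E, hE, l, hl, f, Set.mem_iInter.2 fun d => ⟨hf, fun a ha => ⟨?_, fun hd => h d hd a ha⟩⟩,
      rfl⟩
    exact app_mem hf (rSD_subset d ha) hα

theorem rStep_mono (hα : ⊥ ∈ α) : Monotone (rStep α) := by
  intro Y Z h K c hc
  obtain ⟨E, l, f, e, hE, hl, hf, k⟩ := (mem_rStep hα).1 hc
  exact (mem_rStep hα).2 ⟨E, l, f, e, hE, hl, hf, fun d hd a ha =>
    ⟨(k d hd a ha).1, h _ (k d hd a ha).2⟩⟩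

theorem rSKOp_mono : Monotone fun (Y : Set ℝ → Set D) K => {c | IsK K ∧ c ∈ rStep tSK Y K} :=
  fun _ _ h _ _ hc => ⟨hc.1, rStep_mono adm_tSK.bot h _ hc.2⟩

theorem mem_rSK : c ∈ rSK K ↔ IsK K ∧ c ∈ rStep tSK rSK K :=
  Set.ext_iff.1 (congrFun (nu_unfold rSKOp_mono) K) c

theorem rSK_subset (K : Set ℝ) : rSK K ⊆ tSK := by
  intro c hc
  obtain ⟨E, l, f, rfl, -, hl, hf, -⟩ := (mem_rStep adm_tSK.bot).1 (mem_rSK.1 hc).2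
  rw [tSK_eq]
  exact pair_mem_tProd (rPfin_subset rSD_subset E hl) hf

/-- One unfolding of the Gray code trees. -/
def rGKOp (Y : Set ℝ → Set D) (K : Set ℝ) : Set D :=
  {c | IsK K ∧ c ∈ rAnd (rG (sInf K)) (rAnd (rG (sSup K))
    (⋂ d, rImp tGC tGK (rGC d) (rImpNc tGK (part K d).Nonempty (Y (tent '' part K d)))))}

theorem mem_rGKOp : c ∈ rGKOp Y K ↔
    IsK K ∧ ∃ a ∈ rG (sInf K), ∃ b ∈ rG (sSup K), ∃ f ∈ tFun tGC tGK, c = D.pair a (D.pair b f) ∧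
      ∀ d, ∀ g ∈ rGC d, (part K d).Nonempty → D.app f g ∈ Y (tent '' part K d) := by
  refine and_congr_right fun _ => ⟨?_, ?_⟩
  · rintro ⟨a, ha, _, ⟨b, hb, f, hf, rfl⟩, rfl⟩
    have hf := Set.mem_iInter.1 hf
    exact ⟨a, ha, b, hb, f, (hf 0).1, rfl, fun d g hg => ((hf d).2 g hg).2⟩
  · rintro ⟨a, ha, b, hb, f, hf, rfl, h⟩
    exact ⟨a, ha, _, ⟨b, hb, f, Set.mem_iInter.2 fun d => ⟨hf, fun g hg =>
      ⟨app_mem hf (rGC_subset d hg) adm_tGK.bot, h d g hg⟩⟩, rfl⟩, rfl⟩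

theorem rGKOp_mono : Monotone rGKOp := by
  intro Y Z h K c hc
  obtain ⟨hK, a, ha, b, hb, f, hf, e, k⟩ := mem_rGKOp.1 hc
  exact mem_rGKOp.2 ⟨hK, a, ha, b, hb, f, hf, e, fun d g hg hd => h _ (k d g hg hd)⟩

theorem rGK_eq : rGK = nu rGKOp := rfl

theorem mem_rGK : c ∈ rGK K ↔
    IsK K ∧ ∃ a ∈ rG (sInf K), ∃ b ∈ rG (sSup K), ∃ f ∈ tFun tGC tGK, c = D.pair a (D.pair b f) ∧
      ∀ d, ∀ g ∈ rGC d, (part K d).Nonempty → D.app f g ∈ rGK (tent '' part K d) := by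
  rw [← mem_rGKOp, rGK_eq, ← nu_unfold rGKOp_mono]

theorem rG_subset (x : ℝ) : rG x ⊆ tG := by
  have h : {a | ∃ x, a ∈ rG x} ≤ tProd tGC {a | ∃ x, a ∈ rG x} := by
    rintro a ⟨x, hx⟩
    obtain ⟨-, g, hg, b, hb, rfl⟩ := mem_rG.1 hx
    exact pair_mem_tProd hg.1 ⟨_, hb⟩
  exact fun a ha => le_nu h ⟨x, ha⟩

theorem rGK_subset (K : Set ℝ) : rGK K ⊆ tGK := by
  intro c hc
  obtain ⟨-, a, ha, b, hb, f, hf, rfl, -⟩ := mem_rGK.1 hc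
  rw [tGK_eq]
  exact pair_mem_tProd (rG_subset _ ha) (pair_mem_tProd (rG_subset _ hb) hf)

end Realisers

/-! ## From signed digit trees to Gray code trees: correctness -/

section Values

variable (a d f l T : D)

theorem app_minList_left : D.app Prog.minList.val (D.left d) = d :=
  (Prog.app_val_rec _ _).trans (by simp)

theorem app_minList_right : D.app Prog.minList.val (D.right (D.pair l d)) =
    D.caseS (D.app Prog.minList.val l)
      (fun u => D.caseS u (fun _ => D.left (D.left D.nil)) fun _ => d)
      (fun _ => D.caseS d (fun u => D.caseS u (fun _ => D.left (D.left D.nil))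
        fun _ => D.right D.nil) fun _ => D.right D.nil) :=
  (Prog.app_val_rec _ _).trans (by simp; rfl)

theorem app_negList_left : D.app Prog.negList.val (D.left d) = D.left (D.negSD d) :=
  (Prog.app_val_rec _ _).trans (by simp)

theorem app_negList_right : D.app Prog.negList.val (D.right (D.pair l d)) =
    D.right (D.pair (D.app Prog.negList.val l) (D.negSD d)) :=
  (Prog.app_val_rec _ _).trans (by simp; rfl)

/-- The second component is the value of an abstraction in some environment. It is kept anonymous,
since only its values under application matter; the same form is used for the other programs which
return functions. -/
theorem app_negTree : ∃ h, D.app Prog.negTree.val (D.pair l f) =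
    D.pair (D.app Prog.negList.val l) h ∧
    ∀ d, D.app h d = D.app Prog.negTree.val (D.app f (D.negSD d)) := by
  have key : D.app Prog.negTree.val _ = _ := Prog.app_val_rec _ (D.pair l f)
  rw [Prog.den_pair] at key
  refine ⟨_, key.trans (congrArg₂ D.pair (by simp [Prog.negList_closed.den_eq]) rfl), fun d => ?_⟩
  rw [Prog.app_lam]
  simp
  rfl

theorem oneTree_eq : ∃ h, Prog.oneTree.val = D.pair (D.left (D.left (D.right D.nil))) h ∧
    ∀ d, D.app h d = Prog.oneTree.val := by
  have key : Prog.oneTree.val = _ := (D.lfp_eq _).trans (Prog.app_lam _ _ _)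
  rw [Prog.den_pair] at key
  refine ⟨_, key.trans (congrArg₂ D.pair (by simp) rfl), fun d => ?_⟩
  rw [Prog.app_lam]
  rfl

theorem app_tentTree_neg_one (h : D.app Prog.minList.val l = D.left (D.left D.nil)) :
    D.app Prog.tentTree.val (D.pair l f) = D.app f (D.left (D.left D.nil)) :=
  (Prog.app_val_rec _ _).trans (by simp [Prog.minList_closed.den_eq, h])

theorem app_tentTree_one (h : D.app Prog.minList.val l = D.left (D.right D.nil)) :
    D.app Prog.tentTree.val (D.pair l f) = Prog.oneTree.val :=
  (Prog.app_val_rec _ _).trans (by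
    simp [Prog.minList_closed.den_eq, Prog.oneTree_closed.den_eq, h])

theorem app_tentTree_zero (h : D.app Prog.minList.val l = D.right D.nil) :
    ∃ k, D.app Prog.tentTree.val (D.pair l f) = D.pair (D.left (D.left (D.right D.nil))) k ∧
    ∀ d, D.app k d = D.app Prog.tentTree.val (D.app f (D.right D.nil)) := by
  have key : D.app Prog.tentTree.val _ = _ := Prog.app_val_rec _ (D.pair l f)
  simp only [Prog.den_caseS, Prog.den_app, Prog.minList_closed.den_eq, Prog.den_fstP, Prog.den_var,
    push_zero, D.fst_pair, h, D.caseS_right] at key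
  rw [Prog.den_pair] at key
  refine ⟨_, key.trans (congrArg₂ D.pair (by simp) rfl), fun d => ?_⟩
  rw [Prog.app_lam]
  simp
  rfl

theorem app_grayMin_neg_one (h : D.app Prog.minList.val l = D.left (D.left D.nil)) :
    D.app Prog.grayMin.val (D.pair l f) =
      D.pair (D.left D.nil) (D.app Prog.grayMin.val (D.app f (D.left (D.left D.nil)))) :=
  (Prog.app_val_rec _ _).trans (by simp [Prog.minList_closed.den_eq, h]; rfl)

theorem app_grayMin_one (h : D.app Prog.minList.val l = D.left (D.right D.nil)) :
    D.app Prog.grayMin.val (D.pair l f) =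
      D.pair (D.right D.nil) (D.negG (D.app Prog.grayMin.val (D.app f (D.left (D.right D.nil))))) :=
  (Prog.app_val_rec _ _).trans (by simp [Prog.minList_closed.den_eq, h]; rfl)

/-- For a minimum `x` with first digit `0` and `y = 2x`: the sign of `x` is that of `y`, the second
Gray digit is `1` because `t x ≥ 0`, and the rest is the code of `t (t x) = -t y`, the tail for `y`
with its first digit negated. -/
theorem app_grayMin_zero (h : D.app Prog.minList.val l = D.right D.nil) :
    D.app Prog.grayMin.val (D.pair l f) =
      D.pair (D.fst (D.app Prog.grayMin.val (D.app f (D.right D.nil)))) (D.pair (D.right D.nil)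
        (D.negG (D.snd (D.app Prog.grayMin.val (D.app f (D.right D.nil)))))) :=
  (Prog.app_val_rec _ _).trans (by simp [Prog.minList_closed.den_eq, h]; rfl)

theorem app_grayTree : ∃ h, D.app Prog.grayTree.val T = D.pair (D.app Prog.grayMin.val T)
    (D.pair (D.negG (D.app Prog.grayMin.val (D.app Prog.negTree.val T))) h) ∧
    (∀ u, D.app h (D.left u) = D.app Prog.grayTree.val (D.app Prog.tentTree.val T)) ∧
    ∀ u, D.app h (D.right u) = D.app Prog.grayTree.val
      (D.app Prog.tentTree.val (D.app Prog.negTree.val T)) := by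
  have key : D.app Prog.grayTree.val _ = _ := Prog.app_val_rec _ T
  rw [Prog.den_pair, Prog.den_pair] at key
  refine ⟨_, key.trans (congrArg₂ D.pair (by simp [Prog.grayMin_closed.den_eq])
    (congrArg₂ D.pair (by simp [Prog.grayMin_closed.den_eq, Prog.negTree_closed.den_eq]) rfl)),
    fun u => ?_, fun u => ?_⟩
  · rw [Prog.app_lam]
    simp [Prog.tentTree_closed.den_eq]
    rfl
  · rw [Prog.app_lam]
    simp [Prog.tentTree_closed.den_eq, Prog.negTree_closed.den_eq]
    rfl

end Values

/-! ### Minima, reflections and tent images of signed digit trees -/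

section Correctness

variable {K E : Set ℝ} {l T : D}

theorem minList_spec (h : l ∈ rPfin rSD E) :
    ∃ d, IsLeast E d ∧ D.app Prog.minList.val l ∈ rSD d := by
  refine rPfin_induction (C := fun E l => ∃ d, IsLeast E d ∧ D.app Prog.minList.val l ∈ rSD d)
    (fun x a ha => ⟨x, isLeast_singleton, by rwa [app_minList_left]⟩) ?_ h
  rintro u l x a ⟨d, hd, hl⟩ ha
  have key : D.app Prog.minList.val (D.right (D.pair l a)) ∈ rSD (min d x) := by
    rw [app_minList_right]
    rcases mem_rSD.1 hl with ⟨rfl, e⟩ | ⟨rfl, e⟩ | ⟨rfl, e⟩ <;>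
    rcases mem_rSD.1 ha with ⟨rfl, rfl⟩ | ⟨rfl, rfl⟩ | ⟨rfl, rfl⟩ <;>
    simp [e, mem_rSD]
  exact ⟨_, hd.union isLeast_singleton, key⟩

theorem negList_spec (h : l ∈ rPfin rSD E) :
    D.app Prog.negList.val l ∈ rPfin rSD (Neg.neg '' E) := by
  refine rPfin_induction (C := fun E l => D.app Prog.negList.val l ∈ rPfin rSD (Neg.neg '' E))
    (fun x a ha => ?_) (fun u l x a hl ha => ?_) h
  · rw [app_negList_left, Set.image_singleton]
    exact rPfin_singleton (negSD_mem ha)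
  · rw [app_negList_right, Set.image_union, Set.image_singleton]
    exact rPfin_union hl (negSD_mem ha)

/-- Gives the anonymous functions returned by programs their type, read off the type of the whole
result. -/
theorem of_pair_mem_tProd {T U : Set D} {a b : D} (h : D.pair a b ∈ tProd T U) :
    a ∈ T ∧ b ∈ U := by
  rcases mem_tProd.1 h with e | ⟨a', ha, b', hb, e⟩
  · exact absurd e (D.ne_bot_of_view (by simp))
  · obtain ⟨rfl, rfl⟩ := D.pair_inj e
    exact ⟨ha, hb⟩

theorem le_rSK {Y : Set ℝ → Set D} (h : ∀ K, ∀ c ∈ Y K, IsK K ∧ c ∈ rStep tSK Y K) :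
    Y ≤ rSK :=
  le_nu fun K c hc => h K c hc

theorem isK_one : IsK {1} :=
  ⟨Set.singleton_nonempty _, isCompact_singleton, by simp⟩

theorem part_one_one : part {1} 1 = {1} := by
  ext x
  rw [mem_part]
  refine ⟨fun h => h.1, ?_⟩
  rintro rfl
  exact ⟨rfl, by norm_num, by norm_num⟩

theorem avInv_one_one : avInv 1 '' {1} = {1} := by
  rw [Set.image_singleton, avInv]; norm_num

theorem covers_singleton {d : ℝ} : Covers {d} K ↔ K ⊆ II d := by
  simp [Covers]

/-- Since `2 * 1 - 1 = 1`, the set `{1}` is its own subtree set at the digit `1`. -/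
theorem oneTree_mem : Prog.oneTree.val ∈ rSK {1} := by
  refine le_rSK (Y := fun K => {c | K = {1} ∧ c = Prog.oneTree.val}) ?_ {1} ⟨rfl, rfl⟩
  rintro K c ⟨rfl, rfl⟩
  obtain ⟨h, e, he⟩ := oneTree_eq
  refine ⟨isK_one, (mem_rStep adm_tSK.bot).2 ⟨{1}, _, h, e, ?_, rPfin_singleton digP_mem, ?_, ?_⟩⟩
  · rw [covers_singleton]
    rintro _ rfl
    exact mem_II.2 ⟨by norm_num, by norm_num⟩
  · have := (Prog.oneTree_type (Γ := [])).val_mem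
    rw [e, tSK_eq] at this
    exact (of_pair_mem_tProd this).2
  · rintro _ rfl a -
    rw [part_one_one, avInv_one_one]
    exact ⟨Set.singleton_nonempty _, rfl, he a⟩

/-- Reflection turns the part of `K` at `d` into the part of `-K` at `-d`, and it commutes with the
inverse average maps up to the sign of the digit. Hence the coinduction closes with negated digits.
-/
theorem negTree_spec (h : T ∈ rSK K) : D.app Prog.negTree.val T ∈ rSK (Neg.neg '' K) := by
  refine le_rSK (Y := fun L => {c | ∃ K, ∃ T ∈ rSK K, L = Neg.neg '' K ∧
    c = D.app Prog.negTree.val T}) ?_ _ ⟨K, T, h, rfl, rfl⟩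
  rintro _ _ ⟨K, T, hT, rfl, rfl⟩
  obtain ⟨hK, hT'⟩ := mem_rSK.1 hT
  obtain ⟨E, l, f, rfl, hE, hl, hf, k⟩ := (mem_rStep adm_tSK.bot).1 hT'
  obtain ⟨h, e, he⟩ := app_negTree f l
  refine ⟨hK.neg, (mem_rStep adm_tSK.bot).2
    ⟨Neg.neg '' E, _, h, e, ?_, negList_spec hl, ?_, ?_⟩⟩
  · rintro _ ⟨x, hx, rfl⟩
    obtain ⟨d, hd, hx⟩ := Set.mem_iUnion₂.1 (hE hx)
    refine Set.mem_iUnion₂.2 ⟨-d, ⟨d, hd, rfl⟩, ?_⟩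
    rw [mem_II] at hx ⊢
    constructor <;> linarith
  · have := app_mem (Prog.negTree_type (Γ := [])).val_mem (rSK_subset K hT) adm_tSK.bot
    rw [e, tSK_eq] at this
    exact (of_pair_mem_tProd this).2
  · rintro _ ⟨d, hd, rfl⟩ a ha
    -- The subtree of the given tree has to be looked up at the opposite digit.
    have ha' := negSD_mem ha
    rw [neg_neg] at ha'
    have := k d hd _ ha'
    rw [part_neg, avInv_neg, neg_neg, he]
    exact ⟨this.1.image _, _, _, this.2, rfl, rfl⟩

/-- Case distinction on the least digit. For `-1` the required tree is the subtree at `-1`. For `1`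
all of `K` is non-negative, so the left half is `{0}` with image `{1}`. For `0` the left half lies
in `[-1/2, 0]`, so its image lies in `[0, 1]` and has the single digit `1`; below it one finds the
tent image of the left half of the doubled middle part, which is the same problem again. -/
theorem tentTree_spec (h : T ∈ rSK K) (hd : (part K (-1)).Nonempty) :
    D.app Prog.tentTree.val T ∈ rSK (tent '' part K (-1)) := by
  -- All of `rSK` is included in the coinductive witness, because in two of the three cases the
  -- program ends in a tree already known to be correct.
  refine le_rSK (Y := fun L => {c | c ∈ rSK L ∨ ∃ K, ∃ T ∈ rSK K, (part K (-1)).Nonempty ∧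
    L = tent '' part K (-1) ∧ c = D.app Prog.tentTree.val T}) ?_ _
    (Or.inr ⟨K, T, h, hd, rfl, rfl⟩)
  clear h hd
  have triv : ∀ K, ∀ c ∈ rSK K, IsK K ∧ c ∈ rStep tSK (fun L => {c | c ∈ rSK L ∨ ∃ K, ∃ T ∈ rSK K,
      (part K (-1)).Nonempty ∧ L = tent '' part K (-1) ∧ c = D.app Prog.tentTree.val T}) K := by
    intro K c hc
    obtain ⟨hK, hc⟩ := mem_rSK.1 hc
    exact ⟨hK, rStep_mono adm_tSK.bot (fun _ _ => Or.inl) _ hc⟩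
  rintro L c (hc | ⟨K, T, hT, hne, rfl, rfl⟩)
  · exact triv L c hc
  obtain ⟨hK, hT'⟩ := mem_rSK.1 hT
  obtain ⟨E, l, f, rfl, hE, hl, hf, k⟩ := (mem_rStep adm_tSK.bot).1 hT'
  obtain ⟨d, hd, hm⟩ := minList_spec hl
  have low : ∀ x ∈ K, (d - 1) / 2 ≤ x := fun x hx => by
    obtain ⟨e, he, hx⟩ := Set.mem_iUnion₂.1 (hE hx)
    have := hd.2 he
    have := (mem_II.1 hx).1
    linarith
  rcases mem_rSD.1 hm with ⟨rfl, e⟩ | ⟨rfl, e⟩ | ⟨rfl, e⟩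
  · rw [app_tentTree_neg_one _ _ e, tent_part_neg_one]
    exact triv _ _ (k _ hd.1 _ digM_mem).2
  · rw [app_tentTree_one _ _ e]
    -- Here `K ≥ 0`, so the left half of `K` can only contain `0`, and `t 0 = 1`.
    have : tent '' part K (-1) = {1} := by
      have h0 : ∀ x ∈ part K (-1), x = 0 := fun x hx => by
        obtain ⟨hx, _, _⟩ := mem_part.1 hx
        have := low x hx
        linarith
      refine Set.Subset.antisymm ?_ ?_
      · rintro _ ⟨x, hx, rfl⟩
        simp [h0 x hx, tent]
      · rintro _ rfl
        obtain ⟨x, hx⟩ := hne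
        exact ⟨x, hx, by simp [h0 x hx, tent]⟩
    rw [this]
    exact triv _ _ oneTree_mem
  · obtain ⟨h, e, he⟩ := app_tentTree_zero f l e
    refine ⟨hK.tent hne, (mem_rStep adm_tSK.bot).2
      ⟨{1}, _, h, e, ?_, rPfin_singleton digP_mem, ?_, ?_⟩⟩
    · rw [covers_singleton]
      rintro _ ⟨x, hx, rfl⟩
      obtain ⟨hx, h1, h2⟩ := mem_part.1 hx
      have := low x hx
      rw [tent_of_nonpos (by linarith), mem_II]
      constructor <;> linarith
    · have := app_mem (Prog.tentTree_type (Γ := [])).val_mem (rSK_subset K hT) adm_tSK.bot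
      rw [e, tSK_eq] at this
      exact (of_pair_mem_tProd this).2
    · rintro _ rfl a -
      -- Since `K ≥ -1/2`, the whole left half of `K` belongs to the middle part and survives the
      -- doubling.
      have key : ∀ x, x ∈ part K (-1) → 2 * x ∈ part (avInv 0 '' part K 0) (-1) := by
        intro x hx
        obtain ⟨hx, h1, h2⟩ := mem_part.1 hx
        have := low x hx
        exact mem_part.2 ⟨⟨x, mem_part.2 ⟨hx, by linarith, by linarith⟩, by simp [avInv]⟩,
          by linarith, by linarith⟩
      obtain ⟨x, hx⟩ := hne
      have hsub : part (tent '' part K (-1)) 1 = tent '' part K (-1) := by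
        refine Set.inter_eq_left.2 ?_
        rintro _ ⟨x, hx, rfl⟩
        obtain ⟨hx, h1, h2⟩ := mem_part.1 hx
        have := low x hx
        rw [tent_of_nonpos (by linarith), mem_II]
        constructor <;> linarith
      rw [hsub, he]
      refine ⟨⟨_, x, hx, rfl⟩, Or.inr ⟨_, _, (k 0 hd.1 _ digZ_mem).2, ⟨_, key x hx⟩, ?_, rfl⟩⟩
      -- Pointwise this is `2 (1 + 2x) - 1 = 1 + 2 (2x)`, where the right-hand side is `t (2x)`.
      rw [Set.image_image]
      refine Set.Subset.antisymm ?_ ?_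
      · rintro _ ⟨x, hx, rfl⟩
        refine ⟨_, key x hx, ?_⟩
        have := (mem_part.1 hx).2
        dsimp only
        rw [tent_of_nonpos (by linarith), tent_of_nonpos (by linarith), avInv]
        ring
      · rintro _ ⟨_, hy, rfl⟩
        obtain ⟨⟨x, hx, rfl⟩, h1, h2⟩ := mem_part.1 hy
        obtain ⟨hx, h3, h4⟩ := mem_part.1 hx
        rw [avInv] at *
        refine ⟨x, mem_part.2 ⟨hx, by linarith, by linarith⟩, ?_⟩
        dsimp only
        rw [tent_of_nonpos (by linarith), tent_of_nonpos (by linarith), avInv]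
        ring

/-- `L` and `S` are the set and the subtree at the least digit `d` of the root; `d` is a valid first
signed digit of the minimum. -/
theorem grayMin_cases (h : T ∈ rSK K) : ∃ L, ∃ S ∈ rSK L,
    (sInf K ≤ 0 ∧ sInf L = 2 * sInf K + 1 ∧
      D.app Prog.grayMin.val T = D.pair (D.left D.nil) (D.app Prog.grayMin.val S)) ∨
    (0 ≤ sInf K ∧ sInf L = 2 * sInf K - 1 ∧
      D.app Prog.grayMin.val T = D.pair (D.right D.nil) (D.negG (D.app Prog.grayMin.val S))) ∨
    (sInf L = 2 * sInf K ∧ D.app Prog.grayMin.val T =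
      D.pair (D.fst (D.app Prog.grayMin.val S)) (D.pair (D.right D.nil)
        (D.negG (D.snd (D.app Prog.grayMin.val S))))) := by
  obtain ⟨hK, hT'⟩ := mem_rSK.1 h
  obtain ⟨E, l, f, rfl, hE, hl, hf, k⟩ := (mem_rStep adm_tSK.bot).1 hT'
  obtain ⟨d, hd, hm⟩ := minList_spec hl
  -- The digit covering the minimum is at least `d`, which gives the lower bound; a point of `K` in
  -- `II d` gives the upper bound.
  have hII : sInf K ∈ II d := by
    obtain ⟨e, he, hx⟩ := Set.mem_iUnion₂.1 (hE hK.isLeast.1)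
    have h1 := hd.2 he
    have h2 := (mem_II.1 hx).1
    obtain ⟨z, hz⟩ := (k d hd.1 _ hm).1
    obtain ⟨hz, h3, h4⟩ := mem_part.1 hz
    have := hK.isLeast.2 hz
    exact mem_II.2 ⟨by linarith, by linarith⟩
  have hinf := hK.sInf_avInv hII
  rw [mem_II] at hII
  refine ⟨_, _, (k d hd.1 _ hm).2, ?_⟩
  rcases mem_rSD.1 hm with ⟨rfl, e⟩ | ⟨rfl, e⟩ | ⟨rfl, e⟩
  · exact Or.inl ⟨by linarith, by linarith, by rw [app_grayMin_neg_one _ _ e, e]⟩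
  · exact Or.inr (Or.inl ⟨by linarith, by linarith, by rw [app_grayMin_one _ _ e, e]⟩)
  · exact Or.inr (Or.inr ⟨by linarith, by rw [app_grayMin_zero _ _ e, e]⟩)

theorem rSign_half {x y : ℝ} (h : y = 2 * x) {g : D} (hg : g ∈ rSign y) : g ∈ rSign x := by
  refine ⟨hg.1, fun hx => ?_⟩
  subst h
  rcases hg.2 (by simpa using hx) with ⟨u, hu, rfl⟩ | ⟨u, hu, rfl⟩
  · exact Or.inl ⟨u, ⟨hu.1, by linarith [hu.2]⟩, rfl⟩
  · exact Or.inr ⟨u, ⟨hu.1, by linarith [hu.2]⟩, rfl⟩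

theorem grayMin_mem_tG (h : T ∈ rSK K) : D.app Prog.grayMin.val T ∈ tG :=
  app_mem (Prog.grayMin_type (Γ := [])).val_mem (rSK_subset K h) adm_tG.bot

/-- Each leading digit `0` doubles the absolute value of the minimum, which remains at most `1`. So
for a non-zero minimum a digit `-1` or `1` turns up after finitely many steps and determines the
head. -/
theorem fst_grayMin_spec (h : T ∈ rSK K) :
    D.fst (D.app Prog.grayMin.val T) ∈ rSign (sInf K) := by
  have htype : D.fst (D.app Prog.grayMin.val T) ∈ tGC := by
    have := grayMin_mem_tG h
    rw [tG_eq] at this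
    rcases mem_tProd.1 this with e | ⟨a, ha, b, hb, e⟩
    · rw [e, D.fst_bot]; exact bot_mem_tSum
    · rwa [e, D.fst_pair]
  -- `m` bounds the number of leading zeros; for `m = 0` the hypothesis contradicts `|sInf K| ≤ 1`.
  have key : ∀ (m : ℕ) {K : Set ℝ} {T : D}, T ∈ rSK K → (1 / 2) ^ m < |sInf K| →
      D.fst (D.app Prog.grayMin.val T) ∈ rSign (sInf K) := by
    intro m
    induction m with
    | zero =>
      intro K T hT h
      have hK := (mem_rSK.1 hT).1
      have := abs_le.2 (hK.bounds hK.isLeast.1)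
      rw [pow_zero] at h
      linarith
    | succ m ih =>
      intro K T hT h
      obtain ⟨L, S, hS, ⟨h1, -, e⟩ | ⟨h1, -, e⟩ | ⟨h1, e⟩⟩ := grayMin_cases hT
      · rw [e, D.fst_pair]; exact grayM_mem h1
      · rw [e, D.fst_pair]; exact grayP_mem h1
      · rw [e, D.fst_pair]
        refine rSign_half h1 (ih hS ?_)
        rw [h1, abs_mul, abs_two]
        rw [pow_succ] at h
        linarith
  refine ⟨htype, fun hx => ?_⟩
  obtain ⟨m, hm⟩ := exists_pow_lt_of_lt_one (abs_pos.2 hx) (by norm_num : (1 / 2 : ℝ) < 1)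
  exact (key m h hm).2 hx

/-- The three cases are those of `tent`: `t x = 2x + 1` for the digit `-1`, `t x = -(2x - 1)` for
`1`, and `t (t x) = -t (2x)` for `0`. -/
theorem grayMin_spec (h : T ∈ rSK K) : D.app Prog.grayMin.val T ∈ rG (sInf K) := by
  refine mem_rG_of_rGn fun n => ?_
  induction n using Nat.strong_induction_on generalizing K T with
  | _ n ih =>
  have hK := (mem_rSK.1 h).1
  have hx := hK.bounds hK.isLeast.1
  -- The induction on `n` cannot supply the head: under a digit `0` it is the head of the recursive
  -- result, and for one correct digit of `T` nothing is yet known about that.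
  have hfst := fst_grayMin_spec h
  cases n with
  | zero => trivial
  | succ n =>
  refine ⟨hx, ?_⟩
  obtain ⟨L, S, hS, ⟨h1, h2, e⟩ | ⟨h1, h2, e⟩ | ⟨h1, e⟩⟩ := grayMin_cases h
  · rw [e]
    refine ⟨_, grayM_mem h1, _, ?_, rfl⟩
    rw [tent_of_nonpos h1, add_comm, ← h2]
    exact ih n (by omega) hS
  · rw [e]
    refine ⟨_, grayP_mem h1, _, ?_, rfl⟩
    rw [tent_of_nonneg h1, ← neg_sub, ← h2]
    exact negG_mem_rGn (ih n (by omega) hS)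
  · rw [e, D.fst_pair] at hfst
    rw [e]
    refine ⟨_, hfst, _, ?_, rfl⟩
    cases n with
    | zero => trivial
    | succ n =>
    have hL := (mem_rSK.1 hS).1
    have hy := hL.bounds hL.isLeast.1
    have habs : |sInf K| ≤ 1 / 2 := abs_le.2 ⟨by linarith, by linarith⟩
    have htt : tent (tent (sInf K)) = -tent (sInf L) := by
      rw [tent_of_nonneg (by rw [tent]; linarith), h1, tent, tent, abs_mul, abs_two]
      ring
    refine ⟨tent_mem hx, _, grayP_mem (by rw [tent]; linarith), _, ?_, rfl⟩
    -- One digit is inserted after the head, so `n + 2` correct digits need only `n + 1` correct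
    -- digits of the recursive result.
    obtain ⟨-, g, -, b, hb, hgb⟩ := ih (n + 1) (by omega) hS
    rw [← hgb, D.snd_pair, htt]
    exact negG_mem_rGn hb

/-- The maximum of `K` is the negative of the minimum of `-K`, and since `t` is even the tent image
of the right half of `K` is that of the left half of `-K`. -/
theorem grayTree_spec (h : T ∈ rSK K) : D.app Prog.grayTree.val T ∈ rGK K := by
  refine le_nu (Φ := rGKOp) (x := fun K => {c | ∃ T ∈ rSK K, c = D.app Prog.grayTree.val T})
    (fun K c hc => ?_) K ⟨T, h, rfl⟩
  obtain ⟨T, hT, rfl⟩ := hc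
  have hK := (mem_rSK.1 hT).1
  have hneg := negTree_spec hT
  obtain ⟨f, e, hl, hr⟩ := app_grayTree T
  have hmax := negG_mem (grayMin_spec hneg)
  rw [hK.sInf_neg, neg_neg] at hmax
  refine mem_rGKOp.2 ⟨hK, _, grayMin_spec hT, _, hmax, f, ?_, e, ?_⟩
  · have := app_mem (Prog.grayTree_type (Γ := [])).val_mem (rSK_subset K hT) adm_tGK.bot
    rw [e, tGK_eq] at this
    exact (of_pair_mem_tProd (of_pair_mem_tProd this).2).2
  · intro d g hg hd
    rcases mem_rGC.1 hg with ⟨rfl, rfl⟩ | ⟨rfl, rfl⟩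
    · exact ⟨_, tentTree_spec hT hd, hl _⟩
    · have e1 : part K 1 = Neg.neg '' part (Neg.neg '' K) (-1) := by
        rw [part_neg, neg_neg, IsK.neg_neg_image]
      rw [e1, tent_image_neg]
      refine ⟨_, tentTree_spec hneg ?_, hr _⟩
      rw [part_neg, neg_neg]
      exact hd.image _

theorem grayTree_realises (K : Set ℝ) :
    Prog.grayTree.val ∈ rImp tSK tGK (rSK K) (rGK K) :=
  ⟨(Prog.grayTree_type (Γ := [])).val_mem, fun _ hT => grayTree_spec hT⟩

end Correctness

namespace Prog

/-! ## From Gray code trees to concurrent signed digit trees -/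

/-- The Gray code of the minimum. -/
abbrev minP (m : Prog) : Prog := fstP m

/-- The Gray code of the maximum. -/
abbrev maxP (m : Prog) : Prog := fstP (sndP m)

/-- The subtree at a Gray digit. -/
abbrev subP (m n : Prog) : Prog := app (sndP (sndP m)) n

/-- The Gray code of `2 x`, where `|x| ≤ 1 / 2`. -/
abbrev dblG (m : Prog) : Prog := pair (fstP m) (negG (sndP (sndP m)))

/-- The Gray code tree of `-K`. -/
def negGray : Prog :=
  lam (pair (negG (maxP (var 0))) (pair (negG (minP (var 0))) (lam (subP (var 1) (negGC (var 0))))))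

/-- The Gray code of twice the minimum of `K`. -/
def dblMin : Prog := lam (dblG (minP (var 0)))

/-- The Gray code of twice the maximum of `K`. -/
def dblMax : Prog := lam (dblG (maxP (var 0)))

/-- The Gray code of twice the minimum of the middle part of `K`, which is not positive. -/
def midMin : Prog := lam (pair grayM (negG (maxP (subP (subP (var 0) grayM) grayP))))

/-- The Gray code of twice the maximum of the middle part of `K`, which is not negative. -/
def midMax : Prog := lam (pair grayP (negG (maxP (subP (subP (var 0) grayP) grayP))))

/-- One step of a signed digit tree with the digits `e`; the minimum and the maximum of the doubled
middle part are given by `a` and `b`. -/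
def step (e a b : Prog) : Prog :=
  lam (lam (pair e (lam (case3 (var 0)
    (app (var 4) (subP (var 3) grayM))
    (app (var 4) (app negGray (subP (var 3) grayP)))
    (app (var 3) (pair (app a (var 2)) (pair (app b (var 2))
      (lam (app negGray (subP (subP (var 3) (var 0)) grayP))))))))))

/-- The step with digit `-1`. -/
def stepM : Prog := step (left digM) dblMin dblMax

/-- The step with digit `1`. -/
def stepP : Prog := step (left digP) dblMin dblMax

/-- The step with digit `0`. -/
def stepZ : Prog := step (left digZ) dblMin dblMax

/-- The step with digits `-1` and `1`. -/
def stepMP : Prog := step (right (pair (left digM) digP)) dblMin dblMax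

/-- The step with digits `-1` and `0`. -/
def stepMZ : Prog := step (right (pair (left digM) digZ)) midMin dblMax

/-- The step with digits `0` and `1`. -/
def stepZP : Prog := step (right (pair (left digZ) digP)) dblMin midMax

/-- A step as first alternative, for the tree with index `k`. -/
abbrev done (s : Prog) (k : ℕ) : Prog := left (app (app s (var (k + 1))) (var k))

/-- The concurrent signed digit tree of `K`. -/
def concTree : Prog :=
  recu (lam (lam (amb
    (caseS (fstP (minP (var 0)))
      (right (amb
        (caseS (fstP (maxP (var 1))) (done stepM 2) (done stepMP 2))
        (caseS (fstP (sndP (maxP (var 1)))) bot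
          (caseS (fstP (maxP (subP (var 2) grayM))) bot (done stepMZ 3)))))
      (done stepP 1))
    (caseS (fstP (sndP (minP (var 0)))) bot
      (caseS (fstP (maxP (subP (var 1) grayP))) bot
        (right (amb
          (caseS (fstP (maxP (var 2))) (done stepM 3) (done stepZP 3))
          (caseS (fstP (sndP (maxP (var 2)))) bot (done stepZ 3)))))))))

theorem negGray_closed : negGray.Closed := by simp [negGray, Closed, ClosedAt]
theorem dblMin_closed : dblMin.Closed := by simp [dblMin, Closed, ClosedAt]
theorem dblMax_closed : dblMax.Closed := by simp [dblMax, Closed, ClosedAt]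
theorem midMin_closed : midMin.Closed := by simp [midMin, Closed, ClosedAt]
theorem midMax_closed : midMax.Closed := by simp [midMax, Closed, ClosedAt]

theorem step_closed {e a b : Prog} (he : e.Closed) (ha : a.Closed) (hb : b.Closed) :
    (step e a b).Closed := by
  simp [step, Closed, ClosedAt, he.closedAt, ha.closedAt, hb.closedAt, negGray_closed.closedAt]

theorem stepM_closed : stepM.Closed :=
  step_closed (by simp [Closed, ClosedAt]) dblMin_closed dblMax_closed
theorem stepP_closed : stepP.Closed :=
  step_closed (by simp [Closed, ClosedAt]) dblMin_closed dblMax_closed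
theorem stepZ_closed : stepZ.Closed :=
  step_closed (by simp [Closed, ClosedAt]) dblMin_closed dblMax_closed
theorem stepMP_closed : stepMP.Closed :=
  step_closed (by simp [Closed, ClosedAt]) dblMin_closed dblMax_closed
theorem stepMZ_closed : stepMZ.Closed :=
  step_closed (by simp [Closed, ClosedAt]) midMin_closed dblMax_closed
theorem stepZP_closed : stepZP.Closed :=
  step_closed (by simp [Closed, ClosedAt]) dblMin_closed midMax_closed

theorem concTree_closed : concTree.Closed := by
  simp [concTree, Closed, ClosedAt, stepM_closed.closedAt, stepP_closed.closedAt,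
    stepZ_closed.closedAt, stepMP_closed.closedAt, stepMZ_closed.closedAt, stepZP_closed.closedAt]

/-! ### Typing of the concurrent program -/

section Typing

variable {Γ : List (Set D)} {m n : Prog}

theorem HasType.minP (h : HasType Γ m tGK) : HasType Γ (minP m) tG :=
  .fstP adm_tG.bot (h.conv tGK_eq)

theorem HasType.maxP (h : HasType Γ m tGK) : HasType Γ (maxP m) tG :=
  .fstP adm_tG.bot (.sndP bot_mem_tProd (h.conv tGK_eq))

theorem HasType.subP (h : HasType Γ m tGK) (k : HasType Γ n tGC) : HasType Γ (subP m n) tGK :=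
  .app adm_tGK.bot (.sndP bot_mem_tFun (.sndP bot_mem_tProd (h.conv tGK_eq))) k

theorem HasType.head (h : HasType Γ m tG) : HasType Γ (Prog.fstP m) tGC :=
  .fstP bot_mem_tSum (h.conv tG_eq)

theorem HasType.tail (h : HasType Γ m tG) : HasType Γ (Prog.sndP m) tG :=
  .sndP adm_tG.bot (h.conv tG_eq)

theorem HasType.code (h : HasType Γ m tGC) (k : HasType Γ n tG) : HasType Γ (Prog.pair m n) tG :=
  (HasType.pair h k).conv tG_eq.symm

theorem HasType.dblG (h : HasType Γ m tG) : HasType Γ (dblG m) tG := .code h.head h.tail.tail.negG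

theorem negGray_type : HasType Γ negGray (tFun tGK tGK) :=
  .lam (.gray (.negG (.maxP (.var 0 rfl))) (.negG (.minP (.var 0 rfl)))
    (.lam (.subP (.var 1 rfl) (.negGC (.var 0 rfl)))))

theorem dblMin_type : HasType Γ dblMin (tFun tGK tG) := .lam (.dblG (.minP (.var 0 rfl)))

theorem dblMax_type : HasType Γ dblMax (tFun tGK tG) := .lam (.dblG (.maxP (.var 0 rfl)))

theorem midMin_type : HasType Γ midMin (tFun tGK tG) :=
  .lam (.code grayM_type (.negG (.maxP (.subP (.subP (.var 0 rfl) grayM_type) grayP_type))))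

theorem midMax_type : HasType Γ midMax (tFun tGK tG) :=
  .lam (.code grayP_type (.negG (.maxP (.subP (.subP (.var 0 rfl) grayP_type) grayP_type))))

theorem step_type {e a b : Prog} (he : ∀ Γ, HasType Γ e (tPfin tSD))
    (ha : ∀ Γ, HasType Γ a (tFun tGK tG)) (hb : ∀ Γ, HasType Γ b (tFun tGK tG)) :
    HasType Γ (step e a b) (tFun (tFun tGK tSKstar) (tFun tGK (tStep tSKstar))) :=
  .lam (.lam (.pair (he _) (.lam (.case3 adm_tSKstar.bot (.var 0 rfl)
    (.app adm_tSKstar.bot (.var 4 rfl) (.subP (.var 3 rfl) grayM_type))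
    (.app adm_tSKstar.bot (.var 4 rfl)
      (.app adm_tGK.bot negGray_type (.subP (.var 3 rfl) grayP_type)))
    (.app adm_tSKstar.bot (.var 3 rfl) (.gray (.app adm_tG.bot (ha _) (.var 2 rfl))
      (.app adm_tG.bot (hb _) (.var 2 rfl)) (.lam (.app adm_tGK.bot negGray_type
        (.subP (.subP (.var 3 rfl) (.var 0 rfl)) grayP_type)))))))))

/-- The type of the alternatives in a concurrent signed digit tree. -/
abbrev tNext : Set D := tSum (tStep tSKstar) tSKstar

theorem done_type {e a b : Prog} {k : ℕ} (he : ∀ Γ, HasType Γ e (tPfin tSD))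
    (ha : ∀ Γ, HasType Γ a (tFun tGK tG)) (hb : ∀ Γ, HasType Γ b (tFun tGK tG))
    (hT : Γ.getD k Set.univ = tGK) (hN : Γ.getD (k + 1) Set.univ = tFun tGK tSKstar) :
    HasType Γ (done (step e a b) k) tNext :=
  .left (.app bot_mem_tProd (.app bot_mem_tFun (step_type he ha hb) (.var _ hN)) (.var _ hT))

/-- By `tSKstar = tStar (tStep tSKstar)` an inner layer of `Amb` has the same type as a whole tree,
so one rule types both layers in `concTree`. -/
theorem HasType.conc (h : HasType Γ m tNext) (k : HasType Γ n tNext) :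
    HasType Γ (Prog.amb m n) tSKstar :=
  (HasType.amb h k).conv (by rw [tNext]; conv_rhs => rw [tSKstar_eq, tStar_eq, ← tSKstar_eq])

theorem concTree_type : HasType Γ concTree (tFun tGK tSKstar) := by
  have b : ⊥ ∈ tNext := bot_mem_tSum
  have mx : ∀ {Γ : List (Set D)}, HasType Γ dblMax (tFun tGK tG) := dblMax_type
  have mn : ∀ {Γ : List (Set D)}, HasType Γ dblMin (tFun tGK tG) := dblMin_type
  refine .recu adm_tSKstar.tFun <| .lam <| .lam <| .conc
    (.caseS b (.head (.minP (.var 0 rfl)))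
      (.right (.conc
        (.caseS b (.head (.maxP (.var 1 rfl)))
          (done_type (fun _ => .singleton digM_type) (fun _ => mn) (fun _ => mx) rfl rfl)
          (done_type (fun _ => .cons (.singleton digM_type) digP_type)
            (fun _ => mn) (fun _ => mx) rfl rfl))
        (.caseS b (.head (.tail (.maxP (.var 1 rfl)))) (.bot b)
          (.caseS b (.head (.maxP (.subP (.var 2 rfl) grayM_type))) (.bot b)
            (done_type (fun _ => .cons (.singleton digM_type) digZ_type)
              (fun _ => midMin_type) (fun _ => mx) rfl rfl)))))
      (done_type (fun _ => .singleton digP_type) (fun _ => mn) (fun _ => mx) rfl rfl))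
    (.caseS b (.head (.tail (.minP (.var 0 rfl)))) (.bot b)
      (.caseS b (.head (.maxP (.subP (.var 1 rfl) grayP_type))) (.bot b)
        (.right (.conc
          (.caseS b (.head (.maxP (.var 2 rfl)))
            (done_type (fun _ => .singleton digM_type) (fun _ => mn) (fun _ => mx) rfl rfl)
            (done_type (fun _ => .cons (.singleton digZ_type) digP_type)
              (fun _ => mn) (fun _ => midMax_type) rfl rfl))
          (.caseS b (.head (.tail (.maxP (.var 2 rfl)))) (.bot b)
            (done_type (fun _ => .singleton digZ_type) (fun _ => mn) (fun _ => mx) rfl rfl))))))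

end Typing

end Prog

/-! ## From Gray code trees to concurrent signed digit trees: correctness -/

section Values

variable (T N a : D)

theorem app_negGray : ∃ h, D.app Prog.negGray.val T = D.pair (D.negG (D.fst (D.snd T)))
    (D.pair (D.negG (D.fst T)) h) ∧
    ∀ d, D.app h d = D.app (D.snd (D.snd T)) (D.negGC d) := by
  have key : D.app Prog.negGray.val _ = _ := Prog.app_lam _ _ T
  rw [Prog.den_pair, Prog.den_pair] at key
  refine ⟨_, key.trans (congrArg₂ D.pair (by simp) (congrArg₂ D.pair (by simp) rfl)), fun d => ?_⟩
  rw [Prog.app_lam]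
  simp

/-- The Gray code of `2 x`, where `|x| ≤ 1 / 2`. -/
noncomputable def D.dblG (a : D) : D := D.pair (D.fst a) (D.negG (D.snd (D.snd a)))

theorem app_dblMin : D.app Prog.dblMin.val T = D.dblG (D.fst T) :=
  (Prog.app_lam _ _ _).trans (by simp [D.dblG])

theorem app_dblMax : D.app Prog.dblMax.val T = D.dblG (D.fst (D.snd T)) :=
  (Prog.app_lam _ _ _).trans (by simp [D.dblG])

theorem app_midMin : D.app Prog.midMin.val T = D.pair (D.left D.nil) (D.negG (D.fst (D.snd
    (D.app (D.snd (D.snd (D.app (D.snd (D.snd T)) (D.left D.nil)))) (D.right D.nil))))) :=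
  (Prog.app_lam _ _ _).trans (by simp)

theorem app_midMax : D.app Prog.midMax.val T = D.pair (D.right D.nil) (D.negG (D.fst (D.snd
    (D.app (D.snd (D.snd (D.app (D.snd (D.snd T)) (D.right D.nil)))) (D.right D.nil))))) :=
  (Prog.app_lam _ _ _).trans (by simp)

/-- The type of `h` is part of the conclusion because the tree assembled for the digit `0` is a Gray
code tree only if its family of subtrees is well-typed. -/
theorem app_step {e x y : Prog} (he : e.Closed) (hx : x.Closed) (hy : y.Closed)
    (hT : T ∈ tGK) : ∃ s, D.app (D.app (Prog.step e x y).val N) T = D.pair e.val s ∧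
      D.app s (D.left (D.left D.nil)) = D.app N (D.app (D.snd (D.snd T)) (D.left D.nil)) ∧
      D.app s (D.left (D.right D.nil)) =
        D.app N (D.app Prog.negGray.val (D.app (D.snd (D.snd T)) (D.right D.nil))) ∧
      ∃ h ∈ tFun tGC tGK,
        D.app s (D.right D.nil) = D.app N (D.pair (D.app x.val T) (D.pair (D.app y.val T) h)) ∧
        ∀ d, D.app h d = D.app Prog.negGray.val
          (D.app (D.snd (D.snd (D.app (D.snd (D.snd T)) d))) (D.right D.nil)) := by
  have key : D.app (D.app (Prog.step e x y).val N) T = _ :=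
    (congrArg (fun c => D.app c T) (Prog.app_lam _ _ N)).trans (Prog.app_lam _ _ T)
  rw [Prog.den_pair, he.den_eq] at key
  refine ⟨_, key, ?_, ?_, ?_⟩
  · rw [Prog.app_lam]
    simp
  · rw [Prog.app_lam]
    simp [Prog.negGray_closed.den_eq]
  · rw [Prog.app_lam]
    simp only [Prog.den_caseS, Prog.den_var, push_zero, D.caseS_right, Prog.den_app, Prog.den_pair,
      hx.den_eq, hy.den_eq]
    refine ⟨_, ?_, rfl, fun d => ?_⟩
    -- Only the tree variable needs a type here; the digit and its argument get `Set.univ`, and `N`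
    -- lies beyond the context.
    · exact Prog.HasType.lam (.app adm_tGK.bot Prog.negGray_type
        (.subP (.subP (.var 3 rfl) (.var 0 rfl)) Prog.grayP_type)) _
        (Prog.push_typed (T := Set.univ) (Prog.push_typed (T := Set.univ)
          (Prog.push_typed (Γ := []) (fun _ => trivial) hT) trivial) trivial)
    · rw [Prog.app_lam]
      simp [Prog.negGray_closed.den_eq]

theorem app_concTree : D.app Prog.concTree.val T =
    let st := fun s : Prog => D.left (D.app (D.app s.val Prog.concTree.val) T)
    D.amb
      (D.caseS (D.fst (D.fst T))
        (fun _ => D.right (D.amb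
          (D.caseS (D.fst (D.fst (D.snd T))) (fun _ => st Prog.stepM) fun _ => st Prog.stepMP)
          (D.caseS (D.fst (D.snd (D.fst (D.snd T)))) (fun _ => ⊥) fun _ =>
            D.caseS (D.fst (D.fst (D.snd (D.app (D.snd (D.snd T)) (D.left D.nil))))) (fun _ => ⊥)
              fun _ => st Prog.stepMZ)))
        fun _ => st Prog.stepP)
      (D.caseS (D.fst (D.snd (D.fst T))) (fun _ => ⊥) fun _ =>
        D.caseS (D.fst (D.fst (D.snd (D.app (D.snd (D.snd T)) (D.right D.nil))))) (fun _ => ⊥)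
          fun _ => D.right (D.amb
            (D.caseS (D.fst (D.fst (D.snd T))) (fun _ => st Prog.stepM) fun _ => st Prog.stepZP)
            (D.caseS (D.fst (D.snd (D.fst (D.snd T)))) (fun _ => ⊥) fun _ => st Prog.stepZ))) :=
  (Prog.app_val_rec _ _).trans (by
    simp [Prog.stepM_closed.den_eq, Prog.stepP_closed.den_eq, Prog.stepZ_closed.den_eq,
      Prog.stepMP_closed.den_eq, Prog.stepMZ_closed.den_eq, Prog.stepZP_closed.den_eq]
    rfl)

end Values

/-! ### Gray code trees of reflections and of the doubled middle part -/

section Correctness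

variable {K L : Set ℝ} {T a b f h : D} {x : ℝ}

/-- The components of a Gray code tree. -/
theorem rGK_cases (hT : T ∈ rGK K) : IsK K ∧ D.fst T ∈ rG (sInf K) ∧ D.fst (D.snd T) ∈ rG (sSup K) ∧
    ∀ d, ∀ g ∈ rGC d, (part K d).Nonempty →
      D.app (D.snd (D.snd T)) g ∈ rGK (tent '' part K d) := by
  obtain ⟨hK, a, ha, b, hb, f, hf, rfl, h⟩ := mem_rGK.1 hT
  simpa only [D.fst_pair, D.snd_pair] using ⟨hK, ha, hb, h⟩

theorem rG_cases (ha : a ∈ rG x) : (-1 ≤ x ∧ x ≤ 1) ∧ D.fst a ∈ rSign x ∧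
    D.snd a ∈ rG (tent x) := by
  obtain ⟨hx, g, hg, b, hb, rfl⟩ := mem_rG.1 ha
  simpa only [D.fst_pair, D.snd_pair] using ⟨hx, hg, hb⟩

theorem of_mem_tGK (h : D.pair a (D.pair b f) ∈ tGK) : f ∈ tFun tGC tGK := by
  rw [tGK_eq] at h
  exact (of_pair_mem_tProd (of_pair_mem_tProd h).2).2

/-- Reflection exchanges minimum and maximum. As `t` is even, the subtree at a digit is the old one
at the opposite digit, without any change inside. -/
theorem negGray_spec (hT : T ∈ rGK K) : D.app Prog.negGray.val T ∈ rGK (Neg.neg '' K) := by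
  obtain ⟨hK, hmin, hmax, k⟩ := rGK_cases hT
  obtain ⟨h, e, he⟩ := app_negGray T
  refine mem_rGK.2 ⟨hK.neg, _, hK.sInf_neg ▸ negG_mem hmax, _, hK.sSup_neg ▸ negG_mem hmin, h,
    of_mem_tGK (e ▸ app_mem (Prog.negGray_type (Γ := [])).val_mem (rGK_subset K hT) adm_tGK.bot),
    e, fun d g hg hd => ?_⟩
  rw [he]
  rw [part_neg] at hd ⊢
  rw [tent_image_neg]
  exact k _ _ (negGC_rGC hg) (Set.image_nonempty.1 hd)

/-- The sign of `2x` is that of `x`, and `t (2x) = -t (t x)`: the second digit of `x` is dropped and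
the third one negated. -/
theorem dblG_mem (ha : a ∈ rG x) (hx : |x| ≤ 1 / 2) : D.dblG a ∈ rG (2 * x) := by
  obtain ⟨-, hg, ha⟩ := rG_cases ha
  obtain ⟨-, -, ha⟩ := rG_cases ha
  have hx' := abs_le.1 hx
  refine pair_mem_rG ⟨by linarith, by linarith⟩ ⟨hg.1, fun h => ?_⟩ ?_
  · have : x ≠ 0 := by rintro rfl; simp at h
    rcases hg.2 this with ⟨u, hu, e⟩ | ⟨u, hu, e⟩
    · exact Or.inl ⟨u, ⟨hu.1, by linarith [hu.2]⟩, e⟩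
    · exact Or.inr ⟨u, ⟨hu.1, by linarith [hu.2]⟩, e⟩
  · have : tent (2 * x) = -tent (tent x) := by
      rw [tent_of_nonneg (x := tent x) (by rw [tent]; linarith), tent, tent, abs_mul, abs_two]
      ring
    rw [this]
    exact negG_mem ha

/-- The middle part of `K`, doubled. -/
abbrev mid (K : Set ℝ) : Set ℝ := avInv 0 '' part K 0

theorem mem_mid {x : ℝ} : x ∈ mid K ↔ ∃ y ∈ K, |y| ≤ 1 / 2 ∧ 2 * y = x := by
  constructor
  · rintro ⟨y, hy, rfl⟩
    obtain ⟨hy, h1, h2⟩ := mem_part.1 hy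
    exact ⟨y, hy, abs_le.2 ⟨by linarith, by linarith⟩, by simp [avInv]⟩
  · rintro ⟨y, hy, h, rfl⟩
    obtain ⟨h1, h2⟩ := abs_le.1 h
    exact ⟨y, mem_part.2 ⟨hy, by linarith, by linarith⟩, by simp [avInv]⟩

theorem mem_part_sign {d : ℝ} (hK : IsK K) (hd : d = -1 ∨ d = 1) {x : ℝ} :
    x ∈ part K d ↔ x ∈ K ∧ 0 ≤ d * x := by
  rw [mem_part]
  refine and_congr_right fun hx => ?_
  have := hK.bounds hx
  rcases hd with rfl | rfl <;> constructor
  · rintro ⟨h1, h2⟩; linarith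
  · intro h; constructor <;> linarith
  · rintro ⟨h1, h2⟩; linarith
  · intro h; constructor <;> linarith

theorem part_tent_one {d : ℝ} (hK : IsK K) (h : (part K d).Nonempty) {x : ℝ} :
    x ∈ part (tent '' part K d) 1 ↔ ∃ y ∈ part K d, |y| ≤ 1 / 2 ∧ tent y = x := by
  rw [mem_part_sign (hK.tent h) (Or.inr rfl)]
  constructor
  · rintro ⟨⟨y, hy, rfl⟩, h⟩
    exact ⟨y, hy, by rw [tent] at h; linarith, rfl⟩
  · rintro ⟨y, hy, h, rfl⟩
    exact ⟨⟨y, hy, rfl⟩, by rw [tent]; linarith⟩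

/-- The identity `-t (t y) = t (2y)` for `|y| ≤ 1/2`, applied to sets. The points of `K_d` with `|y|
≤ 1/2` are those which `t` maps into the right half, so the middle part can be reached through the
subtree at `d` and then at `1`. -/
theorem tent_mid {d : ℝ} (hK : IsK K) (hd : d = -1 ∨ d = 1) (h : (part (mid K) d).Nonempty) :
    (part K d).Nonempty ∧ (part (tent '' part K d) 1).Nonempty ∧
    Neg.neg '' (tent '' part (tent '' part K d) 1) = tent '' part (mid K) d := by
  have hne : (part K 0).Nonempty := by
    obtain ⟨_, ⟨x, hx, _⟩, _⟩ := h
    exact ⟨x, hx⟩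
  have hM : IsK (mid K) := hK.avInv hne
  have key : ∀ x, x ∈ part (mid K) d ↔ ∃ y ∈ part K d, |y| ≤ 1 / 2 ∧ 2 * y = x := by
    intro x
    rw [mem_part_sign hM hd, mem_mid]
    constructor
    · rintro ⟨⟨y, hy, h1, rfl⟩, h2⟩
      exact ⟨y, (mem_part_sign hK hd).2 ⟨hy, by linarith⟩, h1, rfl⟩
    · rintro ⟨y, hy, h1, rfl⟩
      obtain ⟨hy, h2⟩ := (mem_part_sign hK hd).1 hy
      exact ⟨⟨y, hy, h1, rfl⟩, by linarith⟩
  obtain ⟨x, hx⟩ := h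
  obtain ⟨y, hy, h1, rfl⟩ := (key x).1 hx
  have hne : (part K d).Nonempty := ⟨y, hy⟩
  have calc2 : ∀ y : ℝ, |y| ≤ 1 / 2 → -tent (tent y) = tent (2 * y) := by
    intro y hy
    rw [tent_of_nonneg (x := tent y) (by rw [tent]; linarith), tent, tent, abs_mul, abs_two]
    ring
  refine ⟨hne, ⟨_, (part_tent_one hK hne).2 ⟨y, hy, h1, rfl⟩⟩, Set.ext fun z => ⟨?_, ?_⟩⟩
  · rintro ⟨_, ⟨x, hx, rfl⟩, rfl⟩
    obtain ⟨y, hy, h1, rfl⟩ := (part_tent_one hK hne).1 hx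
    exact ⟨2 * y, (key _).2 ⟨y, hy, h1, rfl⟩, (calc2 y h1).symm⟩
  · rintro ⟨x, hx, rfl⟩
    obtain ⟨y, hy, h1, rfl⟩ := (key x).1 hx
    exact ⟨_, ⟨_, (part_tent_one hK hne).2 ⟨y, hy, h1, rfl⟩, rfl⟩, calc2 y h1⟩

/-- The subtrees of the Gray code tree of the middle part. -/
theorem mid_subtree (hT : T ∈ rGK K) {d : ℝ} {g : D} (hg : g ∈ rGC d)
    (h : (part (mid K) d).Nonempty) : D.app Prog.negGray.val
      (D.app (D.snd (D.snd (D.app (D.snd (D.snd T)) g))) (D.right D.nil)) ∈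
      rGK (tent '' part (mid K) d) := by
  obtain ⟨hK, -, -, k⟩ := rGK_cases hT
  have hd : d = -1 ∨ d = 1 := (mem_rGC.1 hg).imp And.left And.left
  obtain ⟨h1, h2, e⟩ := tent_mid hK hd h
  obtain ⟨-, -, -, k'⟩ := rGK_cases (k d g hg h1)
  rw [← e]
  exact negGray_spec (k' 1 _ (mem_rGC.2 (Or.inr ⟨rfl, rfl⟩)) h2)

theorem mid_mem (hT : T ∈ rGK K) (hne : (part K 0).Nonempty) (ha : a ∈ rG (sInf (mid K)))
    (hb : b ∈ rG (sSup (mid K))) (hf : h ∈ tFun tGC tGK)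
    (k : ∀ d, D.app h d = D.app Prog.negGray.val
      (D.app (D.snd (D.snd (D.app (D.snd (D.snd T)) d))) (D.right D.nil))) :
    D.pair a (D.pair b h) ∈ rGK (mid K) :=
  mem_rGK.2 ⟨(rGK_cases hT).1.avInv hne, a, ha, b, hb, h, hf, rfl, fun _ g hg hd =>
    k g ▸ mid_subtree hT hg hd⟩

/-- The tent map increases on the left half. -/
theorem sInf_tent_neg_one (hL : IsK L) (h : sInf L ≤ 0) :
    sInf (tent '' part L (-1)) = tent (sInf L) := by
  refine IsLeast.csInf_eq ⟨⟨_, (mem_part_sign hL (Or.inl rfl)).2 ⟨hL.isLeast.1, by linarith⟩, rfl⟩,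
    ?_⟩
  rintro _ ⟨x, hx, rfl⟩
  obtain ⟨hx, h1⟩ := (mem_part_sign hL (Or.inl rfl)).1 hx
  rw [tent_of_nonpos h, tent_of_nonpos (by linarith)]
  linarith [hL.isLeast.2 hx]

/-- The tent map decreases on the right half, so its least value there comes from the maximum. -/
theorem sInf_tent_one (hL : IsK L) (h : 0 ≤ sSup L) :
    sInf (tent '' part L 1) = tent (sSup L) := by
  refine IsLeast.csInf_eq ⟨⟨_, (mem_part_sign hL (Or.inr rfl)).2 ⟨hL.isGreatest.1, by linarith⟩,
    rfl⟩, ?_⟩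
  rintro _ ⟨x, hx, rfl⟩
  obtain ⟨hx, h1⟩ := (mem_part_sign hL (Or.inr rfl)).1 hx
  rw [tent_of_nonneg h, tent_of_nonneg (by linarith)]
  linarith [hL.isGreatest.2 hx]

theorem part_zero_nonempty {y : ℝ} (hy : y ∈ K) (h : |y| ≤ 1 / 2) : (part K 0).Nonempty := by
  obtain ⟨h1, h2⟩ := abs_le.1 h
  exact ⟨y, mem_part.2 ⟨hy, by linarith, by linarith⟩⟩

/-- If `min K` is below `-1/2` it says nothing about the minimum of the middle part. The point `y`
shows that the latter is not positive, hence its first digit; its tent image is the minimum of the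
subtree of the middle part at `-1`, which `mid_subtree` provides. -/
theorem midMin_spec (hT : T ∈ rGK K) {y : ℝ} (hy : y ∈ K) (h : |y| ≤ 1 / 2) (h0 : y ≤ 0) :
    D.app Prog.midMin.val T ∈ rG (sInf (mid K)) := by
  have hL : IsK (mid K) := (rGK_cases hT).1.avInv (part_zero_nonempty hy h)
  have hm : 2 * y ∈ mid K := mem_mid.2 ⟨y, hy, h, rfl⟩
  have hneg : sInf (mid K) ≤ 0 := by linarith [hL.isLeast.2 hm]
  have hsub := (rGK_cases (mid_subtree hT (mem_rGC.2 (Or.inl ⟨rfl, rfl⟩))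
    ⟨_, (mem_part_sign hL (Or.inl rfl)).2 ⟨hm, by linarith⟩⟩)).2.1
  obtain ⟨_, e, -⟩ := app_negGray
    (D.app (D.snd (D.snd (D.app (D.snd (D.snd T)) (D.left D.nil)))) (D.right D.nil))
  -- That subtree is a reflected tree, so its minimum is the negated maximum of the original one.
  rw [e, D.fst_pair, sInf_tent_neg_one hL hneg] at hsub
  rw [app_midMin]
  exact pair_mem_rG (hL.bounds hL.isLeast.1) (grayM_mem hneg) hsub

theorem midMax_spec (hT : T ∈ rGK K) {y : ℝ} (hy : y ∈ K) (h : |y| ≤ 1 / 2) (h0 : 0 ≤ y) :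
    D.app Prog.midMax.val T ∈ rG (sSup (mid K)) := by
  have hL : IsK (mid K) := (rGK_cases hT).1.avInv (part_zero_nonempty hy h)
  have hm : 2 * y ∈ mid K := mem_mid.2 ⟨y, hy, h, rfl⟩
  have hpos : 0 ≤ sSup (mid K) := by linarith [hL.isGreatest.2 hm]
  have hsub := (rGK_cases (mid_subtree hT (mem_rGC.2 (Or.inr ⟨rfl, rfl⟩))
    ⟨_, (mem_part_sign hL (Or.inr rfl)).2 ⟨hm, by linarith⟩⟩)).2.1
  obtain ⟨_, e, -⟩ := app_negGray
    (D.app (D.snd (D.snd (D.app (D.snd (D.snd T)) (D.right D.nil)))) (D.right D.nil))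
  rw [e, D.fst_pair, sInf_tent_one hL hpos] at hsub
  rw [app_midMax]
  exact pair_mem_rG (hL.bounds hL.isGreatest.1) (grayP_mem hpos) hsub

theorem mem_II_zero {x : ℝ} : x ∈ II 0 ↔ |x| ≤ 1 / 2 := by
  rw [mem_II, abs_le]
  constructor <;> rintro ⟨h1, h2⟩ <;> constructor <;> linarith

theorem dblMin_spec (hT : T ∈ rGK K) (h : |sInf K| ≤ 1 / 2) :
    D.app Prog.dblMin.val T ∈ rG (sInf (mid K)) := by
  obtain ⟨hK, hmin, -⟩ := rGK_cases hT
  rw [app_dblMin, hK.sInf_avInv (mem_II_zero.2 h), sub_zero]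
  exact dblG_mem hmin h

theorem dblMax_spec (hT : T ∈ rGK K) (h : |sSup K| ≤ 1 / 2) :
    D.app Prog.dblMax.val T ∈ rG (sSup (mid K)) := by
  obtain ⟨hK, -, hmax, -⟩ := rGK_cases hT
  rw [app_dblMax, hK.sSup_avInv (mem_II_zero.2 h), sub_zero]
  exact dblG_mem hmax h

/-- The results of the program on the Gray code trees of `K`. -/
abbrev concTrees (K : Set ℝ) : Set D := {c | ∃ T ∈ rGK K, c = D.app Prog.concTree.val T}

/-- The value of a step in the program. -/
noncomputable abbrev stepVal (s : Prog) (T : D) : D := D.app (D.app s.val Prog.concTree.val) T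

/-- Subtrees matter only at digits of `E`; elsewhere a value of the right type suffices. This is why
the steps without the digit `0` may use `dblMin` and `dblMax` although these are meaningless there.
-/
theorem step_spec {e x y : Prog} {E : Set ℝ} (he : e.Closed) (hx : x.Closed) (hy : y.Closed)
    (hx' : ∀ Γ, x.HasType Γ (tFun tGK tG)) (hy' : ∀ Γ, y.HasType Γ (tFun tGK tG))
    (hT : T ∈ rGK K) (hE : e.val ∈ rPfin rSD E) (hc : Covers E K)
    (h1 : -1 ∈ E → (part K (-1)).Nonempty) (h2 : 1 ∈ E → (part K 1).Nonempty)
    (h3 : 0 ∈ E → (part K 0).Nonempty ∧ D.app x.val T ∈ rG (sInf (mid K)) ∧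
      D.app y.val T ∈ rG (sSup (mid K))) :
    stepVal (Prog.step e x y) T ∈ rStep tSKstar concTrees K := by
  have he' : ∀ Γ, e.HasType Γ (tPfin tSD) :=
    fun _ => .of_closed he (rPfin_subset rSD_subset _ hE)
  have hT' := rGK_subset K hT
  have htype : stepVal (Prog.step e x y) T ∈ tStep tSKstar := app_mem (app_mem
    (Prog.step_type (Γ := []) he' hx' hy').val_mem Prog.concTree_type.val_mem bot_mem_tFun) hT'
    bot_mem_tProd
  obtain ⟨s, e1, e2, e3, f, hf, e4, e5⟩ := app_step T Prog.concTree.val he hx hy hT'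
  obtain ⟨hK, -, -, k⟩ := rGK_cases hT
  rw [stepVal, e1] at htype ⊢
  refine (mem_rStep adm_tSKstar.bot).2 ⟨E, _, s, rfl, hc, hE, (of_pair_mem_tProd htype).2, ?_⟩
  intro d hd a ha
  rcases mem_rSD.1 ha with ⟨rfl, rfl⟩ | ⟨rfl, rfl⟩ | ⟨rfl, rfl⟩
  · refine ⟨h1 hd, _, ?_, e2⟩
    rw [← tent_part_neg_one]
    exact k _ _ (mem_rGC.2 (Or.inl ⟨rfl, rfl⟩)) (h1 hd)
  · refine ⟨h2 hd, _, ?_, e3⟩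
    have := negGray_spec (k _ _ (mem_rGC.2 (Or.inr ⟨rfl, rfl⟩)) (h2 hd))
    rwa [tent_part_one, IsK.neg_neg_image] at this
  · obtain ⟨hne, hx, hy⟩ := h3 hd
    exact ⟨hne, _, mid_mem hT hne hx hy hf e5, e4⟩

end Correctness

/-! ### The six possible steps and the conditions under which they are correct -/

section Steps

variable {K : Set ℝ} {T : D}

theorem covers_pair {a b : ℝ} (h : ∀ x ∈ K, x ∈ II a ∨ x ∈ II b) : Covers ({a} ∪ {b}) K := by
  intro x hx
  rcases h x hx with h | h
  · exact Set.mem_iUnion₂.2 ⟨a, Or.inl rfl, h⟩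
  · exact Set.mem_iUnion₂.2 ⟨b, Or.inr rfl, h⟩

theorem part_neg_one_nonempty (hK : IsK K) (h : sInf K ≤ 0) : (part K (-1)).Nonempty :=
  ⟨_, (mem_part_sign hK (Or.inl rfl)).2 ⟨hK.isLeast.1, by linarith⟩⟩

theorem part_one_nonempty (hK : IsK K) (h : 0 ≤ sSup K) : (part K 1).Nonempty :=
  ⟨_, (mem_part_sign hK (Or.inr rfl)).2 ⟨hK.isGreatest.1, by linarith⟩⟩

theorem subset_II_neg_one (hK : IsK K) (h : sSup K ≤ 0) : K ⊆ II (-1) := fun x hx =>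
  mem_II.2 ⟨by linarith [hK.bounds hx], by linarith [hK.isGreatest.2 hx]⟩

theorem subset_II_one (hK : IsK K) (h : 0 ≤ sInf K) : K ⊆ II 1 := fun x hx =>
  mem_II.2 ⟨by linarith [hK.isLeast.2 hx], by linarith [hK.bounds hx]⟩

theorem covers_neg_one_one (hK : IsK K) : Covers ({-1} ∪ {1}) K :=
  covers_pair fun x hx => by
    rw [mem_II, mem_II]
    have := hK.bounds hx
    rcases le_total x 0 with h | h
    · left; constructor <;> linarith
    · right; constructor <;> linarith

theorem stepM_spec (hT : T ∈ rGK K) (h : sSup K ≤ 0) :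
    stepVal Prog.stepM T ∈ rStep tSKstar concTrees K := by
  have hK := (rGK_cases hT).1
  have : sInf K ≤ 0 := (hK.isLeast.2 hK.isGreatest.1).trans h
  exact step_spec (E := {-1}) (by simp [Prog.Closed, Prog.ClosedAt]) Prog.dblMin_closed
    Prog.dblMax_closed (fun _ => Prog.dblMin_type) (fun _ => Prog.dblMax_type) hT
    (rPfin_singleton digM_mem) (covers_singleton.2 (subset_II_neg_one hK h))
    (fun _ => part_neg_one_nonempty hK this) (by norm_num) (by norm_num)

theorem stepP_spec (hT : T ∈ rGK K) (h : 0 ≤ sInf K) :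
    stepVal Prog.stepP T ∈ rStep tSKstar concTrees K := by
  have hK := (rGK_cases hT).1
  have : 0 ≤ sSup K := h.trans (hK.isLeast.2 hK.isGreatest.1)
  exact step_spec (E := {1}) (by simp [Prog.Closed, Prog.ClosedAt]) Prog.dblMin_closed
    Prog.dblMax_closed (fun _ => Prog.dblMin_type) (fun _ => Prog.dblMax_type) hT
    (rPfin_singleton digP_mem) (covers_singleton.2 (subset_II_one hK h))
    (by norm_num) (fun _ => part_one_nonempty hK this) (by norm_num)

theorem stepMP_spec (hT : T ∈ rGK K) (h : sInf K ≤ 0) (h' : 0 ≤ sSup K) :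
    stepVal Prog.stepMP T ∈ rStep tSKstar concTrees K := by
  have hK := (rGK_cases hT).1
  exact step_spec (E := {-1} ∪ {1}) (by simp [Prog.Closed, Prog.ClosedAt]) Prog.dblMin_closed
    Prog.dblMax_closed (fun _ => Prog.dblMin_type) (fun _ => Prog.dblMax_type) hT
    (rPfin_union (rPfin_singleton digM_mem) digP_mem) (covers_neg_one_one hK)
    (fun _ => part_neg_one_nonempty hK h) (fun _ => part_one_nonempty hK h') (by norm_num)

theorem stepZ_spec (hT : T ∈ rGK K) (h : |sInf K| ≤ 1 / 2) (h' : |sSup K| ≤ 1 / 2) :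
    stepVal Prog.stepZ T ∈ rStep tSKstar concTrees K := by
  have hK := (rGK_cases hT).1
  refine step_spec (E := {0}) (by simp [Prog.Closed, Prog.ClosedAt]) Prog.dblMin_closed
    Prog.dblMax_closed (fun _ => Prog.dblMin_type) (fun _ => Prog.dblMax_type) hT
    (rPfin_singleton digZ_mem) (covers_singleton.2 fun x hx => mem_II_zero.2 (abs_le.2 ⟨?_, ?_⟩))
    (by norm_num) (by norm_num)
    (fun _ => ⟨part_zero_nonempty hK.isLeast.1 h, dblMin_spec hT h, dblMax_spec hT h'⟩)
  · linarith [hK.isLeast.2 hx, (abs_le.1 h).1]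
  · linarith [hK.isGreatest.2 hx, (abs_le.1 h').2]

/-- The point `y` has two uses: it shows that the middle part is non-empty, and that its minimum is
not positive, so that `midMin` is correct. The maximum of the middle part is that of `K`, doubled.
-/
theorem stepMZ_spec (hT : T ∈ rGK K) (h : |sSup K| ≤ 1 / 2) {y : ℝ} (hy : y ∈ K)
    (hy' : |y| ≤ 1 / 2) (h0 : y ≤ 0) : stepVal Prog.stepMZ T ∈ rStep tSKstar concTrees K := by
  have hK := (rGK_cases hT).1
  refine step_spec (E := {-1} ∪ {0}) (by simp [Prog.Closed, Prog.ClosedAt]) Prog.midMin_closed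
    Prog.dblMax_closed (fun _ => Prog.midMin_type) (fun _ => Prog.dblMax_type) hT
    (rPfin_union (rPfin_singleton digM_mem) digZ_mem) (covers_pair fun x hx => ?_)
    (fun _ => part_neg_one_nonempty hK ((hK.isLeast.2 hy).trans h0)) (by norm_num)
    (fun _ => ⟨part_zero_nonempty hy hy', midMin_spec hT hy hy' h0, dblMax_spec hT h⟩)
  have h1 := hK.bounds hx
  have h2 := (hK.isGreatest.2 hx).trans (abs_le.1 h).2
  rw [mem_II, mem_II]
  rcases le_total x 0 with h | h
  · left; constructor <;> linarith
  · right; constructor <;> linarith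

theorem stepZP_spec (hT : T ∈ rGK K) (h : |sInf K| ≤ 1 / 2) {y : ℝ} (hy : y ∈ K)
    (hy' : |y| ≤ 1 / 2) (h0 : 0 ≤ y) : stepVal Prog.stepZP T ∈ rStep tSKstar concTrees K := by
  have hK := (rGK_cases hT).1
  refine step_spec (E := {0} ∪ {1}) (by simp [Prog.Closed, Prog.ClosedAt]) Prog.dblMin_closed
    Prog.midMax_closed (fun _ => Prog.dblMin_type) (fun _ => Prog.midMax_type) hT
    (rPfin_union (rPfin_singleton digZ_mem) digP_mem) (covers_pair fun x hx => ?_)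
    (by norm_num) (fun _ => part_one_nonempty hK (h0.trans (hK.isGreatest.2 hy)))
    (fun _ => ⟨part_zero_nonempty hy hy', dblMin_spec hT h, midMax_spec hT hy hy' h0⟩)
  have h1 := hK.bounds hx
  have h2 := (abs_le.1 h).1.trans (hK.isLeast.2 hx)
  rw [mem_II, mem_II]
  rcases le_total x 0 with h | h
  · left; constructor <;> linarith
  · right; constructor <;> linarith

end Steps

/-! ### Realisers behind finitely many layers of `Amb` -/

section Concurrency

variable {T R : Set D} {a b : D}

theorem rStar_eq : rStar T R = rConc (tSum T (tStar T)) (rOr R (rStar T R)) :=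
  mu_unfold (Φ := fun X => rConc (tSum T (tStar T)) (rOr R X)) fun _ _ h => by
    rintro c ⟨a, b, e, ha, hb, hab, h1, h2⟩
    have mono := Set.union_subset_union (le_refl (D.left '' R)) (Set.image_mono (f := D.right) h)
    exact ⟨a, b, e, ha, hb, hab, fun k => mono (h1 k), fun k => mono (h2 k)⟩

/-- The types of both alternatives come from the type of the whole, so what remains is that one
alternative terminates and that each terminating one is correct. -/
theorem amb_mem_rStar (hab : D.amb a b ∈ tStar T) (h : a = ⊥ → b ≠ ⊥)
    (ha : a ≠ ⊥ → a ∈ rOr R (rStar T R)) (hb : b ≠ ⊥ → b ∈ rOr R (rStar T R)) :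
    D.amb a b ∈ rStar T R := by
  rw [tStar_eq] at hab
  rcases mem_tAmb.1 hab with e | ⟨a', ha', b', hb', e⟩
  · exact absurd e (D.ne_bot_of_view (by simp))
  · obtain ⟨rfl, rfl⟩ := D.amb_inj e
    rw [rStar_eq]
    exact ⟨_, _, rfl, ha', hb', by tauto, ha, hb⟩

theorem right_ne_bot (a : D) : D.right a ≠ ⊥ := D.ne_bot_of_view (by simp)

theorem left_ne_bot (a : D) : D.left a ≠ ⊥ := D.ne_bot_of_view (by simp)

theorem of_amb_mem_tStar (h : D.amb a b ∈ tStar T) :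
    a ∈ tSum T (tStar T) ∧ b ∈ tSum T (tStar T) := by
  rw [tStar_eq] at h
  rcases mem_tAmb.1 h with e | ⟨a', ha', b', hb', e⟩
  · exact absurd e (D.ne_bot_of_view (by simp))
  · obtain ⟨rfl, rfl⟩ := D.amb_inj e
    exact ⟨ha', hb'⟩

theorem of_right_mem_tSum {U : Set D} (h : D.right a ∈ tSum T U) : a ∈ U := by
  rcases mem_tSum.1 h with e | ⟨a', ha', e⟩ | ⟨a', ha', e⟩
  · exact absurd e (right_ne_bot _)
  · have := congrArg D.view e
    simp at this
  · rwa [D.right_inj e]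

end Concurrency

/-! ### Termination and correctness of the concurrent program -/

section Program

variable {K : Set ℝ} {T : D}

/-- The tests in the program diverge on every answer but `Right`; a terminating test has therefore
been passed. -/
theorem exists_eq_right {w : D} {r : D → D} (h : D.caseS w (fun _ => ⊥) r ≠ ⊥) :
    ∃ v, w = D.right v := by
  rcases D.cases w with rfl | rfl | ⟨a, rfl⟩ | ⟨a, rfl⟩ | ⟨a, b, rfl⟩ | ⟨f, rfl⟩ | ⟨a, b, rfl⟩
  on_goal 4 => exact ⟨a, rfl⟩
  all_goals exact absurd (by simp [D.caseS, D.elim]) h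

theorem nonneg_of_rSign {x : ℝ} {u : D} (h : D.right u ∈ rSign x) : 0 ≤ x := by
  rcases rSign_cases h with ⟨e, h⟩ | ⟨v, e, -⟩ | ⟨v, -, h⟩
  · exact h.ge
  · have := congrArg D.view e
    simp at this
  · exact h

/-- A Gray digit is defined away from `0`, so a test for a positive number cannot diverge. -/
theorem rSign_pos {x : ℝ} {g : D} (h : g ∈ rSign x) (hx : 0 < x) : ∃ u, g = D.right u := by
  rcases rSign_cases h with ⟨-, h⟩ | ⟨v, -, h⟩ | ⟨v, e, -⟩
  · exact absurd h hx.ne'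
  · exact absurd h hx.not_ge
  · exact ⟨v, e⟩

/-- The meaning of the second Gray digit. -/
theorem abs_le_half {x : ℝ} : 0 ≤ tent x ↔ |x| ≤ 1 / 2 := by
  rw [tent]
  constructor <;> intro <;> linarith

/-- The sign of the maximum of the subtree of the Gray code tree `T` at the digit `g`. -/
noncomputable abbrev subMax (T g : D) : D := D.fst (D.fst (D.snd (D.app (D.snd (D.snd T)) g)))

section SubMax

variable {d : ℝ} {g : D}

theorem subMax_mem (hT : T ∈ rGK K) (hg : g ∈ rGC d) (hne : (part K d).Nonempty) :
    subMax T g ∈ rSign (sSup (tent '' part K d)) :=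
  (rG_cases (rGK_cases ((rGK_cases hT).2.2.2 d g hg hne)).2.2.1).2.1

/-- The maximum of the tent image is attained, and `0 ≤ t y` says `|y| ≤ 1/2`. -/
theorem exists_of_subMax (hT : T ∈ rGK K) (hg : g ∈ rGC d) (hne : (part K d).Nonempty) {u : D}
    (h : subMax T g = D.right u) : ∃ y ∈ K, |y| ≤ 1 / 2 ∧ 0 ≤ d * y := by
  have hK := (rGK_cases hT).1
  obtain ⟨y, hy, e⟩ := (hK.tent hne).isGreatest.1
  have := nonneg_of_rSign (h ▸ subMax_mem hT hg hne)
  rw [← e, abs_le_half] at this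
  have hy := (mem_part_sign hK ((mem_rGC.1 hg).imp And.left And.left)).1 hy
  exact ⟨y, hy.1, this, hy.2⟩

/-- If `0 ∈ K`, the maximum is at least `t 0 = 1`, so the test succeeds. -/
theorem exists_subMax_eq (hT : T ∈ rGK K) (hg : g ∈ rGC d) (h0 : 0 ∈ K) :
    ∃ u, subMax T g = D.right u := by
  have hK := (rGK_cases hT).1
  have h0 : 0 ∈ part K d :=
    (mem_part_sign hK ((mem_rGC.1 hg).imp And.left And.left)).2 ⟨h0, by simp⟩
  have h1 := (hK.tent ⟨0, h0⟩).isGreatest.2 ⟨0, h0, rfl⟩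
  exact rSign_pos (subMax_mem hT hg ⟨0, h0⟩) (lt_of_lt_of_le (by norm_num [tent]) h1)

end SubMax

/-- The outer `Amb` runs the sign test of the minimum against the tests for `|min K| ≤ 1/2` and for
a small point in the right half. The inner one does the same for the maximum, with a small point in
the left half if it has to be found there. A sign test diverges only at `0`, and then `0 ∈ K` makes
all rival tests succeed. Two layers of `Amb` are enough. -/
theorem concTree_spec (hT : T ∈ rGK K) : D.app Prog.concTree.val T ∈
    rStar (tStep tSKstar) (rStep tSKstar concTrees K) := by
  have htype := app_mem (Prog.concTree_type (Γ := [])).val_mem (rGK_subset K hT) adm_tSKstar.bot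
  obtain ⟨hK, hmin, hmax, -⟩ := rGK_cases hT
  obtain ⟨-, hmin1, hmin2⟩ := rG_cases hmin
  obtain ⟨-, hmax1, hmax2⟩ := rG_cases hmax
  have hmin2 := (rG_cases hmin2).2.1
  have hmax2 := (rG_cases hmax2).2.1
  have hle := hK.isLeast.2 hK.isGreatest.1
  have gM : D.left D.nil ∈ rGC (-1) := mem_rGC.2 (Or.inl ⟨rfl, rfl⟩)
  have gP : D.right D.nil ∈ rGC 1 := mem_rGC.2 (Or.inr ⟨rfl, rfl⟩)
  have t0 : 0 < tent 0 := by norm_num [tent]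
  rw [tSKstar_eq, app_concTree] at htype
  rw [app_concTree]
  dsimp only at htype ⊢
  obtain ⟨hA, hB⟩ := of_amb_mem_tStar htype
  refine amb_mem_rStar htype ?_ ?_ ?_
  · clear htype hA hB
    -- If the first alternative diverges then `min K = 0`: the second digit is the sign of `t 0 =
    -- 1`, and `0 ∈ K` gives the point in the right half.
    rcases rSign_cases hmin1 with ⟨-, h⟩ | ⟨u, e, -⟩ | ⟨u, e, -⟩
    · intro _
      obtain ⟨v, e⟩ := rSign_pos hmin2 (by rwa [h])
      obtain ⟨w, e'⟩ := exists_subMax_eq hT gP (h ▸ hK.isLeast.1)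
      rw [subMax] at e'
      rw [e, D.caseS_right, e', D.caseS_right]
      exact right_ne_bot _
    · intro h; rw [e, D.caseS_left] at h; exact absurd h (right_ne_bot _)
    · intro h; rw [e, D.caseS_right] at h; exact absurd h (left_ne_bot _)
  · clear htype hB
    intro hne
    rcases rSign_cases hmin1 with ⟨e, -⟩ | ⟨u, e, h⟩ | ⟨u, e, h⟩
    · rw [e, D.caseS_bot] at hne; exact absurd rfl hne
    · rw [e, D.caseS_left] at hA ⊢
      refine Or.inr ⟨_, amb_mem_rStar (of_right_mem_tSum hA) ?_ ?_ ?_, rfl⟩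
      -- The same argument for the maximum, with `0 ∈ K` now used as a point of the left half.
      · rcases rSign_cases hmax1 with ⟨-, h'⟩ | ⟨v, e, -⟩ | ⟨v, e, -⟩
        · intro _
          obtain ⟨v, e⟩ := rSign_pos hmax2 (by rwa [h'])
          obtain ⟨w, e'⟩ := exists_subMax_eq hT gM (h' ▸ hK.isGreatest.1)
          rw [subMax] at e'
          rw [e, D.caseS_right, e', D.caseS_right]
          exact left_ne_bot _
        · intro h; rw [e, D.caseS_left] at h; exact absurd h (left_ne_bot _)
        · intro h; rw [e, D.caseS_right] at h; exact absurd h (left_ne_bot _)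
      · intro hne
        rcases rSign_cases hmax1 with ⟨e, -⟩ | ⟨v, e, h'⟩ | ⟨v, e, h'⟩
        · rw [e, D.caseS_bot] at hne; exact absurd rfl hne
        · rw [e, D.caseS_left]; exact Or.inl ⟨_, stepM_spec hT h', rfl⟩
        · rw [e, D.caseS_right]; exact Or.inl ⟨_, stepMP_spec hT h h', rfl⟩
      · intro hne
        obtain ⟨v, e⟩ := exists_eq_right hne
        rw [e, D.caseS_right] at hne ⊢
        obtain ⟨w, e'⟩ := exists_eq_right hne
        -- The digit read from the subtree at `-1` is meaningful because `min K ≤ 0` makes the left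
        -- half non-empty.
        obtain ⟨y, hy, h1, h2⟩ := exists_of_subMax hT gM (part_neg_one_nonempty hK h) e'
        rw [e', D.caseS_right]
        exact Or.inl ⟨_, stepMZ_spec hT (abs_le_half.1 (nonneg_of_rSign (e ▸ hmax2))) hy h1
          (by linarith), rfl⟩
    · rw [e, D.caseS_right]; exact Or.inl ⟨_, stepP_spec hT h, rfl⟩
  · clear htype hA
    intro hne
    obtain ⟨v, e⟩ := exists_eq_right hne
    have h := abs_le_half.1 (nonneg_of_rSign (e ▸ hmin2))
    rw [e, D.caseS_right] at hne hB ⊢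
    obtain ⟨w, e'⟩ := exists_eq_right hne
    rw [e', D.caseS_right] at hB ⊢
    -- The right half may be empty here, in which case the test `e'` was passed by accident. It is
    -- used only once `max K ≥ 0` is known.
    refine Or.inr ⟨_, amb_mem_rStar (of_right_mem_tSum hB) ?_ ?_ ?_, rfl⟩
    · rcases rSign_cases hmax1 with ⟨-, h'⟩ | ⟨v, e, -⟩ | ⟨v, e, -⟩
      · intro _
        obtain ⟨v, e⟩ := rSign_pos hmax2 (by rwa [h'])
        rw [e, D.caseS_right]
        exact left_ne_bot _
      · intro h; rw [e, D.caseS_left] at h; exact absurd h (left_ne_bot _)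
      · intro h; rw [e, D.caseS_right] at h; exact absurd h (left_ne_bot _)
    · intro hne
      rcases rSign_cases hmax1 with ⟨e, -⟩ | ⟨v, e, h'⟩ | ⟨v, e, h'⟩
      · rw [e, D.caseS_bot] at hne; exact absurd rfl hne
      · rw [e, D.caseS_left]; exact Or.inl ⟨_, stepM_spec hT h', rfl⟩
      · obtain ⟨y, hy, h1, h2⟩ := exists_of_subMax hT gP (part_one_nonempty hK h') e'
        rw [e, D.caseS_right]
        exact Or.inl ⟨_, stepZP_spec hT h hy h1 (by linarith), rfl⟩
    · intro hne
      obtain ⟨v, e⟩ := exists_eq_right hne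
      rw [e, D.caseS_right]
      exact Or.inl ⟨_, stepZ_spec hT h (abs_le_half.1 (nonneg_of_rSign (e ▸ hmax2))), rfl⟩

theorem concTree_realises (K : Set ℝ) :
    Prog.concTree.val ∈ rImp tGK tSKstar (rGK K) (rSKstar K) := by
  refine ⟨(Prog.concTree_type (Γ := [])).val_mem, fun T hT => ?_⟩
  -- The coinductive witness consists of the results of the program itself; the least fixed point
  -- inside has been dealt with in `concTree_spec`.
  refine le_nu (Φ := fun (Y : Set ℝ → Set D) K =>
    {c | IsK K ∧ c ∈ rStar (tStep tSKstar) (rStep tSKstar Y K)}) (x := concTrees) ?_ K ⟨T, hT, rfl⟩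
  rintro K _ ⟨T, hT, rfl⟩
  exact ⟨(rGK_cases hT).1, concTree_spec hT⟩

end Program

/-! ## The inclusions -/

/-- The sign condition is a classical tautology and `t` maps `[-1, 1]` to itself, so every point has
a Gray code. -/
theorem mem_G {x : ℝ} (hx : -1 ≤ x ∧ x ≤ 1) : x ∈ G :=
  le_nu (x := {x : ℝ | -1 ≤ x ∧ x ≤ 1}) (fun x hx => ⟨hx, fun _ => le_total x 0, tent_mem hx⟩) hx

theorem mem_GK {K : Set ℝ} (hK : IsK K) : K ∈ GK :=
  le_nu (x := {K | IsK K}) (fun _ hK => ⟨hK, mem_G (hK.bounds hK.isLeast.1),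
    mem_G (hK.bounds hK.isGreatest.1), fun _ _ hd => hK.tent hd⟩) hK

theorem SK_subset_GK : SK ⊆ GK := by
  rintro K ⟨Y, hY, hK⟩
  exact mem_GK (hY hK).1

theorem Pfin_singleton {P : Set ℝ} {x : ℝ} (h : x ∈ P) : {x} ∈ Pfin P := by
  rintro Z hZ
  exact hZ (Or.inl ⟨x, h, rfl⟩)

theorem Pfin_union {P u : Set ℝ} {x : ℝ} (hu : u ∈ Pfin P) (h : x ∈ P) : u ∪ {x} ∈ Pfin P := by
  rintro Z hZ
  exact hZ (Or.inr ⟨u, hu Z hZ, x, h, rfl⟩)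

/-- The two halves cover `K`; only those digits are taken whose half is certainly non-empty, as
decided by the signs of maximum and minimum. -/
theorem mem_Step {K : Set ℝ} (hK : IsK K) : K ∈ Step {K | IsK K} := by
  have hav : ∀ {d}, (part K d).Nonempty → (part K d).Nonempty ∧ avInv d '' part K d ∈ {K | IsK K} :=
    fun h => ⟨h, hK.avInv h⟩
  have hle := hK.isLeast.2 hK.isGreatest.1
  have hM : (-1 : ℝ) ∈ SD := Or.inl (Or.inl rfl)
  have hP : (1 : ℝ) ∈ SD := Or.inl (Or.inr rfl)
  by_cases h : sSup K ≤ 0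
  · refine ⟨{-1}, Pfin_singleton hM, covers_singleton.2 (subset_II_neg_one hK h), ?_⟩
    rintro _ rfl
    exact hav (part_neg_one_nonempty hK (hle.trans h))
  by_cases h' : 0 ≤ sInf K
  · refine ⟨{1}, Pfin_singleton hP, covers_singleton.2 (subset_II_one hK h'), ?_⟩
    rintro _ rfl
    exact hav (part_one_nonempty hK (h'.trans hle))
  refine ⟨{-1} ∪ {1}, Pfin_union (Pfin_singleton hM) hP, covers_neg_one_one hK, ?_⟩
  rintro _ (rfl | rfl)
  · exact hav (part_neg_one_nonempty hK (not_le.1 h').le)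
  · exact hav (part_one_nonempty hK (not_le.1 h).le)

theorem GK_subset_SKstar : GK ⊆ SKstar := by
  rintro K ⟨Y, hY, hK⟩
  refine le_nu (x := {K | IsK K}) (fun K hK => ⟨hK, ?_⟩) (hY hK).1
  exact fun X hX => hX (Or.inl (mem_Step hK))

end CFP

/-- The inclusions `SK ⊆ GK ⊆ SKstar`, together with their computational content: each is realised,
uniformly in `K`, by a closed program, the first one by a sequential program. -/
theorem mainTheorem3 :
    (CFP.SK ⊆ CFP.GK ∧ CFP.GK ⊆ CFP.SKstar) ∧
    (∃ M : CFP.Prog, M.Closed ∧ M.Sequential ∧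
      ∀ K : Set ℝ, M.val ∈ CFP.rImp CFP.tSK CFP.tGK (CFP.rSK K) (CFP.rGK K)) ∧
    (∃ M : CFP.Prog, M.Closed ∧
      ∀ K : Set ℝ, M.val ∈ CFP.rImp CFP.tGK CFP.tSKstar (CFP.rGK K) (CFP.rSKstar K)) :=
  ⟨⟨CFP.SK_subset_GK, CFP.GK_subset_SKstar⟩,
    ⟨CFP.Prog.grayTree, CFP.Prog.grayTree_closed, CFP.Prog.grayTree_sequential,
      CFP.grayTree_realises⟩,
    ⟨CFP.Prog.concTree, CFP.Prog.concTree_closed, CFP.concTree_realises⟩⟩
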